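/- **Setting.** Let $(\mathrm{KeyGen},\mathrm{Enc},\mathrm{Dec})$ be an additively homomorphic public-key encryption scheme whose plaintexts, for security parameter $\kappa$, form a finite commutative ring $R=R_\kappa$ (the same for all keys). A string is called a ciphertext $[\![v]\!]$ of $v$ under $pk$ if it arises from encryptions by homomorphic operations that compute $v$. Assume: (i) all algorithms of the scheme and the arithmetic of $R$ run in polynomial time, and uniform elements of $R$ can be sampled in probabilistic polynomial time (PPT) up to negligible statistical distance; (ii) decryption is correct on all ciphertexts, where $[\![u]\!]+[\![v]\!]=[\![u+v]\!]$ and $u[\![v]\!]=[\![uv]\!]$; (iii) for every ciphertext $[\![u]\!]$ the scalar addition $[\![u]\!]+\mathrm{Enc}(v,pk)$ is distributed as $\mathrm{Enc}(u+v,pk)$ up to negligible statistical distance; (iv) the scheme is IND-CPA secure against non-uniform PPT adversaries. Two parties $A$, $B$ have independent honestly generated key pairs and know each other's public key; $[\![\cdot]\!]_\diamond$ denotes entrywise ciphertexts under the key of party $\diamond$, and $\bar\diamond$ is the other party. All matrix shapes are fixed. The features $X_\diamond$ of $\diamond$ form a $BS\times F_\diamond$ matrix of categorical indices; $\mathrm{lkup}(Q,X)_{i,(f,d)}=Q_{X_{if},d}$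 and $\mathrm{lkup\_bw}(G,X)_{t,d}=\sum_{(i,f):X_{if}=t}G_{i,(f,d)}$. Embedding tables and weights are shared as $Q_\diamond=S_\diamond+T_\diamond$, $W_\diamond=U_\diamond+V_\diamond$; party $\diamond$ holds $X_\diamond,S_\diamond,U_\diamond,T_{\bar\diamond},V_{\bar\diamond}$ and $[\![T_\diamond]\!]_{\bar\diamond},[\![V_\diamond]\!]_{\bar\diamond},[\![U_{\bar\diamond}]\!]_{\bar\diamond}$. Put $E_\diamond=\mathrm{lkup}(Q_\diamond,X_\diamond)$. $\mathrm{HE2SS}$ turns $[\![v]\!]_{\bar\diamond}$ held by $\diamond$ into shares: $\diamond$ draws a uniform mask $\varphi$, keeps $\varphi$ and sends $[\![v]\!]_{\bar\diamond}+\mathrm{Enc}(-\varphi,pk_{\bar\diamond})$, which $\bar\diamond$ decrypts to $v-\varphi$. **Functionalities.** $\mathcal F_{\mathrm{EmbedMatMulFw}}$ takes the data above; $A$ outputs nothing and $B$ outputs $Z=E_AW_A+E_BW_B$. $\mathcal F_{\mathrm{EmbedMatMulBw}}$ takes in addition the shares $\psi_A,\ E_B-\psi_B$ from $A$ and $\psi_B,\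 E_A-\psi_A,\ \nabla Z$ from $B$. With $\nabla W_\diamond=E_\diamond^T\nabla Z$, $\nabla E_\diamond=\nabla Z\,W_\diamond^T$, $\nabla Q_\diamond=\mathrm{lkup\_bw}(\nabla E_\diamond,X_\diamond)$ and uniformly random $\phi,\xi,\rho_A,\rho_B$, party $A$ outputs $\phi,\ \xi,\ \rho_A,\ \nabla Q_B-\rho_B$ and party $B$ outputs $\nabla W_A-\phi,\ \nabla W_B-\xi,\ \nabla Q_A-\rho_A,\ \rho_B$. **Forward protocol.** Each $\diamond$ applies HE2SS to $\mathrm{lkup}([\![T_\diamond]\!]_{\bar\diamond},X_\diamond)$ with mask $\varepsilon_\diamond$, sets $\psi_\diamond=\mathrm{lkup}(S_\diamond,X_\diamond)+\varepsilon_\diamond$ and decrypts $E_{\bar\diamond}-\psi_{\bar\diamond}$. It then applies HE2SS to $\psi_\diamond[\![V_\diamond]\!]_{\bar\diamond}$ and to $(E_{\bar\diamond}-\psi_{\bar\diamond})[\![U_{\bar\diamond}]\!]_{\bar\diamond}$, and adds $\psi_\diamond U_\diamond$, $(E_{\bar\diamond}-\psi_{\bar\diamond})V_{\bar\diamond}$,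 its two masks and the two decrypted shares to $Z'_\diamond$. $A$ sends $Z'_A$, and $B$ outputs $Z'_A+Z'_B$. **Backward protocol.** $B$ sends $[\![\nabla Z]\!]_B$ and $[\![\nabla Z\,V_A^T]\!]_B$. $A$ applies HE2SS to $\psi_A^T[\![\nabla Z]\!]_B$ (mask $\phi$) and to $(E_B-\psi_B)^T[\![\nabla Z]\!]_B$ (mask $\xi$); $B$ adds $(E_A-\psi_A)^T\nabla Z$ and $\psi_B^T\nabla Z$ to obtain $\nabla W_A-\phi$ and $\nabla W_B-\xi$. $A$ sends $[\![\phi]\!]_A,[\![\xi]\!]_A$ and $B$ sends $[\![\nabla W_A-\phi]\!]_B,[\![\nabla W_B-\xi]\!]_B$. $A$ computes $[\![\nabla E_A]\!]_B=[\![\nabla Z]\!]_BU_A^T+[\![\nabla Z\,V_A^T]\!]_B$, $B$ computes $[\![\nabla E_B]\!]_A=\nabla Z[\![V_B]\!]_A^T+\nabla Z\,U_B^T$; each applies $\mathrm{lkup\_bw}(\cdot,X_\diamond)$ and HE2SS with mask $\rho_\diamond$; finally $A$ sends $[\![\nabla Q_B-\rho_B]\!]_A$ and $B$ sends $[\![\nabla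 Q_A-\rho_A]\!]_B$. The outputs are the shares listed above. **Theorem.** The forward protocol securely realizes $\mathcal F_{\mathrm{EmbedMatMulFw}}$ and the backward protocol securely realizes $\mathcal F_{\mathrm{EmbedMatMulBw}}$ in the presence of a semi-honest adversary that corrupts one party: for either corrupted party $P$ and every PPT adversary, which is given the view of $P$ (its keys, input, randomness and received messages), there is a PPT simulator, which is given only the keys, input and output of $P$, such that every non-uniform PPT environment, which knows both public keys and the secret key of $P$, chooses the inputs of both parties (consistently: the encrypted pieces are ciphertexts of the other party's plain pieces, and the activation shares add up to $E_A,E_B$), and finally sees the output of the adversary or simulator and the outputs of both parties, distinguishes the real from the ideal interaction with at most negligible advantage in $\kappa$. Moreover, in every execution of the backward protocol and for every learning rate $\eta\in R$, if the parties subtract $\eta$ times their gradient shares from their plain pieces and, homomorphically, $\eta$ times the received encrypted shares from their encrypted pieces, the new pieces are again consistent and represent $W_\diamond-\eta\nabla W_\diamond$ and $Q_\diamond-\eta\nabla Q_\diamond$. -/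

import Mathlib

open scoped Matrix

noncomputable section

namespace BlindFL

/-! ## Polynomial-time computation -/

/-- Bit strings. -/
abbrev Str := List Bool

/-- Programs of a register machine; every register holds a stack of bits. -/
inductive Prog : Type
  | skip
  | push (b : Bool) (x : ℕ)
  | pop (x : ℕ)
  | seq (s t : Prog)
  /-- Branch on register `x`: empty, top bit `0`, top bit `1`. -/
  | branch (x : ℕ) (sEmpty sFalse sTrue : Prog)
  /-- Repeat `s` as long as register `x` is not empty. -/
  | loop (x : ℕ) (s : Prog)
  /-- Subroutine call: `body` runs on a fresh set of registers, where register `a.2` starts as a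
  copy of the caller's register `a.1` for each `a` in `args` and all others start empty; then
  its register `0` is copied to the caller's register `ret`. -/
  | call (body : Prog) (args : List (ℕ × ℕ)) (ret : ℕ)

abbrev RegState := ℕ → Str

/-- The registers that a subroutine starts with. -/
def frame (σ : RegState) (args : List (ℕ × ℕ)) : RegState :=
  args.foldr (fun a τ => Function.update τ a.2 (σ a.1)) (fun _ => [])

/-- `Exec s σ τ t`: started in `σ`, the program `s` halts in `τ` after `t` steps.
Copying a string costs its length plus one. -/
inductive Exec : Prog → RegState → RegState → ℕ → Prop
  | skip (σ : RegState) : Exec .skip σ σ 1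
  | push (b : Bool) (x : ℕ) (σ : RegState) :
      Exec (.push b x) σ (Function.update σ x (b :: σ x)) 1
  | pop (x : ℕ) (σ : RegState) : Exec (.pop x) σ (Function.update σ x (σ x).tail) 1
  | seq {s₁ s₂ : Prog} {σ τ υ : RegState} {m n : ℕ} :
      Exec s₁ σ τ m → Exec s₂ τ υ n → Exec (.seq s₁ s₂) σ υ (m + n + 1)
  | branchEmpty {x : ℕ} {s₀ s₁ s₂ : Prog} {σ τ : RegState} {m : ℕ} :
      σ x = [] → Exec s₀ σ τ m → Exec (.branch x s₀ s₁ s₂) σ τ (m + 1)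
  | branchFalse {x : ℕ} {s₀ s₁ s₂ : Prog} {σ τ : RegState} {m : ℕ} :
      (σ x).head? = some false → Exec s₁ σ τ m → Exec (.branch x s₀ s₁ s₂) σ τ (m + 1)
  | branchTrue {x : ℕ} {s₀ s₁ s₂ : Prog} {σ τ : RegState} {m : ℕ} :
      (σ x).head? = some true → Exec s₂ σ τ m → Exec (.branch x s₀ s₁ s₂) σ τ (m + 1)
  | loopDone {x : ℕ} {s : Prog} {σ : RegState} : σ x = [] → Exec (.loop x s) σ σ 1
  | loopStep {x : ℕ} {s : Prog} {σ τ υ : RegState} {m n : ℕ} :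
      σ x ≠ [] → Exec s σ τ m → Exec (.loop x s) τ υ n → Exec (.loop x s) σ υ (m + n + 1)
  | call {body : Prog} {args : List (ℕ × ℕ)} {ret : ℕ} {σ τ : RegState} {m : ℕ} :
      Exec body (frame σ args) τ m →
      Exec (.call body args ret) σ (Function.update σ ret (τ 0))
        ((args.map fun a => (σ a.1).length + 1).sum + m + (τ 0).length + 1)

/-- `f` is computable in polynomial time: some program, started with the arguments in fixed
registers, halts with `f v` in register `0` within a number of steps polynomial in the total
length of the arguments. -/
def PolyTime {ι : Type} [Fintype ι] (f : (ι → Str) → Str) : Prop :=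
  ∃ (reg : ι ↪ ℕ) (s : Prog) (p : Polynomial ℕ), ∀ v : ι → Str, ∃ (τ : RegState) (t : ℕ),
    Exec s (Function.extend reg v fun _ => []) τ t ∧ τ 0 = f v ∧
      t ≤ p.eval (∑ i, (v i).length)

/-- The security parameter in unary. -/
def unary (κ : ℕ) : Str := List.replicate κ true

/-- Probabilistic polynomial time: deterministic polynomial time in `1^κ`, the arguments and
finitely many uniformly random bit strings of length polynomial in `κ`. -/
def IsPPT {ι ο : Type} [Fintype ι] [Fintype ο] (F : ℕ → (ι → Str) → PMF (ο → Str)) : Prop :=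
  ∃ (k : ℕ) (q : Fin k → Polynomial ℕ) (f : ο → (Unit ⊕ ι ⊕ Fin k → Str) → Str),
    (∀ j, PolyTime (f j)) ∧
    ∀ κ x, F κ x =
      (PMF.uniformOfFintype (∀ i : Fin k, List.Vector Bool ((q i).eval κ))).map fun r j =>
        f j (Sum.elim (fun _ => unary κ) (Sum.elim x fun i => (r i).toList))

/-- Non-uniform probabilistic polynomial time: in addition, one advice string of length
polynomial in `κ`. -/
def IsNonuniformPPT {ι ο : Type} [Fintype ι] [Fintype ο]
    (F : ℕ → (ι → Str) → PMF (ο → Str)) : Prop :=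
  ∃ (advice : ℕ → Str) (p : Polynomial ℕ) (G : ℕ → (Unit ⊕ ι → Str) → PMF (ο → Str)),
    (∀ κ, (advice κ).length ≤ p.eval κ) ∧ IsPPT G ∧
    ∀ κ x, F κ x = G κ (Sum.elim (fun _ => advice κ) x)

def Negligible (ε : ℕ → ℝ) : Prop :=
  Asymptotics.SuperpolynomialDecay Filter.atTop (fun κ : ℕ => (κ : ℝ)) ε

/-- Statistical (total variation) distance. -/
def statDist {α : Type} (p q : PMF α) : ℝ := (∑' a, |(p a).toReal - (q a).toReal|) / 2

/-- The probability that an algorithm with one output string accepts, i.e. outputs `1`. -/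
def accept (p : PMF (Unit → Str)) : ℝ := (p fun _ => [true]).toReal

/-! ## Encoding of structured data by finitely many strings -/

/-- An element of `α` is handed to an algorithm as a family of strings indexed by `ι`. -/
class StrEnc (ι : outParam Type) (α : Type) where
  toStrs : α → ι → Str

/-- A family of types indexed by the security parameter, encoded by strings over one index set. -/
structure Coded where
  T : ℕ → Type
  Idx : Type
  [fintypeIdx : Fintype Idx]
  toStrs : ∀ κ, T κ → Idx → Str

attribute [instance] Coded.fintypeIdx

def Coded.of {ι : Type} [Fintype ι] (T : ℕ → Type) [∀ κ, StrEnc ι (T κ)] : Coded where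
  T := T
  Idx := ι
  toStrs _ := StrEnc.toStrs

instance : StrEnc Unit Str := ⟨fun s _ => s⟩

instance (n : ℕ) : StrEnc Unit (List.Vector Bool n) := ⟨fun s _ => s.toList⟩

/-- A categorical value is encoded one-hot. -/
instance (n : ℕ) : StrEnc (Fin n) (Fin n) := ⟨fun x v => [decide (x = v)]⟩

instance : StrEnc Empty Unit := ⟨fun _ i => i.elim⟩

instance {ι m α : Type} [StrEnc ι α] : StrEnc (m × ι) (m → α) :=
  ⟨fun f i => StrEnc.toStrs (f i.1) i.2⟩

instance {ι m n α : Type} [StrEnc ι α] : StrEnc (m × n × ι) (Matrix m n α) :=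
  ⟨fun f i => StrEnc.toStrs (f i.1 i.2.1) i.2.2⟩

instance {ι ι' α β : Type} [StrEnc ι α] [StrEnc ι' β] : StrEnc (ι ⊕ ι') (α × β) :=
  ⟨fun x => Sum.elim (StrEnc.toStrs x.1) (StrEnc.toStrs x.2)⟩

instance {m n α : Type} [Nonempty α] : Nonempty (Matrix m n α) :=
  ⟨fun _ _ => Classical.arbitrary α⟩

/-! ## Additively homomorphic encryption -/

/-- The algorithms of an additively homomorphic public-key encryption scheme. Keys and
ciphertexts are bit strings; for security parameter `κ` the plaintexts form a finite commutative
ring `R κ`, and encryption uses uniformly random bits. -/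
structure HEScheme where
  R : ℕ → Type
  [commRing : ∀ κ, CommRing (R κ)]
  [fintype : ∀ κ, Fintype (R κ)]
  /-- The bit string that represents a plaintext. -/
  code : ∀ κ, R κ → Str
  coinLen : Polynomial ℕ
  /-- Public and secret key. -/
  keygen : ℕ → PMF (Str × Str)
  /-- `enc κ pk v r` -/
  enc : ∀ κ, Str → R κ → List.Vector Bool (coinLen.eval κ) → Str
  /-- `dec κ sk c` -/
  dec : ∀ κ, Str → Str → R κ
  /-- Homomorphic addition `add κ pk c d`. -/
  add : ℕ → Str → Str → Str → Str
  /-- Scalar multiplication `smul κ pk u c`. -/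
  smul : ∀ κ, Str → R κ → Str → Str

attribute [instance] HEScheme.commRing HEScheme.fintype

namespace HEScheme

variable (E : HEScheme)

/-- Randomness of one encryption. -/
abbrev Coin (κ : ℕ) : Type := List.Vector Bool (E.coinLen.eval κ)

instance (κ : ℕ) : Nonempty (E.Coin κ) := ⟨List.Vector.replicate _ false⟩

instance (κ : ℕ) : StrEnc Unit (E.R κ) := ⟨fun x _ => E.code κ x⟩

/-- `IsCipher κ pk v c`: the string `c` is a ciphertext `⟦v⟧` under `pk`, i.e. it arises from
encryptions by homomorphic operations that compute `v`. -/
inductive IsCipher (κ : ℕ) (pk : Str) : E.R κ → Str → Prop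
  | enc (v : E.R κ) (r : E.Coin κ) : IsCipher κ pk v (E.enc κ pk v r)
  | add {u v : E.R κ} {c d : Str} :
      IsCipher κ pk u c → IsCipher κ pk v d → IsCipher κ pk (u + v) (E.add κ pk c d)
  | smul (u : E.R κ) {v : E.R κ} {c : Str} :
      IsCipher κ pk v c → IsCipher κ pk (u * v) (E.smul κ pk u c)

/-- All algorithms of the scheme and the arithmetic of the plaintext ring run in polynomial
time, and uniform plaintexts can be sampled up to negligible statistical distance. -/
structure Efficient : Prop where
  code_injective : ∀ κ, Function.Injective (E.code κ)
  code_length : ∃ p : Polynomial ℕ, ∀ κ x, (E.code κ x).length ≤ p.eval κ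
  zero : ∃ f : (Fin 1 → Str) → Str, PolyTime f ∧ ∀ κ, f ![unary κ] = E.code κ 0
  one : ∃ f : (Fin 1 → Str) → Str, PolyTime f ∧ ∀ κ, f ![unary κ] = E.code κ 1
  neg : ∃ f : (Fin 2 → Str) → Str, PolyTime f ∧
    ∀ κ x, f ![unary κ, E.code κ x] = E.code κ (-x)
  plus : ∃ f : (Fin 3 → Str) → Str, PolyTime f ∧
    ∀ κ x y, f ![unary κ, E.code κ x, E.code κ y] = E.code κ (x + y)
  times : ∃ f : (Fin 3 → Str) → Str, PolyTime f ∧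
    ∀ κ x y, f ![unary κ, E.code κ x, E.code κ y] = E.code κ (x * y)
  sample : ∃ (G : ∀ κ, PMF (E.R κ)) (ε : ℕ → ℝ),
    IsPPT (fun κ (_ : Empty → Str) => (G κ).map fun v (_ : Unit) => E.code κ v) ∧ Negligible ε ∧
    ∀ κ, statDist (G κ) (PMF.uniformOfFintype (E.R κ)) ≤ ε κ
  keygen : IsPPT fun κ (_ : Empty → Str) => (E.keygen κ).map fun k => ![k.1, k.2]
  enc : ∃ f : (Fin 4 → Str) → Str, PolyTime f ∧
    ∀ κ pk v r, f ![unary κ, pk, E.code κ v, r.toList] = E.enc κ pk v r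
  dec : ∃ f : (Fin 3 → Str) → Str, PolyTime f ∧
    ∀ κ sk c, f ![unary κ, sk, c] = E.code κ (E.dec κ sk c)
  add : ∃ f : (Fin 4 → Str) → Str, PolyTime f ∧
    ∀ κ pk c d, f ![unary κ, pk, c, d] = E.add κ pk c d
  smul : ∃ f : (Fin 4 → Str) → Str, PolyTime f ∧
    ∀ κ pk u c, f ![unary κ, pk, E.code κ u, c] = E.smul κ pk u c

/-- Decryption recovers the plaintext of every ciphertext. -/
def Correct : Prop :=
  ∀ κ, ∀ k ∈ (E.keygen κ).support, ∀ v c, E.IsCipher κ k.1 v c → E.dec κ k.2 c = v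

/-- `⟦u⟧ + Enc(v, pk)` is distributed as `Enc(u + v, pk)`, up to negligible statistical
distance, for every ciphertext `⟦u⟧`. -/
def Rerandomizing : Prop :=
  ∃ ε : ℕ → ℝ, Negligible ε ∧ ∀ κ, ∀ k ∈ (E.keygen κ).support, ∀ u v c,
    E.IsCipher κ k.1 u c →
      statDist ((PMF.uniformOfFintype (E.Coin κ)).map fun r => E.add κ k.1 c (E.enc κ k.1 v r))
        ((PMF.uniformOfFintype (E.Coin κ)).map fun r => E.enc κ k.1 (u + v) r) ≤ ε κ

/-- The chosen-plaintext game: the adversary sees `pk`, picks two plaintexts and a state, and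
has to tell from the state and a ciphertext which plaintext was encrypted. -/
def cpaGame {σ : Type}
    (choose : ∀ κ, Str → PMF ((E.R κ × E.R κ) × (σ → Str)))
    (guess : ℕ → (σ ⊕ Unit → Str) → PMF (Unit → Str)) (b : Bool) (κ : ℕ) : PMF (Unit → Str) :=
  (E.keygen κ).bind fun k =>
  (choose κ k.1).bind fun m =>
  (PMF.uniformOfFintype (E.Coin κ)).bind fun r =>
  guess κ (Sum.elim m.2 fun _ => E.enc κ k.1 (if b then m.1.2 else m.1.1) r)

/-- Indistinguishability under chosen-plaintext attack, against non-uniform probabilistic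
polynomial-time adversaries. -/
def INDCPA : Prop :=
  ∀ (σ : Type) [Fintype σ]
    (choose : ∀ κ, Str → PMF ((E.R κ × E.R κ) × (σ → Str)))
    (guess : ℕ → (σ ⊕ Unit → Str) → PMF (Unit → Str)),
    IsNonuniformPPT (fun κ (x : Unit → Str) =>
      (choose κ (x ())).map fun m =>
        Sum.elim ![E.code κ m.1.1, E.code κ m.1.2] m.2) →
    IsPPT guess →
    Negligible fun κ =>
      |accept (E.cpaGame choose guess true κ) - accept (E.cpaGame choose guess false κ)|

end HEScheme

/-! ## Secure two-party computation with a semi-honest adversary -/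

inductive Party : Type
  | A
  | B

@[reducible] def Party.other : Party → Party
  | .A => .B
  | .B => .A

/-- The key pairs of both parties. -/
structure Keys where
  pk : Party → Str
  sk : Party → Str

/-- The keys known to a party: both public keys and its own secret key. -/
def Keys.known (k : Keys) (P : Party) : Fin 3 → Str := ![k.pk .A, k.pk .B, k.sk P]

/-- Both parties generate their key pairs independently. -/
def HEScheme.keys (E : HEScheme) (κ : ℕ) : PMF Keys :=
  (E.keygen κ).bind fun a => (E.keygen κ).map fun b =>
    { pk := fun P => match P with
        | .A => a.1
        | .B => b.1
      sk := fun P => match P with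
        | .A => a.2
        | .B => b.2 }

/-- A (randomized) two-party ideal functionality. The parties also hold their keys; `Admissible`
singles out the joint inputs of the kind that the functionality is defined for. -/
structure Functionality where
  Inp : Party → Coded
  Out : Party → Coded
  Admissible : ∀ κ, Keys → (Inp .A).T κ → (Inp .B).T κ → Prop
  eval : ∀ κ, (Inp .A).T κ → (Inp .B).T κ → PMF ((Out .A).T κ × (Out .B).T κ)

/-- A two-party protocol for the inputs and outputs of `F`: each party draws uniform randomness,
`recv` gives the messages that each party receives, and the output of a party is computed from
its keys, input, randomness and received messages. -/
structure Protocol (F : Functionality) where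
  Rand : Party → Coded
  [fintypeRand : ∀ P κ, Fintype ((Rand P).T κ)]
  [nonemptyRand : ∀ P κ, Nonempty ((Rand P).T κ)]
  Recv : Party → Coded
  recv : ∀ κ, Keys → (F.Inp .A).T κ → (F.Inp .B).T κ → (Rand .A).T κ → (Rand .B).T κ →
    ∀ P, (Recv P).T κ
  output : ∀ κ P, (pk : Party → Str) → (sk : Str) →
    (F.Inp P).T κ → (Rand P).T κ → (Recv P).T κ → (F.Out P).T κ

attribute [instance] Protocol.fintypeRand Protocol.nonemptyRand

namespace Protocol

variable {F : Functionality} (pr : Protocol F)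

/-- The index set of the view of `P`: its keys, input, randomness and received messages. -/
abbrev ViewIdx (P : Party) : Type :=
  Fin 3 ⊕ (F.Inp P).Idx ⊕ (pr.Rand P).Idx ⊕ (pr.Recv P).Idx

end Protocol

/-- Choose between the components of a pair. -/
def pick {α : Party → Type} (x : α .A × α .B) : ∀ P, α P
  | .A => x.1
  | .B => x.2

/-- What the environment receives at the end: its own state, the output of the adversary or
simulator, and the outputs of both parties. -/
abbrev FinalIdx (F : Functionality) (σ α : Type) : Type :=
  σ ⊕ α ⊕ (F.Out .A).Idx ⊕ (F.Out .B).Idx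

/-- The type of the first stage of an environment, which sees the keys known to the corrupted
party and picks the inputs of both parties and its own state. -/
abbrev Chooser (F : Functionality) (σ : Type) : Type :=
  ∀ κ, (Fin 3 → Str) → PMF (((F.Inp .A).T κ × (F.Inp .B).T κ) × (σ → Str))

/-- The real interaction, with `P` corrupted by the adversary `adv`. -/
def real (E : HEScheme) {F : Functionality} (pr : Protocol F) (P : Party) {σ α : Type}
    (adv : ℕ → (pr.ViewIdx P → Str) → PMF (α → Str)) (choose : Chooser F σ)
    (dist : ℕ → (FinalIdx F σ α → Str) → PMF (Unit → Str)) (κ : ℕ) : PMF (Unit → Str) :=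
  (E.keys κ).bind fun k =>
  (choose κ (k.known P)).bind fun x =>
  (PMF.uniformOfFintype ((pr.Rand .A).T κ)).bind fun rA =>
  (PMF.uniformOfFintype ((pr.Rand .B).T κ)).bind fun rB =>
  let msgs := pr.recv κ k x.1.1 x.1.2 rA rB
  let outA := pr.output κ .A k.pk (k.sk .A) x.1.1 rA (msgs .A)
  let outB := pr.output κ .B k.pk (k.sk .B) x.1.2 rB (msgs .B)
  let input : (F.Inp P).T κ := pick (α := fun P => (F.Inp P).T κ) x.1 P
  let rand : (pr.Rand P).T κ := pick (α := fun P => (pr.Rand P).T κ) (rA, rB) P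
  (adv κ (Sum.elim (k.known P) (Sum.elim ((F.Inp P).toStrs κ input)
    (Sum.elim ((pr.Rand P).toStrs κ rand) ((pr.Recv P).toStrs κ (msgs P)))))).bind fun a =>
  dist κ (Sum.elim x.2 (Sum.elim a
    (Sum.elim ((F.Out .A).toStrs κ outA) ((F.Out .B).toStrs κ outB))))

/-- The ideal interaction, with `P` corrupted: the simulator sees only the keys, the input and
the output of `P`. -/
def ideal (E : HEScheme) (F : Functionality) (P : Party) {σ α : Type}
    (sim : ℕ → (Fin 3 ⊕ (F.Inp P).Idx ⊕ (F.Out P).Idx → Str) → PMF (α → Str))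
    (choose : Chooser F σ)
    (dist : ℕ → (FinalIdx F σ α → Str) → PMF (Unit → Str)) (κ : ℕ) : PMF (Unit → Str) :=
  (E.keys κ).bind fun k =>
  (choose κ (k.known P)).bind fun x =>
  (F.eval κ x.1.1 x.1.2).bind fun out =>
  let input : (F.Inp P).T κ := pick (α := fun P => (F.Inp P).T κ) x.1 P
  let outP : (F.Out P).T κ := pick (α := fun P => (F.Out P).T κ) out P
  (sim κ (Sum.elim (k.known P)
    (Sum.elim ((F.Inp P).toStrs κ input) ((F.Out P).toStrs κ outP)))).bind fun a =>
  dist κ (Sum.elim x.2 (Sum.elim a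
    (Sum.elim ((F.Out .A).toStrs κ out.1) ((F.Out .B).toStrs κ out.2))))

/-- The first stage of an environment is admissible: it runs in non-uniform probabilistic
polynomial time, and the inputs that it picks are admissible for the keys in use. -/
structure AdmissibleChooser (E : HEScheme) (F : Functionality) (P : Party) {σ : Type} [Fintype σ]
    (choose : Chooser F σ) : Prop where
  ppt : IsNonuniformPPT fun κ (x : Fin 3 → Str) =>
    (choose κ x).map fun y =>
      Sum.elim ((F.Inp .A).toStrs κ y.1.1) (Sum.elim ((F.Inp .B).toStrs κ y.1.2) y.2)
  admissible : ∀ κ, ∀ k ∈ (E.keys κ).support, ∀ y ∈ (choose κ (k.known P)).support,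
    F.Admissible κ k y.1.1 y.1.2

/-- `pr` securely realizes `F` in the presence of a semi-honest adversary that corrupts one
party: for every probabilistic polynomial-time adversary there is a probabilistic
polynomial-time simulator such that no environment can tell the real interaction from the ideal
one, except with negligible probability. -/
def SecurelyRealizes (E : HEScheme) {F : Functionality} (pr : Protocol F) : Prop :=
  ∀ (P : Party) (α : Type) [Fintype α] (adv : ℕ → (pr.ViewIdx P → Str) → PMF (α → Str)),
    IsPPT adv →
    ∃ sim : ℕ → (Fin 3 ⊕ (F.Inp P).Idx ⊕ (F.Out P).Idx → Str) → PMF (α → Str), IsPPT sim ∧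
      ∀ (σ : Type) [Fintype σ] (choose : Chooser F σ)
        (dist : ℕ → (FinalIdx F σ α → Str) → PMF (Unit → Str)),
        AdmissibleChooser E F P choose → IsPPT dist →
        Negligible fun κ =>
          |accept (real E pr P adv choose dist κ) - accept (ideal E F P sim choose dist κ)|

/-! ## The layer: shapes, lookup, and homomorphic matrix operations -/

/-- Batch size, output dimensionality, and for each party the number of categorical fields, the
embedding dimensionality and the size of the vocabulary. -/
structure Shape where
  bs : ℕ
  out : ℕ
  fld : Party → ℕ
  dim : Party → ℕ
  voc : Party → ℕ

namespace Shape

variable (sh : Shape)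

abbrev Batch : Type := Fin sh.bs
abbrev Outs : Type := Fin sh.out
abbrev Fld (P : Party) : Type := Fin (sh.fld P)
abbrev Dim (P : Party) : Type := Fin (sh.dim P)
abbrev Voc (P : Party) : Type := Fin (sh.voc P)

/-- Columns of the embedded batch: one block of embedding coordinates per field. -/
abbrev Ins (P : Party) : Type := sh.Fld P × sh.Dim P

/-- A mini-batch of categorical features. -/
abbrev Feat (P : Party) : Type := sh.Batch → sh.Fld P → sh.Voc P

end Shape

/-- Embedding lookup, for plain as well as for encrypted tables. -/
def lkup {b f v d : Type} {α : Type} (Q : Matrix v d α) (X : b → f → v) : Matrix b (f × d) α :=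
  fun i j => Q (X i j.1) j.2

/-- Backward operation of the lookup: row `t` of the gradient of the table is the sum of the
derivatives of all embedded entries that were looked up in row `t`. -/
def lkupBw {b f v d : Type} [Fintype b] [Fintype f] [DecidableEq v] {α : Type} [AddCommMonoid α]
    (G : Matrix b (f × d) α) (X : b → f → v) : Matrix v d α :=
  fun t c => ∑ p : b × f with X p.1 p.2 = t, G p.1 (p.2, c)

namespace HEScheme

variable (E : HEScheme) (κ : ℕ)

/-- Plaintext matrices, matrices of encryption coins, and the randomness of a transformation
from HE to SS (for each entry a mask and the coins of one encryption). -/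
abbrev Mat (m n : Type) : Type := Matrix m n (E.R κ)
abbrev CoinMat (m n : Type) : Type := Matrix m n (E.Coin κ)
abbrev MaskMat (m n : Type) : Type := Matrix m n (E.R κ × E.Coin κ)

/-- The masks in the randomness of a transformation from HE to SS. -/
def mask {m n : Type} (r : E.MaskMat κ m n) : E.Mat κ m n := r.map Prod.fst

/-- Entrywise ciphertexts. -/
def IsCipherMat {m n : Type} (pk : Str) (M : E.Mat κ m n) (C : Matrix m n Str) : Prop :=
  ∀ i j, E.IsCipher κ pk (M i j) (C i j)

def encMat {m n : Type} (pk : Str) (M : E.Mat κ m n) (r : E.CoinMat κ m n) : Matrix m n Str :=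
  fun i j => E.enc κ pk (M i j) (r i j)

def decMat {m n : Type} (sk : Str) (C : Matrix m n Str) : E.Mat κ m n :=
  C.map (E.dec κ sk)

def addMat {m n : Type} (pk : Str) (C D : Matrix m n Str) : Matrix m n Str :=
  fun i j => E.add κ pk (C i j) (D i j)

def smulMat {m n : Type} (pk : Str) (u : E.R κ) (C : Matrix m n Str) : Matrix m n Str :=
  fun i j => E.smul κ pk u (C i j)

/-- Homomorphic sum, starting from an encryption of zero with fixed coins. -/
def csum (pk : Str) (l : List Str) : Str :=
  l.foldr (E.add κ pk) (E.enc κ pk 0 (List.Vector.replicate _ false))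

/-- `X ⟦Y⟧` -/
def mulLeft {l m n : Type} [Fintype m] (pk : Str) (X : E.Mat κ l m) (C : Matrix m n Str) :
    Matrix l n Str :=
  fun i j => E.csum κ pk ((Finset.univ : Finset m).toList.map fun k =>
    E.smul κ pk (X i k) (C k j))

/-- `⟦Y⟧ X` -/
def mulRight {l m n : Type} [Fintype m] (pk : Str) (C : Matrix l m Str) (X : E.Mat κ m n) :
    Matrix l n Str :=
  fun i j => E.csum κ pk ((Finset.univ : Finset m).toList.map fun k =>
    E.smul κ pk (X k j) (C i k))

/-- `lkup_bw` on encrypted derivatives. -/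
def clkupBw {b f v d : Type} [Fintype b] [Fintype f] [DecidableEq v] (pk : Str)
    (C : Matrix b (f × d) Str) (X : b → f → v) : Matrix v d Str :=
  fun t c => E.csum κ pk
    ((Finset.univ.filter fun p : b × f => X p.1 p.2 = t).toList.map fun p => C p.1 (p.2, c))

/-- The message `⟦v - φ⟧ = ⟦v⟧ + Enc(-φ)` in the transformation of `⟦v⟧` into the shares
`φ` and `v - φ`. -/
def he2ss {m n : Type} (pk : Str) (C : Matrix m n Str) (r : E.MaskMat κ m n) : Matrix m n Str :=
  E.addMat κ pk C (E.encMat κ pk (-(E.mask κ r)) (r.map Prod.snd))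

end HEScheme

section Layer

variable (E : HEScheme) (sh : Shape)

/-- Features and model pieces held by party `P`, where `Q = S + T` are the embedding tables and
`W = U + V` the weights. `P` holds `S, U` of its own model and `T, V` of the model of the other
party in the clear, and `T, V` of its own model and `U` of the model of the other party encrypted
under the key of the other party. -/
structure LayerInput (P : Party) (κ : ℕ) where
  X : sh.Feat P
  S : E.Mat κ (sh.Voc P) (sh.Dim P)
  U : E.Mat κ (sh.Ins P) sh.Outs
  Tother : E.Mat κ (sh.Voc P.other) (sh.Dim P.other)
  Vother : E.Mat κ (sh.Ins P.other) sh.Outs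
  cT : Matrix (sh.Voc P) (sh.Dim P) Str
  cV : Matrix (sh.Ins P) sh.Outs Str
  cUother : Matrix (sh.Ins P.other) sh.Outs Str

variable {E sh} {κ : ℕ}

@[reducible, instance] def layerInputEnc (P : Party) :=
  (⟨fun x => StrEnc.toStrs (x.X, x.S, x.U, x.Tother, x.Vother, x.cT, x.cV, x.cUother)⟩ :
    StrEnc _ (LayerInput E sh P κ))

/-- The encrypted model pieces of each party are ciphertexts of the plain pieces of the other. -/
structure LayerInput.Consistent (k : Keys) (a : LayerInput E sh .A κ) (b : LayerInput E sh .B κ) :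
    Prop where
  cTA : E.IsCipherMat κ (k.pk .B) b.Tother a.cT
  cVA : E.IsCipherMat κ (k.pk .B) b.Vother a.cV
  cUB : E.IsCipherMat κ (k.pk .B) b.U a.cUother
  cTB : E.IsCipherMat κ (k.pk .A) a.Tother b.cT
  cVB : E.IsCipherMat κ (k.pk .A) a.Vother b.cV
  cUA : E.IsCipherMat κ (k.pk .A) a.U b.cUother

section Model

variable (a : LayerInput E sh .A κ) (b : LayerInput E sh .B κ)

/-- Embedding tables `Q = S + T`. -/
def tableA : E.Mat κ (sh.Voc .A) (sh.Dim .A) := a.S + b.Tother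
def tableB : E.Mat κ (sh.Voc .B) (sh.Dim .B) := b.S + a.Tother

/-- Weights `W = U + V`. -/
def weightA : E.Mat κ (sh.Ins .A) sh.Outs := a.U + b.Vother
def weightB : E.Mat κ (sh.Ins .B) sh.Outs := b.U + a.Vother

/-- Embedded batches `E = lkup(Q, X)`. -/
def embedA : E.Mat κ sh.Batch (sh.Ins .A) := lkup (tableA a b) a.X
def embedB : E.Mat κ sh.Batch (sh.Ins .B) := lkup (tableB a b) b.X

/-- Gradients for the derivatives `G` of the output:
`∇W = Eᵀ G` and `∇Q = lkup_bw(G Wᵀ, X)`. -/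
def gradWA (G : E.Mat κ sh.Batch sh.Outs) : E.Mat κ (sh.Ins .A) sh.Outs := (embedA a b)ᵀ * G
def gradWB (G : E.Mat κ sh.Batch sh.Outs) : E.Mat κ (sh.Ins .B) sh.Outs := (embedB a b)ᵀ * G
def gradQA (G : E.Mat κ sh.Batch sh.Outs) : E.Mat κ (sh.Voc .A) (sh.Dim .A) :=
  lkupBw (G * (weightA a b)ᵀ) a.X
def gradQB (G : E.Mat κ sh.Batch sh.Outs) : E.Mat κ (sh.Voc .B) (sh.Dim .B) :=
  lkupBw (G * (weightB a b)ᵀ) b.X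

end Model

/-! ## Forward propagation -/

variable (E sh)

/-- Forward functionality: `A` outputs nothing, `B` outputs `Z = E_A W_A + E_B W_B`. -/
def FEmbedMatMulFw : Functionality where
  Inp P := Coded.of fun κ => LayerInput E sh P κ
  Out
    | .A => Coded.of fun _ => Unit
    | .B => Coded.of fun κ => E.Mat κ sh.Batch sh.Outs
  Admissible _ k a b := LayerInput.Consistent k a b
  eval _ a b := PMF.pure ((), embedA a b * weightA a b + embedB a b * weightB a b)

/-- Randomness of a party in the forward protocol: one transformation from HE to SS for the
lookup, and one for each of the two matrix multiplications. -/
abbrev FwRand (P : Party) (κ : ℕ) : Type :=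
  E.MaskMat κ sh.Batch (sh.Ins P) ×
    E.MaskMat κ sh.Batch sh.Outs × E.MaskMat κ sh.Batch sh.Outs

variable {E sh}

section FwParty

/-! Local computations of party `P`; `pk` is the public key of the other party, `sk` its own
secret key, and `m₁ m₂ m₃` are the three received transformation messages. -/

variable {P : Party} (pk sk : Str) (x : LayerInput E sh P κ) (r : FwRand E sh P κ)
  (m₁ : Matrix sh.Batch (sh.Ins P.other) Str) (m₂ m₃ : Matrix sh.Batch sh.Outs Str)

/-- Message for the share of `lkup(T, X)`. -/
def fwMsg₁ : Matrix sh.Batch (sh.Ins P) Str := E.he2ss κ pk (lkup x.cT x.X) r.1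

/-- Own share `ψ` of the embedded batch of `P`. -/
def fwPsi : E.Mat κ sh.Batch (sh.Ins P) := lkup x.S x.X + E.mask κ r.1

/-- Share `E - ψ` of the embedded batch of the other party. -/
def fwShare : E.Mat κ sh.Batch (sh.Ins P.other) := E.decMat κ sk m₁

/-- Message of the first matrix multiplication, for the share of `ψ V`. -/
def fwMsg₂ : Matrix sh.Batch sh.Outs Str :=
  E.he2ss κ pk (E.mulLeft κ pk (fwPsi x r) x.cV) r.2.1

/-- Message of the second matrix multiplication, for the share of `(E - ψ) U`. -/
def fwMsg₃ : Matrix sh.Batch sh.Outs Str :=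
  E.he2ss κ pk (E.mulLeft κ pk (fwShare (E := E) (sh := sh) (P := P) sk m₁) x.cUother) r.2.2

/-- The share `Z'` of the output: the sum of the results of the two matrix multiplications. -/
def fwZ : E.Mat κ sh.Batch sh.Outs :=
  (fwPsi x r * x.U + E.mask κ r.2.1 + E.decMat κ sk m₂) +
    (fwShare (E := E) (sh := sh) (P := P) sk m₁ * x.Vother + E.mask κ r.2.2 + E.decMat κ sk m₃)

end FwParty

variable (E sh)

/-- Messages received in the forward protocol; `B` also receives `Z'_A`. -/
abbrev FwRecvA (_κ : ℕ) : Type :=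
  Matrix sh.Batch (sh.Ins .B) Str × Matrix sh.Batch sh.Outs Str × Matrix sh.Batch sh.Outs Str
abbrev FwRecvB (κ : ℕ) : Type :=
  Matrix sh.Batch (sh.Ins .A) Str × Matrix sh.Batch sh.Outs Str × Matrix sh.Batch sh.Outs Str ×
    E.Mat κ sh.Batch sh.Outs

/-- The forward protocol. -/
def embedMatMulFw : Protocol (FEmbedMatMulFw E sh) where
  Rand P := Coded.of fun κ => FwRand E sh P κ
  fintypeRand P κ := inferInstanceAs (Fintype (FwRand E sh P κ))
  nonemptyRand P κ := inferInstanceAs (Nonempty (FwRand E sh P κ))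
  Recv
    | .A => Coded.of fun κ => FwRecvA sh κ
    | .B => Coded.of fun κ => FwRecvB E sh κ
  recv κ k (a : LayerInput E sh .A κ) (b : LayerInput E sh .B κ)
      (rA : FwRand E sh .A κ) (rB : FwRand E sh .B κ) :=
    let mA₁ := fwMsg₁ (k.pk .B) a rA
    let mB₁ := fwMsg₁ (k.pk .A) b rB
    let mA₂ := fwMsg₂ (k.pk .B) a rA
    let mB₂ := fwMsg₂ (k.pk .A) b rB
    let mA₃ := fwMsg₃ (k.pk .B) (k.sk .A) a rA mB₁
    let mB₃ := fwMsg₃ (k.pk .A) (k.sk .B) b rB mA₁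
    fun P => match P with
      | .A => ((mB₁, mB₂, mB₃) : FwRecvA sh κ)
      | .B => ((mA₁, mA₂, mA₃, fwZ (k.sk .A) a rA mB₁ mB₂ mB₃) : FwRecvB E sh κ)
  output κ P _ sk := match P with
    | .A => fun _ _ _ => ()
    | .B => fun (b : LayerInput E sh .B κ) (r : FwRand E sh .B κ) (m : FwRecvB E sh κ) =>
        m.2.2.2 + fwZ sk b r m.1 m.2.1 m.2.2.1

/-! ## Backward propagation -/

/-- Backward inputs: `A` adds its activation shares `ψ_A` and `E_B - ψ_B`, and `B` its activation
shares `ψ_B` and `E_A - ψ_A` and the derivatives `∇Z`. -/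
structure BwInputA (κ : ℕ) where
  layer : LayerInput E sh .A κ
  psi : E.Mat κ sh.Batch (sh.Ins .A)
  share : E.Mat κ sh.Batch (sh.Ins .B)

structure BwInputB (κ : ℕ) where
  layer : LayerInput E sh .B κ
  psi : E.Mat κ sh.Batch (sh.Ins .B)
  share : E.Mat κ sh.Batch (sh.Ins .A)
  gradZ : E.Mat κ sh.Batch sh.Outs

/-- Backward outputs: `φ, ξ, ρ_A, ∇Q_B - ρ_B` for `A`, and
`∇W_A - φ, ∇W_B - ξ, ∇Q_A - ρ_A, ρ_B` for `B`. -/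
structure BwOutputA (κ : ℕ) where
  phi : E.Mat κ (sh.Ins .A) sh.Outs
  xi : E.Mat κ (sh.Ins .B) sh.Outs
  rho : E.Mat κ (sh.Voc .A) (sh.Dim .A)
  gradQB : E.Mat κ (sh.Voc .B) (sh.Dim .B)

structure BwOutputB (κ : ℕ) where
  gradWA : E.Mat κ (sh.Ins .A) sh.Outs
  gradWB : E.Mat κ (sh.Ins .B) sh.Outs
  gradQA : E.Mat κ (sh.Voc .A) (sh.Dim .A)
  rho : E.Mat κ (sh.Voc .B) (sh.Dim .B)

variable {E sh}

@[reducible, instance] def bwInputAEnc :=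
  (⟨fun x => StrEnc.toStrs (x.layer, x.psi, x.share)⟩ : StrEnc _ (BwInputA E sh κ))

@[reducible, instance] def bwInputBEnc :=
  (⟨fun x => StrEnc.toStrs (x.layer, x.psi, x.share, x.gradZ)⟩ : StrEnc _ (BwInputB E sh κ))

@[reducible, instance] def bwOutputAEnc :=
  (⟨fun x => StrEnc.toStrs (x.phi, x.xi, x.rho, x.gradQB)⟩ : StrEnc _ (BwOutputA E sh κ))

@[reducible, instance] def bwOutputBEnc :=
  (⟨fun x => StrEnc.toStrs (x.gradWA, x.gradWB, x.gradQA, x.rho)⟩ :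
    StrEnc _ (BwOutputB E sh κ))

structure BwConsistent (k : Keys) (a : BwInputA E sh κ) (b : BwInputB E sh κ) : Prop where
  layer : LayerInput.Consistent k a.layer b.layer
  shareA : a.psi + b.share = embedA a.layer b.layer
  shareB : b.psi + a.share = embedB a.layer b.layer

variable (E sh)

/-- Backward functionality: the gradients are shared with uniformly random pieces
`φ, ξ, ρ_A, ρ_B`. -/
def FEmbedMatMulBw : Functionality where
  Inp
    | .A => Coded.of fun κ => BwInputA E sh κ
    | .B => Coded.of fun κ => BwInputB E sh κ
  Out
    | .A => Coded.of fun κ => BwOutputA E sh κ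
    | .B => Coded.of fun κ => BwOutputB E sh κ
  Admissible κ k (a : BwInputA E sh κ) (b : BwInputB E sh κ) := BwConsistent k a b
  eval κ (a : BwInputA E sh κ) (b : BwInputB E sh κ) :=
    (PMF.uniformOfFintype (E.Mat κ (sh.Ins .A) sh.Outs × E.Mat κ (sh.Ins .B) sh.Outs ×
      E.Mat κ (sh.Voc .A) (sh.Dim .A) × E.Mat κ (sh.Voc .B) (sh.Dim .B))).map fun s =>
      (({ phi := s.1
          xi := s.2.1
          rho := s.2.2.1
          gradQB := gradQB a.layer b.layer b.gradZ - s.2.2.2 } : BwOutputA E sh κ),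
       ({ gradWA := gradWA a.layer b.layer b.gradZ - s.1
          gradWB := gradWB a.layer b.layer b.gradZ - s.2.1
          gradQA := gradQA a.layer b.layer b.gradZ - s.2.2.1
          rho := s.2.2.2 } : BwOutputB E sh κ))

/-- Randomness of `A`: the transformations with masks `φ, ξ, ρ_A`, and the coins of the
encryptions of `φ`, `ξ` and `∇Q_B - ρ_B` under its own key. -/
structure BwRandA (κ : ℕ) where
  phi : E.MaskMat κ (sh.Ins .A) sh.Outs
  xi : E.MaskMat κ (sh.Ins .B) sh.Outs
  rho : E.MaskMat κ (sh.Voc .A) (sh.Dim .A)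
  coinPhi : E.CoinMat κ (sh.Ins .A) sh.Outs
  coinXi : E.CoinMat κ (sh.Ins .B) sh.Outs
  coinQB : E.CoinMat κ (sh.Voc .B) (sh.Dim .B)

/-- Randomness of `B`: the transformation with mask `ρ_B`, the coins of the encryptions of `∇Z`,
`∇Z V_Aᵀ`, `∇W_A - φ`, `∇W_B - ξ` and `∇Q_A - ρ_A` under its own key, and the coins of the
scalar addition of `∇Z U_Bᵀ` to a ciphertext under the key of `A`. -/
structure BwRandB (κ : ℕ) where
  rho : E.MaskMat κ (sh.Voc .B) (sh.Dim .B)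
  coinZ : E.CoinMat κ sh.Batch sh.Outs
  coinZV : E.CoinMat κ sh.Batch (sh.Ins .A)
  coinWA : E.CoinMat κ (sh.Ins .A) sh.Outs
  coinWB : E.CoinMat κ (sh.Ins .B) sh.Outs
  coinQA : E.CoinMat κ (sh.Voc .A) (sh.Dim .A)
  coinZU : E.CoinMat κ sh.Batch (sh.Ins .B)

/-- Messages received by `A`: `⟦∇Z⟧_B`, `⟦∇Z V_Aᵀ⟧_B`, `⟦∇W_A - φ⟧_B`, `⟦∇W_B - ξ⟧_B`,
`⟦∇Q_B - ρ_B⟧_A`, `⟦∇Q_A - ρ_A⟧_B`. -/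
structure BwRecvA where
  cZ : Matrix sh.Batch sh.Outs Str
  cZV : Matrix sh.Batch (sh.Ins .A) Str
  cWA : Matrix (sh.Ins .A) sh.Outs Str
  cWB : Matrix (sh.Ins .B) sh.Outs Str
  mQB : Matrix (sh.Voc .B) (sh.Dim .B) Str
  cQA : Matrix (sh.Voc .A) (sh.Dim .A) Str

/-- Messages received by `B`: `⟦ψ_Aᵀ ∇Z - φ⟧_B`, `⟦(E_B - ψ_B)ᵀ ∇Z - ξ⟧_B`, `⟦φ⟧_A`, `⟦ξ⟧_A`,
`⟦∇Q_A - ρ_A⟧_B`, `⟦∇Q_B - ρ_B⟧_A`. -/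
structure BwRecvB where
  mWA : Matrix (sh.Ins .A) sh.Outs Str
  mWB : Matrix (sh.Ins .B) sh.Outs Str
  cPhi : Matrix (sh.Ins .A) sh.Outs Str
  cXi : Matrix (sh.Ins .B) sh.Outs Str
  mQA : Matrix (sh.Voc .A) (sh.Dim .A) Str
  cQB : Matrix (sh.Voc .B) (sh.Dim .B) Str

def BwRandA.equiv : BwRandA E sh κ ≃
    E.MaskMat κ (sh.Ins .A) sh.Outs × E.MaskMat κ (sh.Ins .B) sh.Outs ×
    E.MaskMat κ (sh.Voc .A) (sh.Dim .A) × E.CoinMat κ (sh.Ins .A) sh.Outs ×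
    E.CoinMat κ (sh.Ins .B) sh.Outs × E.CoinMat κ (sh.Voc .B) (sh.Dim .B) where
  toFun r := (r.phi, r.xi, r.rho, r.coinPhi, r.coinXi, r.coinQB)
  invFun t := ⟨t.1, t.2.1, t.2.2.1, t.2.2.2.1, t.2.2.2.2.1, t.2.2.2.2.2⟩

def BwRandB.equiv : BwRandB E sh κ ≃
    E.MaskMat κ (sh.Voc .B) (sh.Dim .B) × E.CoinMat κ sh.Batch sh.Outs ×
    E.CoinMat κ sh.Batch (sh.Ins .A) × E.CoinMat κ (sh.Ins .A) sh.Outs ×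
    E.CoinMat κ (sh.Ins .B) sh.Outs × E.CoinMat κ (sh.Voc .A) (sh.Dim .A) ×
    E.CoinMat κ sh.Batch (sh.Ins .B) where
  toFun r := (r.rho, r.coinZ, r.coinZV, r.coinWA, r.coinWB, r.coinQA, r.coinZU)
  invFun t := ⟨t.1, t.2.1, t.2.2.1, t.2.2.2.1, t.2.2.2.2.1, t.2.2.2.2.2.1, t.2.2.2.2.2.2⟩

variable {E sh}

instance : Fintype (BwRandA E sh κ) := Fintype.ofEquiv _ (BwRandA.equiv E sh).symm
instance : Nonempty (BwRandA E sh κ) := (BwRandA.equiv E sh).nonempty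
instance : Fintype (BwRandB E sh κ) := Fintype.ofEquiv _ (BwRandB.equiv E sh).symm
instance : Nonempty (BwRandB E sh κ) := (BwRandB.equiv E sh).nonempty

@[reducible, instance] def bwRandAEnc :=
  (⟨fun r => StrEnc.toStrs (BwRandA.equiv E sh r)⟩ : StrEnc _ (BwRandA E sh κ))

@[reducible, instance] def bwRandBEnc :=
  (⟨fun r => StrEnc.toStrs (BwRandB.equiv E sh r)⟩ : StrEnc _ (BwRandB E sh κ))

@[reducible, instance] def bwRecvAEnc :=
  (⟨fun m => StrEnc.toStrs (m.cZ, m.cZV, m.cWA, m.cWB, m.mQB, m.cQA)⟩ : StrEnc _ (BwRecvA sh))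

@[reducible, instance] def bwRecvBEnc :=
  (⟨fun m => StrEnc.toStrs (m.mWA, m.mWB, m.cPhi, m.cXi, m.mQA, m.cQB)⟩ : StrEnc _ (BwRecvB sh))

section BwParty

/-! Local computations. -/

variable (pkA pkB sk : Str)

/-- `A`: message for the share of `ψ_Aᵀ ∇Z`. -/
def bwMsgWA (a : BwInputA E sh κ) (r : BwRandA E sh κ) (cZ : Matrix sh.Batch sh.Outs Str) :
    Matrix (sh.Ins .A) sh.Outs Str :=
  E.he2ss κ pkB (E.mulLeft κ pkB a.psiᵀ cZ) r.phi

/-- `A`: message for the share of `(E_B - ψ_B)ᵀ ∇Z`. -/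
def bwMsgWB (a : BwInputA E sh κ) (r : BwRandA E sh κ) (cZ : Matrix sh.Batch sh.Outs Str) :
    Matrix (sh.Ins .B) sh.Outs Str :=
  E.he2ss κ pkB (E.mulLeft κ pkB a.shareᵀ cZ) r.xi

/-- `B`: its share `∇W_A - φ`. -/
def bwShareWA (b : BwInputB E sh κ) (mWA : Matrix (sh.Ins .A) sh.Outs Str) :
    E.Mat κ (sh.Ins .A) sh.Outs :=
  b.shareᵀ * b.gradZ + E.decMat κ sk mWA

/-- `B`: its share `∇W_B - ξ`. -/
def bwShareWB (b : BwInputB E sh κ) (mWB : Matrix (sh.Ins .B) sh.Outs Str) :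
    E.Mat κ (sh.Ins .B) sh.Outs :=
  b.psiᵀ * b.gradZ + E.decMat κ sk mWB

/-- `A`: from `⟦∇E_A⟧_B = ⟦∇Z⟧_B U_Aᵀ + ⟦∇Z V_Aᵀ⟧_B`, the message for the share of `∇Q_A`. -/
def bwMsgQA (a : BwInputA E sh κ) (r : BwRandA E sh κ) (cZ : Matrix sh.Batch sh.Outs Str)
    (cZV : Matrix sh.Batch (sh.Ins .A) Str) : Matrix (sh.Voc .A) (sh.Dim .A) Str :=
  E.he2ss κ pkB
    (E.clkupBw κ pkB (E.addMat κ pkB (E.mulRight κ pkB cZ a.layer.Uᵀ) cZV) a.layer.X) r.rho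

/-- `B`: from `⟦∇E_B⟧_A = ∇Z ⟦V_B⟧_Aᵀ + ∇Z U_Bᵀ`, the message for the share of `∇Q_B`. -/
def bwMsgQB (b : BwInputB E sh κ) (r : BwRandB E sh κ) : Matrix (sh.Voc .B) (sh.Dim .B) Str :=
  E.he2ss κ pkA
    (E.clkupBw κ pkA
      (E.addMat κ pkA (E.mulLeft κ pkA b.gradZ b.layer.cVᵀ)
        (E.encMat κ pkA (b.gradZ * b.layer.Uᵀ) r.coinZU)) b.layer.X) r.rho

/-- The outputs of the two parties. -/
def bwOutA (r : BwRandA E sh κ) (m : BwRecvA sh) : BwOutputA E sh κ where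
  phi := E.mask κ r.phi
  xi := E.mask κ r.xi
  rho := E.mask κ r.rho
  gradQB := E.decMat κ sk m.mQB

def bwOutB (b : BwInputB E sh κ) (r : BwRandB E sh κ) (m : BwRecvB sh) : BwOutputB E sh κ where
  gradWA := bwShareWA sk b m.mWA
  gradWB := bwShareWB sk b m.mWB
  gradQA := E.decMat κ sk m.mQA
  rho := E.mask κ r.rho

end BwParty

/-- The messages received by the two parties in the backward protocol. -/
def bwRecv (k : Keys) (a : BwInputA E sh κ) (b : BwInputB E sh κ)
    (rA : BwRandA E sh κ) (rB : BwRandB E sh κ) : BwRecvA sh × BwRecvB sh :=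
  let cZ := E.encMat κ (k.pk .B) b.gradZ rB.coinZ
  let cZV := E.encMat κ (k.pk .B) (b.gradZ * b.layer.Votherᵀ) rB.coinZV
  let mWA := bwMsgWA (k.pk .B) a rA cZ
  let mWB := bwMsgWB (k.pk .B) a rA cZ
  let mQA := bwMsgQA (k.pk .B) a rA cZ cZV
  let mQB := bwMsgQB (k.pk .A) b rB
  ({ cZ := cZ
     cZV := cZV
     cWA := E.encMat κ (k.pk .B) (bwShareWA (k.sk .B) b mWA) rB.coinWA
     cWB := E.encMat κ (k.pk .B) (bwShareWB (k.sk .B) b mWB) rB.coinWB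
     mQB := mQB
     cQA := E.encMat κ (k.pk .B) (E.decMat κ (k.sk .B) mQA) rB.coinQA },
   { mWA := mWA
     mWB := mWB
     cPhi := E.encMat κ (k.pk .A) (E.mask κ rA.phi) rA.coinPhi
     cXi := E.encMat κ (k.pk .A) (E.mask κ rA.xi) rA.coinXi
     mQA := mQA
     cQB := E.encMat κ (k.pk .A) (E.decMat κ (k.sk .A) mQB) rA.coinQB })

variable (E sh)

/-- The backward protocol. -/
def embedMatMulBw : Protocol (FEmbedMatMulBw E sh) where
  Rand
    | .A => Coded.of fun κ => BwRandA E sh κ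
    | .B => Coded.of fun κ => BwRandB E sh κ
  fintypeRand
    | .A, κ => inferInstanceAs (Fintype (BwRandA E sh κ))
    | .B, κ => inferInstanceAs (Fintype (BwRandB E sh κ))
  nonemptyRand
    | .A, κ => inferInstanceAs (Nonempty (BwRandA E sh κ))
    | .B, κ => inferInstanceAs (Nonempty (BwRandB E sh κ))
  Recv
    | .A => Coded.of fun _ => BwRecvA sh
    | .B => Coded.of fun _ => BwRecvB sh
  recv κ k (a : BwInputA E sh κ) (b : BwInputB E sh κ)
      (rA : BwRandA E sh κ) (rB : BwRandB E sh κ) :=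
    fun P => match P with
      | .A => (bwRecv k a b rA rB).1
      | .B => (bwRecv k a b rA rB).2
  output κ P _ sk := match P with
    | .A => fun (_ : BwInputA E sh κ) (r : BwRandA E sh κ) (m : BwRecvA sh) => bwOutA sk r m
    | .B => fun (b : BwInputB E sh κ) (r : BwRandB E sh κ) (m : BwRecvB sh) => bwOutB sk b r m

variable {E sh}

/-! ## Model update

At the end of the backward protocol each party updates its plain model pieces with its output,
and its encrypted pieces homomorphically with the ciphertexts it received. -/

/-- `⟦M⟧ - η ⟦D⟧` -/
def cipherStep {m n : Type} (pk : Str) (η : E.R κ) (C D : Matrix m n Str) : Matrix m n Str :=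
  E.addMat κ pk C (E.smulMat κ pk (-η) D)

def updateA (η : E.R κ) (k : Keys) (a : LayerInput E sh .A κ) (o : BwOutputA E sh κ)
    (m : BwRecvA sh) : LayerInput E sh .A κ where
  X := a.X
  S := a.S - η • o.rho
  U := a.U - η • o.phi
  Tother := a.Tother - η • o.gradQB
  Vother := a.Vother - η • o.xi
  cT := cipherStep (E := E) (k.pk .B) η a.cT m.cQA
  cV := cipherStep (E := E) (k.pk .B) η a.cV m.cWA
  cUother := cipherStep (E := E) (k.pk .B) η a.cUother m.cWB

def updateB (η : E.R κ) (k : Keys) (b : LayerInput E sh .B κ) (o : BwOutputB E sh κ)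
    (m : BwRecvB sh) : LayerInput E sh .B κ where
  X := b.X
  S := b.S - η • o.rho
  U := b.U - η • o.gradWB
  Tother := b.Tother - η • o.gradQA
  Vother := b.Vother - η • o.gradWA
  cT := cipherStep (E := E) (k.pk .A) η b.cT m.cQB
  cV := cipherStep (E := E) (k.pk .A) η b.cV m.cXi
  cUother := cipherStep (E := E) (k.pk .A) η b.cUother m.cPhi

variable (E sh)

/-- In every execution of the backward protocol, for every learning rate `η`, the updated models
are again consistently shared and encrypted, and they are the models after the gradient step. -/
def UpdatesModels : Prop :=
  ∀ (κ : ℕ) (k : Keys), k ∈ (E.keys κ).support →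
  ∀ (a : BwInputA E sh κ) (b : BwInputB E sh κ), BwConsistent k a b →
  ∀ (rA : BwRandA E sh κ) (rB : BwRandB E sh κ) (η : E.R κ),
    let m := bwRecv k a b rA rB
    let a' := updateA η k a.layer (bwOutA (k.sk .A) rA m.1) m.1
    let b' := updateB η k b.layer (bwOutB (k.sk .B) b rB m.2) m.2
    LayerInput.Consistent k a' b' ∧
    weightA a' b' = weightA a.layer b.layer - η • gradWA a.layer b.layer b.gradZ ∧
    weightB a' b' = weightB a.layer b.layer - η • gradWB a.layer b.layer b.gradZ ∧
    tableA a' b' = tableA a.layer b.layer - η • gradQA a.layer b.layer b.gradZ ∧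
    tableB a' b' = tableB a.layer b.layer - η • gradQB a.layer b.layer b.gradZ

end Layer

end BlindFL

end

noncomputable section

namespace BlindFL

set_option linter.unusedSectionVars false

/-! ## Polynomial-time computable functions -/

/-! A corrupted party receives two sorts of ciphertexts: those under its own key, which it can open,
and those under the key of the honest party. They are simulated for different reasons.

Every ciphertext received under the own key is an HE2SS message ⟦v⟧ + Enc(-φ), where φ is a mask of
the honest party. By rerandomization it is statistically close to a fresh encryption of v - φ, even
jointly with φ and everything else (`he2ss_close`), so only this plaintext has to be simulated. If φ
occurs nowhere else, the plaintext is uniform (`he2ss_close_encPMF`). This settles the forward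
protocol: all ciphertexts received there are of this sort, the output is the deterministic matrix Z
by correctness (`fwZ_add_fwZ`), and the share of `A` that `B` receives is Z minus the share that `B`
computes itself. The error is purely statistical.

In the backward protocol the masks reappear in the outputs of both parties, so the view has to be
compared jointly with the outputs. Here the plaintext v - φ is either an output of the receiver or
such an output minus a product of its own inputs, so the simulator can encrypt it afresh. The masks
of the corrupted party are themselves among its outputs. The ciphertexts under the key of the honest
party are replaced by encryptions of zero, which is a hybrid argument over IND-CPA (`encGame_zero`,
`interaction_hybrid_zero`). The reduction receives the honest public key as its challenge and runs
the environment, the other key generation, the adversary and the final test by itself. It never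
needs the honest secret key, because correctness turns each decrypted value that is encrypted again
into an explicit function of inputs and masks (`bwRecv_fst`, `bwRecv_snd`). Since the reduction
samples ring elements only approximately, the chain of `exists_simulator_of_hybrid` is: real view,
hybrid with uniform masks, hybrid with sampled masks, the same with zero plaintexts, then uniform
masks again, which is the ideal view exactly.

The update statement is algebra on ciphertexts: the plain and the encrypted pieces are changed by
complementary shares of the same gradient (`updatesModels`).

The remaining work is efficiency. The machine model has subroutine calls on fresh registers, so
polynomial time is closed under composition (`PolyTime.comp`). All shapes are fixed, hence
simulators and reductions are compositions of a constant number of operations, coin draws and calls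
of given algorithms. The predicates `PolyFn` and `EPPT` keep track of this on encoded data, so that
each efficiency proof follows the construction of the algorithm. -/

theorem eval_nat_mono (p : Polynomial ℕ) {m n : ℕ} (h : m ≤ n) : p.eval m ≤ p.eval n := by
  rw [Polynomial.eval_eq_sum_range, Polynomial.eval_eq_sum_range]
  gcongr

/-- A step adds at most one bit to a register, and a call is charged for the length of the string it
returns. Running time therefore bounds output length, which is what bounds the input of the next
program in a composition. -/
theorem Exec.length_le {s : Prog} {σ τ : RegState} {t : ℕ} (h : Exec s σ τ t) (x : ℕ) :
    (τ x).length ≤ (σ x).length + t := by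
  induction h with
  | skip σ => omega
  | push b y σ =>
    by_cases hx : x = y
    · subst hx; simp
    · simp [Function.update_of_ne hx]
  | pop y σ =>
    by_cases hx : x = y
    · subst hx; simp; omega
    · simp [Function.update_of_ne hx]
  | seq _ _ h₁ h₂ => omega
  | branchEmpty _ _ h => omega
  | branchFalse _ _ h => omega
  | branchTrue _ _ h => omega
  | loopDone _ => omega
  | loopStep _ _ _ h₁ h₂ => omega
  | @call body args ret σ τ m _ _ =>
    by_cases hx : x = ret
    · subst hx; simp; omega
    · simp [Function.update_of_ne hx]

theorem frame_map {ι : Type} (σ : RegState) (r : ι → ℕ) (q : ι ↪ ℕ) (l : List ι) :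
    (∀ i ∈ l, frame σ (l.map fun i => (r i, q i)) (q i) = σ (r i)) ∧
    ∀ n, (∀ i ∈ l, n ≠ q i) → frame σ (l.map fun i => (r i, q i)) n = [] := by
  induction l with
  | nil => simp [frame]
  | cons a l ih =>
    have e : frame σ ((a :: l).map fun i => (r i, q i)) =
        Function.update (frame σ (l.map fun i => (r i, q i))) (q a) (σ (r a)) := rfl
    rw [e]
    refine ⟨fun i hi => ?_, fun n hn => ?_⟩
    · by_cases h : i = a
      · subst h; simp
      · rw [Function.update_of_ne (by simpa using h)]
        exact ih.1 i (by simpa [h] using hi)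
    · rw [Function.update_of_ne (hn a (by simp))]
      exact ih.2 n fun i hi => hn i (by simp [hi])

/-- The state in which a called body starts is literally the initial state in the definition of
`PolyTime`, so the specification of a program applies to a call of it unchanged. -/
theorem frame_univ {ι : Type} [Fintype ι] (σ : RegState) (r : ι → ℕ) (q : ι ↪ ℕ) :
    frame σ ((Finset.univ : Finset ι).toList.map fun i => (r i, q i)) =
      Function.extend q (fun i => σ (r i)) fun _ => [] := by
  funext n
  by_cases h : ∃ i, q i = n
  · obtain ⟨i, rfl⟩ := h
    rw [q.injective.extend_apply]
    exact (frame_map σ r q _).1 i (by simp)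
  · rw [Function.extend_apply' _ _ _ h]
    exact (frame_map σ r q _).2 n fun i _ hi => h ⟨i, hi.symm⟩

theorem length_extend_le {ι : Type} [Fintype ι] (q : ι ↪ ℕ) (v : ι → Str) (n : ℕ) :
    (Function.extend q v (fun _ => []) n).length ≤ ∑ i, (v i).length := by
  by_cases h : ∃ i, q i = n
  · obtain ⟨i, rfl⟩ := h
    rw [q.injective.extend_apply]
    exact Finset.single_le_sum (f := fun i => (v i).length) (fun _ _ => Nat.zero_le _)
      (Finset.mem_univ i)
  · rw [Function.extend_apply' _ _ _ h]; simp

/-- An embedding of a finite type into the natural numbers from `n` on. -/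
def regFrom (ι : Type) [Fintype ι] (n : ℕ) : ι ↪ ℕ where
  toFun i := n + (Fintype.equivFin ι i : ℕ)
  inj' i j h := (Fintype.equivFin ι).injective (Fin.ext (by simpa using h))

theorem exec_copy (x : ℕ) (σ : RegState) :
    Exec (.call .skip [(x, 0)] 0) σ (Function.update σ 0 (σ x)) (2 * (σ x).length + 3) := by
  have h := Exec.call (body := .skip) (args := [(x, 0)]) (ret := 0) (σ := σ) (Exec.skip _)
  have e : frame σ [(x, 0)] 0 = σ x := by simp [frame]
  rw [e] at h
  convert h using 1
  simp; omega

namespace PolyTime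

variable {ι ι' : Type} [Fintype ι]

theorem proj (i : ι) : PolyTime fun v : ι → Str => v i := by
  refine ⟨regFrom ι 0, .call .skip [(regFrom ι 0 i, 0)] 0, 2 * Polynomial.X + 3, fun v => ?_⟩
  refine ⟨_, _, exec_copy _ _, ?_, ?_⟩
  · simp [(regFrom ι 0).injective.extend_apply]
  · rw [(regFrom ι 0).injective.extend_apply]
    have := Finset.single_le_sum (f := fun i => (v i).length) (fun _ _ => Nat.zero_le _)
      (Finset.mem_univ i)
    simp at this ⊢; exact this

/-- The second string if the first one starts with `1`, and the third one otherwise. -/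
def selectBit (v : Fin 3 → Str) : Str := if (v 0).head? = some true then v 1 else v 2

theorem selectBit_polyTime : PolyTime selectBit := by
  refine ⟨Fin.valEmbedding, .branch 0 (.call .skip [(2, 0)] 0) (.call .skip [(2, 0)] 0)
    (.call .skip [(1, 0)] 0), 2 * Polynomial.X + 4, fun v => ?_⟩
  have hx : ∀ i : Fin 3, Function.extend Fin.valEmbedding v (fun _ => []) (i : ℕ) = v i :=
    fun i => Fin.valEmbedding.injective.extend_apply _ _ i
  have h0 := hx 0
  have h1 := hx 1
  have h2 := hx 2
  simp only [Fin.val_zero, Fin.val_one, Fin.val_two] at h0 h1 h2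
  have hs : ∑ i, (v i).length = (v 0).length + (v 1).length + (v 2).length := by
    simp [Fin.sum_univ_three]
  have ev : (2 * Polynomial.X + 4 : Polynomial ℕ).eval (∑ i, (v i).length) =
      2 * (∑ i, (v i).length) + 4 := by simp
  rw [ev, hs]
  rcases hc : (v 0).head? with _ | b
  · refine ⟨_, _, Exec.branchEmpty (by rw [h0]; simpa using hc) (exec_copy 2 _), ?_, ?_⟩
    · rw [Function.update_self, h2]; simp [selectBit, hc]
    · rw [h2]; omega
  · cases b
    · refine ⟨_, _, Exec.branchFalse (by rw [h0]; simpa using hc) (exec_copy 2 _), ?_, ?_⟩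
      · rw [Function.update_self, h2]; simp [selectBit, hc]
      · rw [h2]; omega
    · refine ⟨_, _, Exec.branchTrue (by rw [h0]; simpa using hc) (exec_copy 1 _), ?_, ?_⟩
      · rw [Function.update_self, h1]; simp [selectBit, hc]
      · rw [h1]; omega

/-- Sequential composition of subroutine calls that write into pairwise different registers. -/
theorem exec_calls (r : ι ↪ ℕ) (mid : ι' ↪ ℕ) (hd : ∀ i j, r i ≠ mid j)
    (q : ι' → ι ↪ ℕ) (s : ι' → Prog) (p : ι' → Polynomial ℕ) (g : ι' → (ι → Str) → Str)
    (h : ∀ j v, ∃ τ t, Exec (s j) (Function.extend (q j) v fun _ => []) τ t ∧ τ 0 = g j v ∧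
      t ≤ (p j).eval (∑ i, (v i).length)) (l : List ι') :
    ∃ (S : Prog) (P : Polynomial ℕ), ∀ v σ, (∀ i, σ (r i) = v i) →
      ∃ τ t, Exec S σ τ t ∧ (∀ j ∈ l, τ (mid j) = g j v) ∧
        (∀ n, (∀ j ∈ l, n ≠ mid j) → τ n = σ n) ∧ t ≤ P.eval (∑ i, (v i).length) := by
  induction l with
  | nil =>
    exact ⟨.skip, 1, fun v σ _ => ⟨σ, 1, Exec.skip σ, by simp, by simp, by simp⟩⟩
  | cons j l ih =>
    obtain ⟨S, P, hS⟩ := ih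
    -- Copying the arguments costs `X` plus their number, the body `p j`, and copying its result at
    -- most `X + p j` by `Exec.length_le`; the two sequencing and calling overheads give the final
    -- 2.
    refine ⟨.seq (.call (s j) ((Finset.univ : Finset ι).toList.map fun i => (r i, q j i))
      (mid j)) S, 2 * Polynomial.X + (Fintype.card ι : Polynomial ℕ) + 2 * p j + P + 2,
      fun v σ hσ => ?_⟩
    obtain ⟨τ, t, he, ho, ht⟩ := h j v
    have hf : frame σ ((Finset.univ : Finset ι).toList.map fun i => (r i, q j i)) =
        Function.extend (q j) v fun _ => [] := by
      rw [frame_univ]; congr 1; funext i; exact hσ i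
    obtain ⟨τ', t', he', ho', hp', ht'⟩ := hS v (Function.update σ (mid j) (τ 0)) (fun i => by
      rw [Function.update_of_ne (hd i j), hσ])
    refine ⟨τ', _, Exec.seq (Exec.call (by rw [hf]; exact he)) he', ?_, ?_, ?_⟩
    · intro j' hj'
      by_cases hl : j' ∈ l
      · exact ho' j' hl
      · have hjj : j' = j := by simpa [hl] using hj'
        subst hjj
        rw [hp' _ fun j'' hj'' e => hl (by rwa [mid.injective e])]
        simpa using ho
    · intro n hn
      rw [hp' n fun j'' hj'' => hn j'' (by simp [hj'']), Function.update_of_ne (hn j (by simp))]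
    · have hlen := he.length_le 0
      have hlen' := length_extend_le (q j) v 0
      have hargs : (((Finset.univ : Finset ι).toList.map fun i => (r i, q j i)).map
          fun a => (σ a.1).length + 1).sum = (∑ i, (v i).length) + Fintype.card ι := by
        rw [List.map_map, ← Finset.sum_map_toList]
        simp [Function.comp_def, hσ, Finset.sum_add_distrib]
      rw [hargs]
      simp only [Polynomial.eval_add, Polynomial.eval_mul, Polynomial.eval_ofNat,
        Polynomial.eval_X, Polynomial.eval_natCast]
      simp only [Nat.cast_id] at *
      omega

/-- Inputs occupy the registers below `Fintype.card ι` and intermediate results those from there on,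
so no call overwrites an input. Each call runs on fresh registers, which makes any cleaning between
the subprograms unnecessary. -/
theorem comp [Fintype ι'] {f : (ι' → Str) → Str} (hf : PolyTime f) {g : ι' → (ι → Str) → Str}
    (hg : ∀ j, PolyTime (g j)) : PolyTime fun v => f fun j => g j v := by
  obtain ⟨qf, sf, pf, hf⟩ := hf
  choose q s p hg using hg
  have hd : ∀ (i : ι) (j : ι'), regFrom ι 0 i ≠ regFrom ι' (Fintype.card ι) j := by
    intro i j
    have := (Fintype.equivFin ι i).2
    change 0 + (Fintype.equivFin ι i : ℕ) ≠ Fintype.card ι + (Fintype.equivFin ι' j : ℕ)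
    omega
  obtain ⟨S, P, hS⟩ := exec_calls (regFrom ι 0) (regFrom ι' (Fintype.card ι)) hd q s p g hg
    (Finset.univ : Finset ι').toList
  have hlen : ∀ j v, (g j v).length ≤ (∑ i, (v i).length) + (p j).eval (∑ i, (v i).length) := by
    intro j v
    obtain ⟨τ, t, he, ho, ht⟩ := hg j v
    have h1 := he.length_le 0
    have h2 := length_extend_le (q j) v 0
    rw [← ho]; omega
  -- The intermediate string `j` has length at most `X + p j`, and polynomials over ℕ are monotone,
  -- so `f` runs in time `pf` composed with the sum of these bounds. The factors 2 again pay for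
  -- copying arguments and results.
  refine ⟨regFrom ι 0, .seq S (.call sf ((Finset.univ : Finset ι').toList.map fun j =>
    (regFrom ι' (Fintype.card ι) j, qf j)) 0),
    P + 2 * (∑ j, (Polynomial.X + p j)) + (Fintype.card ι' : Polynomial ℕ) +
      2 * pf.comp (∑ j, (Polynomial.X + p j)) + 2, fun v => ?_⟩
  obtain ⟨τ, t, he, ho, -, ht⟩ := hS v (Function.extend (regFrom ι 0) v fun _ => [])
    fun i => (regFrom ι 0).injective.extend_apply _ _ _
  have ho' : ∀ j, τ (regFrom ι' (Fintype.card ι) j) = g j v := fun j => ho j (by simp)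
  obtain ⟨τ', t', he', hr', ht'⟩ := hf fun j => g j v
  have hfr : frame τ ((Finset.univ : Finset ι').toList.map fun j =>
      (regFrom ι' (Fintype.card ι) j, qf j)) = Function.extend qf (fun j => g j v)
        fun _ => [] := by
    rw [frame_univ]; congr 1; funext j; exact ho' j
  refine ⟨_, _, Exec.seq he (Exec.call (by rw [hfr]; exact he')), by simpa using hr', ?_⟩
  have hargs : (((Finset.univ : Finset ι').toList.map fun j =>
      (regFrom ι' (Fintype.card ι) j, qf j)).map fun a => (τ a.1).length + 1).sum =
        (∑ j, (g j v).length) + Fintype.card ι' := by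
    rw [List.map_map, ← Finset.sum_map_toList]
    simp [Function.comp_def, ho', Finset.sum_add_distrib]
  have h1 := he'.length_le 0
  have h2 := length_extend_le qf (fun j => g j v) 0
  have h3 : ∑ j, (g j v).length ≤ (∑ j, (Polynomial.X + p j) : Polynomial ℕ).eval
      (∑ i, (v i).length) := by
    rw [Polynomial.eval_finsetSum]
    refine Finset.sum_le_sum fun j _ => ?_
    simpa using hlen j v
  have h4 := eval_nat_mono pf h3
  rw [hargs]
  simp only [Polynomial.eval_add, Polynomial.eval_mul, Polynomial.eval_ofNat,
    Polynomial.eval_comp, Polynomial.eval_natCast, Nat.cast_id] at *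
  omega

theorem reindex [Fintype ι'] {f : (ι' → Str) → Str} (hf : PolyTime f) (e : ι' → ι) :
    PolyTime fun v : ι → Str => f fun j => v (e j) :=
  hf.comp fun j => proj (e j)

end PolyTime

/-! ## Uniform distributions -/

section Uniform

open PMF

theorem uniform_map_equiv {α β : Type} [Fintype α] [Nonempty α] [Fintype β] [Nonempty β]
    (e : α ≃ β) : (uniformOfFintype α).map e = uniformOfFintype β := by
  classical
  ext b
  rw [map_apply, tsum_eq_single (e.symm b)]
  · simp [Fintype.card_congr e]
  · intro a ha
    rw [if_neg]
    rintro rfl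
    simp at ha

theorem uniform_bind_equiv {α β γ : Type} [Fintype α] [Nonempty α] [Fintype β] [Nonempty β]
    (e : α ≃ β) (f : β → PMF γ) :
    (uniformOfFintype β).bind f = (uniformOfFintype α).bind fun a => f (e a) := by
  rw [← uniform_map_equiv e, bind_map]; rfl

theorem uniform_bind_prod {α β γ : Type} [Fintype α] [Nonempty α] [Fintype β] [Nonempty β]
    (f : α × β → PMF γ) :
    (uniformOfFintype (α × β)).bind f =
      (uniformOfFintype α).bind fun a => (uniformOfFintype β).bind fun b => f (a, b) := by
  ext c
  simp only [bind_apply, uniformOfFintype_apply, Fintype.card_prod, Nat.cast_mul, tsum_fintype]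
  rw [Fintype.sum_prod_type]
  refine Finset.sum_congr rfl fun a _ => ?_
  rw [Finset.mul_sum]
  refine Finset.sum_congr rfl fun b _ => ?_
  rw [ENNReal.mul_inv (by simp) (by simp), mul_assoc]

/-- Resampling one coordinate of a uniformly random family. -/
theorem uniform_bind_update {ι γ : Type} [Fintype ι] [DecidableEq ι] {α : ι → Type}
    [∀ i, Fintype (α i)] [∀ i, Nonempty (α i)] (i : ι) (f : (∀ i, α i) → PMF γ) :
    ((uniformOfFintype (∀ i, α i)).bind fun g => (uniformOfFintype (α i)).bind fun a =>
      f (Function.update g i a)) = (uniformOfFintype (∀ i, α i)).bind f := by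
  rw [uniform_bind_equiv (Equiv.piSplitAt i α).symm f,
    uniform_bind_equiv (Equiv.piSplitAt i α).symm, uniform_bind_prod, uniform_bind_prod]
  have h : ∀ (a b : α i) (g : ∀ j : { j // j ≠ i }, α j),
      Function.update ((Equiv.piSplitAt i α).symm (a, g)) i b =
        (Equiv.piSplitAt i α).symm (b, g) := by
    intro a b g
    funext j
    by_cases hj : j = i
    · subst hj; simp [Equiv.piSplitAt]
    · simp [Equiv.piSplitAt, hj]
  simp only [h, bind_const]
  rw [bind_comm]

end Uniform

/-! ## Statistical closeness -/

theorem summable_toReal {α : Type} (p : PMF α) : Summable fun a => (p a).toReal :=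
  ENNReal.summable_toReal (by rw [p.tsum_coe]; exact ENNReal.one_ne_top)

theorem tsum_toReal {α : Type} (p : PMF α) : ∑' a, (p a).toReal = 1 := by
  rw [← ENNReal.tsum_toReal_eq fun a => p.apply_ne_top a, p.tsum_coe, ENNReal.toReal_one]

theorem accept_nonneg (p : PMF (Unit → Str)) : 0 ≤ accept p := ENNReal.toReal_nonneg

theorem accept_le_one (p : PMF (Unit → Str)) : accept p ≤ 1 :=
  ENNReal.toReal_le_of_le_ofReal zero_le_one (by simpa using p.coe_le_one _)

theorem accept_bind {α : Type} (p : PMF α) (f : α → PMF (Unit → Str)) :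
    accept (p.bind f) = ∑' a, (p a).toReal * accept (f a) := by
  unfold accept
  rw [PMF.bind_apply, ENNReal.tsum_toReal_eq fun a =>
    ENNReal.mul_ne_top (p.apply_ne_top a) ((f a).apply_ne_top _)]
  simp only [ENNReal.toReal_mul]

theorem summable_mul_accept {α : Type} (p : PMF α) (f : α → PMF (Unit → Str)) :
    Summable fun a => (p a).toReal * accept (f a) :=
  (summable_toReal p).of_nonneg_of_le
    (fun _ => mul_nonneg ENNReal.toReal_nonneg (accept_nonneg _))
    fun _ => mul_le_of_le_one_right ENNReal.toReal_nonneg (accept_le_one _)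

/-- No test tells `p` from `q` with an advantage greater than `ε`. -/
def Close {α : Type} (ε : ℝ) (p q : PMF α) : Prop :=
  ∀ f : α → PMF (Unit → Str), |accept (p.bind f) - accept (q.bind f)| ≤ ε

namespace Close

variable {α β : Type} {ε δ : ℝ} {p q r : PMF α}

theorem refl (p : PMF α) : Close 0 p p := fun f => by simp

theorem symm (h : Close ε p q) : Close ε q p := fun f => by rw [abs_sub_comm]; exact h f

theorem trans (h : Close ε p q) (h' : Close δ q r) : Close (ε + δ) p r := fun f =>
  (abs_sub_le _ (accept (q.bind f)) _).trans (add_le_add (h f) (h' f))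

theorem mono (h : Close ε p q) (hle : ε ≤ δ) : Close δ p q := fun f => (h f).trans hle

/-- The difference of the acceptance probabilities is bounded by the whole ℓ¹ distance, which is
twice the statistical distance; the lost factor 2 is harmless for negligible errors. -/
theorem of_statDist (h : statDist p q ≤ ε) : Close (2 * ε) p q := fun f => by
  rw [accept_bind, accept_bind, ← (summable_mul_accept p f).tsum_sub (summable_mul_accept q f)]
  have hs : Summable fun a => |(p a).toReal - (q a).toReal| :=
    ((summable_toReal p).sub (summable_toReal q)).abs
  have hle : ∀ a, ‖(p a).toReal * accept (f a) - (q a).toReal * accept (f a)‖ ≤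
      |(p a).toReal - (q a).toReal| := by
    intro a
    rw [← sub_mul, norm_mul, Real.norm_eq_abs, Real.norm_eq_abs, abs_of_nonneg (accept_nonneg _)]
    exact mul_le_of_le_one_right (abs_nonneg _) (accept_le_one _)
  have h1 := tsum_of_norm_bounded hs.hasSum hle
  rw [Real.norm_eq_abs] at h1
  unfold statDist at h
  linarith

theorem bind_left (h : Close ε p q) (g : α → PMF β) : Close ε (p.bind g) (q.bind g) := fun f => by
  rw [PMF.bind_bind, PMF.bind_bind]; exact h _

theorem map (h : Close ε p q) (g : α → β) : Close ε (p.map g) (q.map g) := h.bind_left _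

/-- Averaging preserves the bound, and only values in the support matter. This restriction is what
lets facts about generated keys and admissible inputs be used inside an experiment. -/
theorem bind_right {f g : α → PMF β} (h : ∀ a ∈ p.support, Close ε (f a) (g a)) :
    Close ε (p.bind f) (p.bind g) := fun t => by
  rw [PMF.bind_bind, PMF.bind_bind, accept_bind, accept_bind,
    ← (summable_mul_accept p _).tsum_sub (summable_mul_accept p _)]
  have hle : ∀ a, ‖(p a).toReal * accept ((f a).bind t) - (p a).toReal * accept ((g a).bind t)‖ ≤
      (p a).toReal * ε := by
    intro a
    rw [← mul_sub, norm_mul, Real.norm_eq_abs, Real.norm_eq_abs,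
      abs_of_nonneg ENNReal.toReal_nonneg]
    by_cases ha : a ∈ p.support
    · exact mul_le_mul_of_nonneg_left (h a ha t) ENNReal.toReal_nonneg
    · rw [PMF.mem_support_iff, not_not] at ha
      simp [ha]
  have h1 := tsum_of_norm_bounded ((summable_toReal p).mul_right ε).hasSum hle
  rwa [tsum_mul_right, tsum_toReal, one_mul, Real.norm_eq_abs] at h1

theorem bind {f g : α → PMF β} (hp : Close ε p q) (h : ∀ a ∈ q.support, Close δ (f a) (g a)) :
    Close (ε + δ) (p.bind f) (q.bind g) :=
  (hp.bind_left f).trans (bind_right h)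

theorem accept_le {p q : PMF (Unit → Str)} (h : Close ε p q) : |accept p - accept q| ≤ ε := by
  simpa using h PMF.pure

end Close

/-! ## Products of distributions -/

section Pi

variable {ι : Type} [DecidableEq ι] {α β : ι → Type}

/-- Resample the coordinates in the list `l` independently. -/
def samplePi (μ : ∀ i, PMF (α i)) : List ι → (∀ i, α i) → PMF (∀ i, α i)
  | [], g => PMF.pure g
  | i :: l, g => (μ i).bind fun a => samplePi μ l (Function.update g i a)

/-- Coordinates in `l` are overwritten, so the starting family matters only off `l`. With all
coordinates listed it does not matter at all, and the arbitrary starting point in `piPMF` is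
harmless. -/
theorem samplePi_congr (μ : ∀ i, PMF (α i)) (l : List ι) (g h : ∀ i, α i)
    (hgh : ∀ i ∉ l, g i = h i) : samplePi μ l g = samplePi μ l h := by
  induction l generalizing g h with
  | nil =>
    have : g = h := funext fun i => hgh i (by simp)
    rw [this]
  | cons j l ih =>
    simp only [samplePi]
    congr 1
    funext a
    refine ih _ _ fun i hi => ?_
    by_cases hij : i = j
    · subst hij; simp
    · simp [hij, hgh i (by simp [hij, hi])]

theorem samplePi_map (μ : ∀ i, PMF (α i)) (f : ∀ i, α i → β i) (l : List ι) (g : ∀ i, α i) :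
    (samplePi μ l g).map (fun x i => f i (x i)) =
      samplePi (fun i => (μ i).map (f i)) l fun i => f i (g i) := by
  induction l generalizing g with
  | nil => simp [samplePi, PMF.pure_map]
  | cons j l ih =>
    simp only [samplePi, PMF.map_bind, PMF.bind_map, ih]
    congr 1
    funext a
    simp only [Function.comp_apply]
    congr 1
    funext i
    by_cases hij : i = j
    · subst hij; simp
    · simp [hij]

/-- Hybrid argument: the coordinates are exchanged one at a time, at cost `ε` each. -/
theorem samplePi_close {ε : ℝ} {μ ν : ∀ i, PMF (α i)} (h : ∀ i, Close ε (μ i) (ν i)) (l : List ι)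
    (g : ∀ i, α i) : Close (l.length * ε) (samplePi μ l g) (samplePi ν l g) := by
  induction l generalizing g with
  | nil => simpa [samplePi] using Close.refl _
  | cons j l ih =>
    refine ((h j).bind fun a _ => ih _).mono (le_of_eq ?_)
    simp; ring

variable [Fintype ι]

/-- The product of finitely many distributions. -/
def piPMF (μ : ∀ i, PMF (α i)) : PMF (∀ i, α i) :=
  samplePi μ (Finset.univ : Finset ι).toList fun i => (μ i).support_nonempty.some

theorem piPMF_map (μ : ∀ i, PMF (α i)) (f : ∀ i, α i → β i) :
    (piPMF μ).map (fun x i => f i (x i)) = piPMF fun i => (μ i).map (f i) := by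
  rw [piPMF, samplePi_map]
  exact samplePi_congr _ _ _ _ (by simp)

theorem piPMF_close {ε : ℝ} {μ ν : ∀ i, PMF (α i)} (h : ∀ i, Close ε (μ i) (ν i)) :
    Close (Fintype.card ι * ε) (piPMF μ) (piPMF ν) := by
  have := samplePi_close h (Finset.univ : Finset ι).toList fun i => (μ i).support_nonempty.some
  rw [Finset.length_toList, Finset.card_univ] at this
  rwa [piPMF, piPMF, samplePi_congr ν _ _ _ (by simp)]

/-- Resampling coordinates of a uniform family leaves it uniform by `uniform_bind_update`. Once all
coordinates are resampled the starting family is forgotten, so averaging over a uniform start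
changes nothing. -/
theorem piPMF_uniform [∀ i, Fintype (α i)] [∀ i, Nonempty (α i)] :
    piPMF (fun i => PMF.uniformOfFintype (α i)) = PMF.uniformOfFintype (∀ i, α i) := by
  have key : ∀ l : List ι, (PMF.uniformOfFintype (∀ i, α i)).bind
      (samplePi (fun i => PMF.uniformOfFintype (α i)) l) = PMF.uniformOfFintype (∀ i, α i) := by
    intro l
    induction l with
    | nil => simp only [samplePi]; exact PMF.bind_pure _
    | cons i l ih =>
      simp only [samplePi]
      rw [uniform_bind_update i (samplePi (fun i => PMF.uniformOfFintype (α i)) l), ih]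
  rw [← key (Finset.univ : Finset ι).toList, piPMF]
  rw [show samplePi (fun i => PMF.uniformOfFintype (α i)) (Finset.univ : Finset ι).toList =
    fun _ => samplePi (fun i => PMF.uniformOfFintype (α i)) (Finset.univ : Finset ι).toList
      fun i => (PMF.uniformOfFintype (α i)).support_nonempty.some from
    funext fun g => samplePi_congr _ _ _ _ (by simp), PMF.bind_const]

end Pi

/-! ## Negligible functions -/

namespace Negligible

variable {ε δ : ℕ → ℝ}

theorem zero : Negligible fun _ => 0 := Asymptotics.superpolynomialDecay_zero _ _

theorem add (hε : Negligible ε) (hδ : Negligible δ) : Negligible fun κ => ε κ + δ κ :=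
  Asymptotics.SuperpolynomialDecay.add hε hδ

theorem const_mul (hε : Negligible ε) (c : ℝ) : Negligible fun κ => c * ε κ :=
  Asymptotics.SuperpolynomialDecay.const_mul hε c

theorem of_le (hε : Negligible ε) (h0 : ∀ κ, 0 ≤ δ κ) (h : ∀ κ, δ κ ≤ ε κ) : Negligible δ :=
  Asymptotics.SuperpolynomialDecay.trans_abs_le hε fun κ => by
    rw [abs_of_nonneg (h0 κ)]; exact (h κ).trans (le_abs_self _)

end Negligible

/-! ## Closure properties of probabilistic polynomial time -/

namespace IsPPT

variable {ι ι' ο ο' : Type} [Fintype ι] [Fintype ι'] [Fintype ο] [Fintype ο']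

/-- The random strings may be indexed by any finite type. -/
theorem of_finite {ρ : Type} [Fintype ρ] [DecidableEq ρ] {F : ℕ → (ι → Str) → PMF (ο → Str)}
    (q : ρ → Polynomial ℕ) (f : ο → (Unit ⊕ ι ⊕ ρ → Str) → Str) (hf : ∀ j, PolyTime (f j))
    (hF : ∀ κ x, F κ x =
      (PMF.uniformOfFintype (∀ i : ρ, List.Vector Bool ((q i).eval κ))).map fun r j =>
        f j (Sum.elim (fun _ => unary κ) (Sum.elim x fun i => (r i).toList))) : IsPPT F := by
  let e : Fin (Fintype.card ρ) ≃ ρ := (Fintype.equivFin ρ).symm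
  refine ⟨Fintype.card ρ, fun i => q (e i), fun j v => f j fun i =>
    v (Sum.map id (Sum.map id e.symm) i), fun j => (hf j).reindex _, fun κ x => ?_⟩
  rw [hF, ← uniform_map_equiv
    (Equiv.piCongrLeft (fun i => List.Vector Bool ((q i).eval κ)) e).symm, PMF.map_comp]
  congr 1
  funext r j
  simp only [Function.comp_apply]
  congr 1
  funext i
  rcases i with i | i | i
  · rfl
  · rfl
  · exact congrArg (fun i => (r i).toList) (e.apply_symm_apply i).symm

/-- The coin strings of the two stages are put side by side. Their lengths depend on `κ` alone, so
the second stage needs no more of them when its input is the output of the first. -/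
theorem bind {F : ℕ → (ι → Str) → PMF (ο → Str)} (hF : IsPPT F)
    {H : ℕ → (ι ⊕ ο → Str) → PMF (ο' → Str)} (hH : IsPPT H) :
    IsPPT fun κ x => (F κ x).bind fun y => H κ (Sum.elim x y) := by
  obtain ⟨k, q, f, hf, hF⟩ := hF
  obtain ⟨k', q', h, hh, hH⟩ := hH
  refine of_finite (ρ := Fin k ⊕ Fin k') (Sum.elim q q')
    (fun j v => h j (Sum.elim (fun _ => v (.inl ()))
      (Sum.elim (Sum.elim (fun i => v (.inr (.inl i)))
        fun o => f o fun i => v (Sum.map id (Sum.map id Sum.inl) i))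
        fun i => v (.inr (.inr (.inr i)))))) (fun j => ?_) fun κ x => ?_
  · refine (hh j).comp (g := fun i v => Sum.elim (fun _ => v (.inl ()))
      (Sum.elim (Sum.elim (fun i => v (.inr (.inl i)))
        fun o => f o fun i => v (Sum.map id (Sum.map id Sum.inl) i))
        fun i => v (.inr (.inr (.inr i)))) i) fun i => ?_
    rcases i with i | (i | o) | i
    · exact PolyTime.proj _
    · exact PolyTime.proj _
    · exact (hf o).reindex _
    · exact PolyTime.proj _
  · rw [hF, PMF.bind_map, ← PMF.bind_pure_comp, uniform_bind_equiv
      (Equiv.sumPiEquivProdPi fun i => List.Vector Bool ((Sum.elim q q' i).eval κ)).symm,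
      uniform_bind_prod]
    congr 1
    funext r
    simp only [Function.comp_apply, hH]
    rw [← PMF.bind_pure_comp]
    congr 1
    funext r'
    simp only [Function.comp_apply]
    congr 1
    funext j
    congr 1
    funext i
    rcases i with i | (i | o) | i
    · rfl
    · rfl
    · simp only [Sum.elim_inr, Sum.elim_inl]
      congr 1
      funext i
      rcases i with i | i | i <;> rfl
    · rfl

theorem comap {H : ℕ → (ι' → Str) → PMF (ο → Str)} (hH : IsPPT H)
    {u : ι' → (Unit ⊕ ι → Str) → Str} (hu : ∀ i, PolyTime (u i)) :
    IsPPT fun κ (x : ι → Str) => H κ fun i => u i (Sum.elim (fun _ => unary κ) x) := by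
  obtain ⟨k, q, h, hh, hH⟩ := hH
  refine ⟨k, q, fun j v => h j (Sum.elim (fun _ => v (.inl ()))
      (Sum.elim (fun i => u i fun a => v (Sum.map id Sum.inl a)) fun i => v (.inr (.inr i)))),
    fun j => ?_, fun κ x => ?_⟩
  · refine (hh j).comp (g := fun i v => Sum.elim (fun _ => v (.inl ()))
      (Sum.elim (fun i => u i fun a => v (Sum.map id Sum.inl a)) fun i => v (.inr (.inr i))) i)
      fun i => ?_
    rcases i with i | i | i
    · exact PolyTime.proj _
    · exact (hu i).reindex _
    · exact PolyTime.proj _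
  · simp only [hH]
    congr 1
    funext r j
    congr 1
    funext i
    rcases i with i | i | i
    · rfl
    · simp only [Sum.elim_inr, Sum.elim_inl]
      congr 1
      funext a
      rcases a with a | a <;> rfl
    · rfl

theorem map_reindex {F : ℕ → (ι → Str) → PMF (ο → Str)} (hF : IsPPT F) (e : ο' → ο) :
    IsPPT fun κ x => (F κ x).map fun y j => y (e j) := by
  obtain ⟨k, q, f, hf, hF⟩ := hF
  exact ⟨k, q, fun j => f (e j), fun j => hf _, fun κ x => by simp only [hF, PMF.map_comp]; rfl⟩

theorem det {f : ο → (Unit ⊕ ι → Str) → Str} (hf : ∀ j, PolyTime (f j)) :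
    IsPPT fun κ (x : ι → Str) =>
      PMF.pure fun j => f j (Sum.elim (fun _ => unary κ) x) := by
  refine of_finite (ρ := Empty) (fun i => i.elim) (fun j v => f j fun i => v (Sum.map id Sum.inl i))
    (fun j => (hf j).reindex _) fun κ x => ?_
  rw [← PMF.map_const (PMF.uniformOfFintype
    (∀ i : Empty, List.Vector Bool (Polynomial.eval κ (Empty.elim i))))]
  congr 1
  funext r j
  simp only [Function.const]
  congr 1
  funext i
  rcases i with i | i <;> rfl

/-- Coins are indexed by pairs of a member and one of its strings; currying identifies the uniform
distribution on them with the product of the uniform distributions of the members, which makes the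
outputs independent. -/
theorem pi {m : Type} [Fintype m] [DecidableEq m] {F : m → ℕ → (ι → Str) → PMF (ο → Str)}
    (hF : ∀ i, IsPPT (F i)) :
    IsPPT fun κ x => (piPMF fun i => F i κ x).map fun y (j : m × ο) => y j.1 j.2 := by
  choose k q f hf hF using hF
  refine of_finite (ρ := Σ i, Fin (k i)) (fun a => q a.1 a.2)
    (fun j v => f j.1 j.2 fun a => v (Sum.map id (Sum.map id fun b => ⟨j.1, b⟩) a))
    (fun j => (hf _ _).reindex _) fun κ x => ?_
  simp only [hF]
  rw [← piPMF_map (fun i => PMF.uniformOfFintype (∀ b : Fin (k i),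
    List.Vector Bool ((q i b).eval κ))), piPMF_uniform, PMF.map_comp, ← uniform_map_equiv
    (Equiv.piCurry fun i (b : Fin (k i)) => List.Vector Bool ((q i b).eval κ)), PMF.map_comp]
  congr 1
  funext r j
  simp only [Function.comp_apply]
  congr 1
  funext a
  rcases a with a | a | a <;> rfl

end IsPPT

/-! ## Polynomial-time functions and samplers on encoded data -/

/-- A family of strings, encoded by itself. -/
def Strs (σ : Type) : Type := σ → Str

instance (σ : Type) : StrEnc σ (Strs σ) := ⟨fun s => s⟩

/-- A trivial type, encoded by the advice string. -/
def Advised (_ : ℕ → Str) (_ : ℕ) : Type := Unit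

instance (advice : ℕ → Str) (κ : ℕ) : StrEnc Unit (Advised advice κ) := ⟨fun _ _ => advice κ⟩

section Encoded

variable {ι ι' ο ο' : Type} [Fintype ι] [Fintype ι'] [Fintype ο] [Fintype ο']
  {X Y Z : ℕ → Type} [∀ κ, StrEnc ι (X κ)] [∀ κ, StrEnc ο (Y κ)] [∀ κ, StrEnc ο' (Z κ)]

/-- The string `g κ x` can be computed in polynomial time from `1^κ` and the encoding of `x`. -/
def PolyStr (g : ∀ κ, X κ → Str) : Prop :=
  ∃ f : (Unit ⊕ ι → Str) → Str, PolyTime f ∧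
    ∀ κ x, f (Sum.elim (fun _ => unary κ) (StrEnc.toStrs x)) = g κ x

/-- The encoding of `f κ x` can be computed in polynomial time from that of `x`. -/
def PolyFn (f : ∀ κ, X κ → Y κ) : Prop :=
  ∀ j, PolyStr fun κ x => StrEnc.toStrs (f κ x) j

/-- The encoding of a sample of `F κ x` can be computed in probabilistic polynomial time from the
encoding of `x`. -/
def EPPT (F : ∀ κ, X κ → PMF (Y κ)) : Prop :=
  ∃ G : ℕ → (ι → Str) → PMF (ο → Str), IsPPT G ∧
    ∀ κ x, (F κ x).map StrEnc.toStrs = G κ (StrEnc.toStrs x)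

theorem PolyStr.unary : PolyStr fun κ (_ : X κ) => unary κ :=
  ⟨fun v => v (.inl ()), PolyTime.proj _, fun _ _ => rfl⟩

theorem PolyStr.input (j : ι) : PolyStr fun κ (x : X κ) => StrEnc.toStrs x j :=
  ⟨fun v => v (.inr j), PolyTime.proj _, fun _ _ => rfl⟩

theorem PolyStr.comp {f : (ι' → Str) → Str} (hf : PolyTime f) {g : ι' → ∀ κ, X κ → Str}
    (hg : ∀ i, PolyStr (g i)) : PolyStr fun κ x => f fun i => g i κ x := by
  choose h hh hg using hg
  exact ⟨fun v => f fun i => h i v, hf.comp hh, fun κ x => by simp only [hg]⟩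

theorem PolyStr.precomp {g : ∀ κ, Y κ → Str} (hg : PolyStr g) {u : ∀ κ, X κ → Y κ}
    (hu : PolyFn u) : PolyStr fun κ x => g κ (u κ x) := by
  obtain ⟨f, hf, hg⟩ := hg
  have := PolyStr.comp (X := X) hf (g := fun i κ x =>
    Sum.elim (fun _ => BlindFL.unary κ) (StrEnc.toStrs (u κ x)) i) (fun i => by
      rcases i with i | i
      · exact PolyStr.unary
      · exact hu i)
  simpa only [hg] using this

namespace PolyFn

theorem id : PolyFn fun κ (x : X κ) => x := fun j => PolyStr.input j

theorem comp {g : ∀ κ, Y κ → Z κ} (hg : PolyFn g) {u : ∀ κ, X κ → Y κ} (hu : PolyFn u) :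
    PolyFn fun κ x => g κ (u κ x) := fun j => (hg j).precomp hu

theorem fst {f : ∀ κ, X κ → Y κ × Z κ} (hf : PolyFn f) : PolyFn fun κ x => (f κ x).1 :=
  fun j => hf (.inl j)

theorem snd {f : ∀ κ, X κ → Y κ × Z κ} (hf : PolyFn f) : PolyFn fun κ x => (f κ x).2 :=
  fun j => hf (.inr j)

theorem pair {f : ∀ κ, X κ → Y κ} {g : ∀ κ, X κ → Z κ} (hf : PolyFn f) (hg : PolyFn g) :
    PolyFn fun κ x => (f κ x, g κ x) := fun j => by
  rcases j with j | j
  · exact hf j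
  · exact hg j

theorem ofPi {m : Type} [Fintype m] {f : ∀ κ, X κ → m → Y κ} (hf : PolyFn f) (i : m) :
    PolyFn fun κ x => f κ x i := fun j => hf (i, j)

theorem toPi {m : Type} [Fintype m] {f : ∀ κ, X κ → m → Y κ}
    (hf : ∀ i, PolyFn fun κ x => f κ x i) : PolyFn f := fun j => hf j.1 j.2

theorem ofMatrix {m n : Type} [Fintype m] [Fintype n] {f : ∀ κ, X κ → Matrix m n (Y κ)}
    (hf : PolyFn f) (i : m) (j : n) : PolyFn fun κ x => f κ x i j := fun a => hf (i, j, a)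

theorem toMatrix {m n : Type} [Fintype m] [Fintype n] {f : ∀ κ, X κ → Matrix m n (Y κ)}
    (hf : ∀ i j, PolyFn fun κ x => f κ x i j) : PolyFn f := fun a => hf a.1 a.2.1 a.2.2

theorem ofStrs {σ : Type} [Fintype σ] {f : ∀ κ, X κ → Strs σ} (hf : PolyFn f) (i : σ) :
    PolyFn fun κ x => (f κ x i : Str) := fun _ => hf i

theorem toStrs {σ : Type} [Fintype σ] {f : ∀ κ, X κ → Strs σ}
    (hf : ∀ i, PolyFn fun κ x => (f κ x i : Str)) : PolyFn f := fun i => hf i ()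

end PolyFn

namespace EPPT

theorem det {f : ∀ κ, X κ → Y κ} (hf : PolyFn f) : EPPT fun κ x => PMF.pure (f κ x) := by
  choose g hg hf using hf
  exact ⟨_, IsPPT.det hg, fun κ x => by simp only [PMF.pure_map, hf]⟩

theorem bind {F : ∀ κ, X κ → PMF (Y κ)} (hF : EPPT F) {H : ∀ κ, X κ → Y κ → PMF (Z κ)}
    (hH : EPPT fun κ (z : X κ × Y κ) => H κ z.1 z.2) :
    EPPT fun κ x => (F κ x).bind (H κ x) := by
  obtain ⟨f, hf, hF⟩ := hF
  obtain ⟨h, hh, hH⟩ := hH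
  refine ⟨_, hf.bind hh, fun κ x => ?_⟩
  rw [PMF.map_bind, ← hF, PMF.bind_map]
  congr 1
  funext y
  exact hH κ (x, y)

theorem comap {H : ∀ κ, Y κ → PMF (Z κ)} (hH : EPPT H) {u : ∀ κ, X κ → Y κ} (hu : PolyFn u) :
    EPPT fun κ x => H κ (u κ x) := by
  obtain ⟨h, hh, hH⟩ := hH
  choose g hg hu using hu
  exact ⟨_, hh.comap hg, fun κ x => by rw [hH]; congr 1; funext i; rw [hu]⟩

theorem map {F : ∀ κ, X κ → PMF (Y κ)} (hF : EPPT F) {f : ∀ κ, X κ → Y κ → Z κ}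
    (hf : PolyFn fun κ (z : X κ × Y κ) => f κ z.1 z.2) :
    EPPT fun κ x => (F κ x).map (f κ x) :=
  hF.bind (H := fun κ x y => PMF.pure (f κ x y)) (EPPT.det hf)

theorem of_isPPT {F : ℕ → (ι → Str) → PMF (ο → Str)} (hF : IsPPT F) :
    EPPT (X := fun _ => Strs ι) (Y := fun _ => Strs ο) F :=
  ⟨F, hF, fun _ _ => PMF.map_id _⟩

theorem pi {m : Type} [Fintype m] [DecidableEq m] {F : m → ∀ κ, X κ → PMF (Y κ)}
    (hF : ∀ i, EPPT (F i)) :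
    EPPT (Y := fun κ => m → Y κ) fun κ x => piPMF fun i => F i κ x := by
  choose G hG hF using hF
  refine ⟨_, IsPPT.pi hG, fun κ x => ?_⟩
  simp only [← hF]
  rw [← piPMF_map, PMF.map_comp]
  rfl

theorem const {F : ∀ κ, PMF (Y κ)}
    (hF : IsPPT fun κ (_ : Empty → Str) => (F κ).map StrEnc.toStrs) :
    EPPT fun κ (_ : X κ) => F κ := by
  refine ⟨_, hF.comap (ι := ι) (u := fun i => i.elim) fun i => i.elim, fun κ x => rfl⟩

theorem uniform_vector (q : Polynomial ℕ) :
    EPPT fun κ (_ : X κ) => PMF.uniformOfFintype (List.Vector Bool (q.eval κ)) := by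
  refine const (IsPPT.of_finite (ρ := Unit) (fun _ => q) (fun _ v => v (.inr (.inr ())))
    (fun _ => PolyTime.proj _) fun κ x => ?_)
  rw [← uniform_map_equiv (Equiv.funUnique Unit (List.Vector Bool (q.eval κ))), PMF.map_comp]
  rfl

theorem prod {F : ∀ κ, X κ → PMF (Y κ)} (hF : EPPT F) {H : ∀ κ, X κ → PMF (Z κ)} (hH : EPPT H) :
    EPPT fun κ x => (F κ x).bind fun y => (H κ x).map fun z => (y, z) :=
  hF.bind (H := fun κ x y => (H κ x).map fun z => (y, z))
    ((hH.comap PolyFn.id.fst).map (f := fun κ (s : X κ × Y κ) z => (s.2, z))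
      (PolyFn.id.fst.snd.pair PolyFn.id.snd))

end EPPT

end Encoded

/-! ## Homomorphic matrix operations -/

namespace HEScheme

variable {E : HEScheme} {κ : ℕ} {pk : Str} {l m n : Type}

theorem IsCipher.of_eq {u v : E.R κ} {c : Str} (h : E.IsCipher κ pk u c) (e : u = v) :
    E.IsCipher κ pk v c := e ▸ h

theorem IsCipher.csum {ι : Type} {f : ι → E.R κ} {g : ι → Str} (s : List ι)
    (h : ∀ i, E.IsCipher κ pk (f i) (g i)) :
    E.IsCipher κ pk (s.map f).sum (E.csum κ pk (s.map g)) := by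
  induction s with
  | nil => exact IsCipher.enc 0 _
  | cons i s ih => exact IsCipher.add (h i) ih

namespace IsCipherMat

theorem enc (M : E.Mat κ m n) (r : E.CoinMat κ m n) :
    E.IsCipherMat κ pk M (E.encMat κ pk M r) := fun _ _ => IsCipher.enc _ _

theorem add {M N : E.Mat κ m n} {C D : Matrix m n Str} (hC : E.IsCipherMat κ pk M C)
    (hD : E.IsCipherMat κ pk N D) : E.IsCipherMat κ pk (M + N) (E.addMat κ pk C D) :=
  fun i j => IsCipher.add (hC i j) (hD i j)

theorem smul (u : E.R κ) {M : E.Mat κ m n} {C : Matrix m n Str} (hC : E.IsCipherMat κ pk M C) :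
    E.IsCipherMat κ pk (u • M) (E.smulMat κ pk u C) :=
  fun i j => IsCipher.smul u (hC i j)

theorem transpose {M : E.Mat κ m n} {C : Matrix m n Str} (hC : E.IsCipherMat κ pk M C) :
    E.IsCipherMat κ pk Mᵀ Cᵀ := fun i j => hC j i

theorem mulLeft [Fintype m] (A : E.Mat κ l m) {M : E.Mat κ m n} {C : Matrix m n Str}
    (hC : E.IsCipherMat κ pk M C) : E.IsCipherMat κ pk (A * M) (E.mulLeft κ pk A C) := fun i j =>
  (IsCipher.csum (Finset.univ : Finset m).toList fun k => IsCipher.smul (A i k) (hC k j)).of_eq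
    (by rw [Matrix.mul_apply, Finset.sum_map_toList])

theorem mulRight [Fintype m] {M : E.Mat κ l m} {C : Matrix l m Str}
    (hC : E.IsCipherMat κ pk M C) (A : E.Mat κ m n) :
    E.IsCipherMat κ pk (M * A) (E.mulRight κ pk C A) := fun i j =>
  (IsCipher.csum (Finset.univ : Finset m).toList fun k => IsCipher.smul (A k j) (hC i k)).of_eq
    (by rw [Matrix.mul_apply, Finset.sum_map_toList]; simp only [mul_comm])

theorem lkup {b f v d : Type} {Q : E.Mat κ v d} {C : Matrix v d Str}
    (hC : E.IsCipherMat κ pk Q C) (X : b → f → v) :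
    E.IsCipherMat κ pk (BlindFL.lkup Q X) (BlindFL.lkup C X) := fun _ _ => hC _ _

theorem clkupBw {b f v d : Type} [Fintype b] [Fintype f] [DecidableEq v] {G : E.Mat κ b (f × d)}
    {C : Matrix b (f × d) Str} (hC : E.IsCipherMat κ pk G C) (X : b → f → v) :
    E.IsCipherMat κ pk (lkupBw G X) (E.clkupBw κ pk C X) := fun t c =>
  (IsCipher.csum (Finset.univ.filter fun p : b × f => X p.1 p.2 = t).toList
    fun p => hC p.1 (p.2, c)).of_eq (by rw [Finset.sum_map_toList]; rfl)

theorem he2ss {M : E.Mat κ m n} {C : Matrix m n Str} (hC : E.IsCipherMat κ pk M C)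
    (r : E.MaskMat κ m n) : E.IsCipherMat κ pk (M - E.mask κ r) (E.he2ss κ pk C r) := by
  rw [sub_eq_add_neg]
  exact hC.add (enc _ _)

theorem of_eq {M N : E.Mat κ m n} {C : Matrix m n Str} (hC : E.IsCipherMat κ pk M C) (e : M = N) :
    E.IsCipherMat κ pk N C := e ▸ hC

theorem cipherStep (η : E.R κ) {M N : E.Mat κ m n} {C D : Matrix m n Str}
    (hC : E.IsCipherMat κ pk M C) (hD : E.IsCipherMat κ pk N D) :
    E.IsCipherMat κ pk (M - η • N) (BlindFL.cipherStep (E := E) pk η C D) :=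
  (hC.add (hD.smul (-η))).of_eq (by rw [neg_smul, sub_eq_add_neg])

end IsCipherMat

theorem mem_support_keygen_of_keys {k : Keys} (hk : k ∈ (E.keys κ).support) (P : Party) :
    (k.pk P, k.sk P) ∈ (E.keygen κ).support := by
  simp only [keys, PMF.mem_support_bind_iff, PMF.mem_support_map_iff] at hk
  obtain ⟨a, ha, b, hb, rfl⟩ := hk
  cases P
  · exact ha
  · exact hb

theorem Correct.decMat (hC : E.Correct) {k : Keys} (hk : k ∈ (E.keys κ).support) (P : Party)
    {M : E.Mat κ m n} {C : Matrix m n Str} (h : E.IsCipherMat κ (k.pk P) M C) :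
    E.decMat κ (k.sk P) C = M := by
  ext i j
  exact hC κ _ (mem_support_keygen_of_keys hk P) _ _ (h i j)

end HEScheme

/-! ### Correctness of the backward messages and of the model update -/

section ModelUpdate

variable {E : HEScheme} {sh : Shape} {κ : ℕ}

theorem lkup_add {b f v d : Type} {α : Type} [Add α] (Q Q' : Matrix v d α) (X : b → f → v) :
    lkup (Q + Q') X = lkup Q X + lkup Q' X := rfl

/-! ## The messages of the backward protocol -/

section Bw

variable {k : Keys} {a : BwInputA E sh κ} {b : BwInputB E sh κ}

/-- The plaintext is ψ_Aᵀ ∇Z, rewritten by means of E_A = ψ_A + (E_A - ψ_A). In this form, once the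
mask is subtracted, it is an output of `B` minus a product of inputs of `B`, which the simulator for
`B` can compute. -/
theorem isCipher_gradWA (h : BwConsistent k a b) (r : E.CoinMat κ sh.Batch sh.Outs) :
    E.IsCipherMat κ (k.pk .B) (gradWA a.layer b.layer b.gradZ - b.shareᵀ * b.gradZ)
      (E.mulLeft κ (k.pk .B) a.psiᵀ (E.encMat κ (k.pk .B) b.gradZ r)) := by
  refine (HEScheme.IsCipherMat.enc b.gradZ r).mulLeft a.psiᵀ |>.of_eq ?_
  rw [gradWA, ← h.shareA, Matrix.transpose_add, Matrix.add_mul, add_sub_cancel_right]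

theorem isCipher_gradWB (h : BwConsistent k a b) (r : E.CoinMat κ sh.Batch sh.Outs) :
    E.IsCipherMat κ (k.pk .B) (gradWB a.layer b.layer b.gradZ - b.psiᵀ * b.gradZ)
      (E.mulLeft κ (k.pk .B) a.shareᵀ (E.encMat κ (k.pk .B) b.gradZ r)) := by
  refine (HEScheme.IsCipherMat.enc b.gradZ r).mulLeft a.shareᵀ |>.of_eq ?_
  rw [gradWB, ← h.shareB, Matrix.transpose_add, Matrix.add_mul, add_sub_cancel_left]

theorem isCipher_gradQA (a : BwInputA E sh κ) (b : BwInputB E sh κ)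
    (r : E.CoinMat κ sh.Batch sh.Outs) (r' : E.CoinMat κ sh.Batch (sh.Ins .A)) :
    E.IsCipherMat κ (k.pk .B) (gradQA a.layer b.layer b.gradZ)
      (E.clkupBw κ (k.pk .B) (E.addMat κ (k.pk .B)
        (E.mulRight κ (k.pk .B) (E.encMat κ (k.pk .B) b.gradZ r) a.layer.Uᵀ)
        (E.encMat κ (k.pk .B) (b.gradZ * b.layer.Votherᵀ) r')) a.layer.X) := by
  refine (((HEScheme.IsCipherMat.enc b.gradZ r).mulRight a.layer.Uᵀ).add
    (HEScheme.IsCipherMat.enc (b.gradZ * b.layer.Votherᵀ) r')).clkupBw a.layer.X |>.of_eq ?_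
  rw [gradQA, weightA, Matrix.transpose_add, Matrix.mul_add]

/-- Here, unlike for ∇Q_A, a stored ciphertext of V_B enters, and consistency of the inputs is
needed to know its plaintext. -/
theorem isCipher_gradQB (h : BwConsistent k a b) (r : E.CoinMat κ sh.Batch (sh.Ins .B)) :
    E.IsCipherMat κ (k.pk .A) (gradQB a.layer b.layer b.gradZ)
      (E.clkupBw κ (k.pk .A) (E.addMat κ (k.pk .A)
        (E.mulLeft κ (k.pk .A) b.gradZ b.layer.cVᵀ)
        (E.encMat κ (k.pk .A) (b.gradZ * b.layer.Uᵀ) r)) b.layer.X) := by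
  refine ((h.layer.cVB.transpose.mulLeft b.gradZ).add
    (HEScheme.IsCipherMat.enc (b.gradZ * b.layer.Uᵀ) r)).clkupBw b.layer.X |>.of_eq ?_
  rw [gradQB, weightB, Matrix.transpose_add, Matrix.mul_add, add_comm]

variable (hC : E.Correct) (hk : k ∈ (E.keys κ).support) (h : BwConsistent k a b)
  (rA : BwRandA E sh κ) (rB : BwRandB E sh κ)
include hC hk h

/-- `B` decrypts this share and encrypts it again for `A`. Replacing it by an explicit function of
inputs and masks removes the secret key of `B` from the view of `A`, without which IND-CPA could not
be applied; the next three facts serve the same purpose. -/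
theorem bwShareWA_eq : bwShareWA (k.sk .B) b (bwRecv k a b rA rB).2.mWA =
    gradWA a.layer b.layer b.gradZ - E.mask κ rA.phi := by
  rw [bwShareWA, show E.decMat κ (k.sk .B) (bwRecv k a b rA rB).2.mWA = _ from
    hC.decMat hk .B ((isCipher_gradWA h rB.coinZ).he2ss rA.phi)]
  abel

theorem bwShareWB_eq : bwShareWB (k.sk .B) b (bwRecv k a b rA rB).2.mWB =
    gradWB a.layer b.layer b.gradZ - E.mask κ rA.xi := by
  rw [bwShareWB, show E.decMat κ (k.sk .B) (bwRecv k a b rA rB).2.mWB = _ from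
    hC.decMat hk .B ((isCipher_gradWB h rB.coinZ).he2ss rA.xi)]
  abel

omit h in
theorem decMat_mQA : E.decMat κ (k.sk .B) (bwRecv k a b rA rB).2.mQA =
    gradQA a.layer b.layer b.gradZ - E.mask κ rA.rho :=
  hC.decMat hk .B ((isCipher_gradQA a b rB.coinZ rB.coinZV).he2ss rA.rho)

theorem decMat_mQB : E.decMat κ (k.sk .A) (bwRecv k a b rA rB).1.mQB =
    gradQB a.layer b.layer b.gradZ - E.mask κ rB.rho :=
  hC.decMat hk .A ((isCipher_gradQB h rB.coinZU).he2ss rB.rho)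

/-- What `A` receives. -/
theorem bwRecv_fst : (bwRecv k a b rA rB).1 =
    { cZ := E.encMat κ (k.pk .B) b.gradZ rB.coinZ
      cZV := E.encMat κ (k.pk .B) (b.gradZ * b.layer.Votherᵀ) rB.coinZV
      cWA := E.encMat κ (k.pk .B) (gradWA a.layer b.layer b.gradZ - E.mask κ rA.phi) rB.coinWA
      cWB := E.encMat κ (k.pk .B) (gradWB a.layer b.layer b.gradZ - E.mask κ rA.xi) rB.coinWB
      mQB := bwMsgQB (k.pk .A) b rB
      cQA := E.encMat κ (k.pk .B) (gradQA a.layer b.layer b.gradZ - E.mask κ rA.rho)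
        rB.coinQA } := by
  rw [← bwShareWA_eq hC hk h rA rB, ← bwShareWB_eq hC hk h rA rB, ← decMat_mQA hC hk rA rB]
  rfl

/-- What `B` receives. -/
theorem bwRecv_snd : (bwRecv k a b rA rB).2 =
    { mWA := bwMsgWA (k.pk .B) a rA (E.encMat κ (k.pk .B) b.gradZ rB.coinZ)
      mWB := bwMsgWB (k.pk .B) a rA (E.encMat κ (k.pk .B) b.gradZ rB.coinZ)
      cPhi := E.encMat κ (k.pk .A) (E.mask κ rA.phi) rA.coinPhi
      cXi := E.encMat κ (k.pk .A) (E.mask κ rA.xi) rA.coinXi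
      mQA := bwMsgQA (k.pk .B) a rA (E.encMat κ (k.pk .B) b.gradZ rB.coinZ)
        (E.encMat κ (k.pk .B) (b.gradZ * b.layer.Votherᵀ) rB.coinZV)
      cQB := E.encMat κ (k.pk .A) (gradQB a.layer b.layer b.gradZ - E.mask κ rB.rho)
        rA.coinQB } := by
  rw [← decMat_mQB hC hk h rA rB]
  rfl

/-- Together with `bwOutB_eq`: an execution has exactly the outputs of the functionality, with the
masks of the transformations as its random pieces. -/
theorem bwOutA_eq : bwOutA (k.sk .A) rA (bwRecv k a b rA rB).1 =
    { phi := E.mask κ rA.phi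
      xi := E.mask κ rA.xi
      rho := E.mask κ rA.rho
      gradQB := gradQB a.layer b.layer b.gradZ - E.mask κ rB.rho } := by
  rw [← decMat_mQB hC hk h rA rB]
  rfl

theorem bwOutB_eq : bwOutB (k.sk .B) b rB (bwRecv k a b rA rB).2 =
    { gradWA := gradWA a.layer b.layer b.gradZ - E.mask κ rA.phi
      gradWB := gradWB a.layer b.layer b.gradZ - E.mask κ rA.xi
      gradQA := gradQA a.layer b.layer b.gradZ - E.mask κ rA.rho
      rho := E.mask κ rB.rho } := by
  rw [← bwShareWA_eq hC hk h rA rB, ← bwShareWB_eq hC hk h rA rB, ← decMat_mQA hC hk rA rB]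
  rfl

end Bw

/-- The two parties hold complementary shares of each gradient, so the masks cancel in the sum of
the updated pieces. Each ciphertext that a party receives for an encrypted piece encrypts exactly
the share by which the other party changes the matching plain piece. -/
theorem updatesModels (hC : E.Correct) : UpdatesModels E sh := by
  intro κ k hk a b h rA rB η
  dsimp only
  rw [bwOutA_eq hC hk h, bwOutB_eq hC hk h, bwRecv_fst hC hk h, bwRecv_snd hC hk h]
  refine ⟨⟨?_, ?_, ?_, ?_, ?_, ?_⟩, ?_, ?_, ?_, ?_⟩
  · exact h.layer.cTA.cipherStep η (.enc _ _)
  · exact h.layer.cVA.cipherStep η (.enc _ _)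
  · exact h.layer.cUB.cipherStep η (.enc _ _)
  · exact h.layer.cTB.cipherStep η (.enc _ _)
  · exact h.layer.cVB.cipherStep η (.enc _ _)
  · exact h.layer.cUA.cipherStep η (.enc _ _)
  · simp only [weightA, updateA, updateB, smul_sub]; abel
  · simp only [weightB, updateA, updateB, smul_sub]; abel
  · simp only [tableA, updateA, updateB, smul_sub]; abel
  · simp only [tableB, updateA, updateB, smul_sub]; abel

end ModelUpdate

/-! ## Polynomial-time operations of the scheme -/

section Operations

variable {ι ο : Type} [Fintype ι] [Fintype ο] {X Y : ℕ → Type} [∀ κ, StrEnc ι (X κ)]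
  [∀ κ, StrEnc ο (Y κ)]

theorem PolyStr.comp₁ {f : (Fin 1 → Str) → Str} (hf : PolyTime f) {g₀ : ∀ κ, X κ → Str}
    (h₀ : PolyStr g₀) : PolyStr fun κ x => f ![g₀ κ x] := by
  rw [show (fun κ x => f ![g₀ κ x]) = fun κ x => f fun _ => g₀ κ x by
    funext κ x; congr 1; funext i; fin_cases i; rfl]
  exact PolyStr.comp hf fun _ => h₀

theorem PolyStr.comp₂ {f : (Fin 2 → Str) → Str} (hf : PolyTime f) {g₀ g₁ : ∀ κ, X κ → Str}
    (h₀ : PolyStr g₀) (h₁ : PolyStr g₁) : PolyStr fun κ x => f ![g₀ κ x, g₁ κ x] := by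
  rw [show (fun κ x => f ![g₀ κ x, g₁ κ x]) = fun κ x => f fun i => ![g₀, g₁] i κ x by
    funext κ x; congr 1; funext i; fin_cases i <;> rfl]
  exact PolyStr.comp hf (by simp [Fin.forall_fin_succ, *])

theorem PolyStr.comp₃ {f : (Fin 3 → Str) → Str} (hf : PolyTime f) {g₀ g₁ g₂ : ∀ κ, X κ → Str}
    (h₀ : PolyStr g₀) (h₁ : PolyStr g₁) (h₂ : PolyStr g₂) :
    PolyStr fun κ x => f ![g₀ κ x, g₁ κ x, g₂ κ x] := by
  rw [show (fun κ x => f ![g₀ κ x, g₁ κ x, g₂ κ x]) = fun κ x => f fun i => ![g₀, g₁, g₂] i κ x by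
    funext κ x; congr 1; funext i; fin_cases i <;> rfl]
  exact PolyStr.comp hf (by simp [Fin.forall_fin_succ, *])

theorem PolyStr.comp₄ {f : (Fin 4 → Str) → Str} (hf : PolyTime f)
    {g₀ g₁ g₂ g₃ : ∀ κ, X κ → Str} (h₀ : PolyStr g₀) (h₁ : PolyStr g₁) (h₂ : PolyStr g₂)
    (h₃ : PolyStr g₃) : PolyStr fun κ x => f ![g₀ κ x, g₁ κ x, g₂ κ x, g₃ κ x] := by
  rw [show (fun κ x => f ![g₀ κ x, g₁ κ x, g₂ κ x, g₃ κ x]) = fun κ x => f fun i => ![g₀, g₁, g₂, g₃] i κ x by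
    funext κ x; congr 1; funext i; fin_cases i <;> rfl]
  exact PolyStr.comp hf (by simp [Fin.forall_fin_succ, *])

/-- Branching on a categorical value. -/
theorem PolyFn.ite {n : ℕ} {u : ∀ κ, X κ → Fin n} (hu : PolyFn u) (t : Fin n)
    {f g : ∀ κ, X κ → Y κ} (hf : PolyFn f) (hg : PolyFn g) :
    PolyFn fun κ x => if u κ x = t then f κ x else g κ x := fun j => by
  convert PolyStr.comp₃ PolyTime.selectBit_polyTime (hu t) (hf j) (hg j) using 3 with κ x
  by_cases h : u κ x = t <;> simp [PolyTime.selectBit, StrEnc.toStrs, h]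

theorem EPPT.uniform_pi {m : Type} [Fintype m] [DecidableEq m] [∀ κ, Fintype (Y κ)]
    [∀ κ, Nonempty (Y κ)] (h : EPPT fun κ (_ : X κ) => PMF.uniformOfFintype (Y κ)) :
    EPPT fun κ (_ : X κ) => PMF.uniformOfFintype (m → Y κ) := by
  have := EPPT.pi (m := m) fun _ => h
  simpa only [piPMF_uniform] using this

namespace HEScheme.Efficient

variable {E : HEScheme} (hE : E.Efficient) {l m n : Type} [Fintype l] [Fintype m] [Fintype n]
include hE

theorem polyFn_zero : PolyFn fun κ (_ : X κ) => (0 : E.R κ) := fun _ => by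
  obtain ⟨f, hf, h⟩ := hE.zero
  have := PolyStr.comp₁ hf (PolyStr.unary (X := X))
  simp only [h] at this
  exact this

theorem polyFn_neg {f : ∀ κ, X κ → E.R κ} (hf : PolyFn f) : PolyFn fun κ x => -f κ x := fun _ => by
  obtain ⟨g, hg, h⟩ := hE.neg
  have := PolyStr.comp₂ hg PolyStr.unary (hf ())
  simp only [StrEnc.toStrs, h] at this
  exact this

theorem polyFn_add {f g : ∀ κ, X κ → E.R κ} (hf : PolyFn f) (hg : PolyFn g) :
    PolyFn fun κ x => f κ x + g κ x := fun _ => by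
  obtain ⟨p, hp, h⟩ := hE.plus
  have := PolyStr.comp₃ hp PolyStr.unary (hf ()) (hg ())
  simp only [StrEnc.toStrs, h] at this
  exact this

theorem polyFn_mul {f g : ∀ κ, X κ → E.R κ} (hf : PolyFn f) (hg : PolyFn g) :
    PolyFn fun κ x => f κ x * g κ x := fun _ => by
  obtain ⟨p, hp, h⟩ := hE.times
  have := PolyStr.comp₃ hp PolyStr.unary (hf ()) (hg ())
  simp only [StrEnc.toStrs, h] at this
  exact this

theorem polyFn_sub {f g : ∀ κ, X κ → E.R κ} (hf : PolyFn f) (hg : PolyFn g) :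
    PolyFn fun κ x => f κ x - g κ x := by
  simpa only [sub_eq_add_neg] using hE.polyFn_add hf (hE.polyFn_neg hg)

/-- The index set does not depend on `κ`, so the number of additions is constant and induction over
the set gives polynomial time. -/
theorem polyFn_sum {α : Type} (s : Finset α) {f : α → ∀ κ, X κ → E.R κ}
    (hf : ∀ a, PolyFn (f a)) : PolyFn fun κ x => ∑ a ∈ s, f a κ x := by
  classical
  induction s using Finset.induction with
  | empty => simpa using hE.polyFn_zero
  | insert a s ha ih => simpa only [Finset.sum_insert ha] using hE.polyFn_add (hf a) ih

theorem polyFn_enc {pk : ∀ κ, X κ → Str} (hpk : PolyFn pk) {v : ∀ κ, X κ → E.R κ}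
    (hv : PolyFn v) {r : ∀ κ, X κ → E.Coin κ} (hr : PolyFn r) :
    PolyFn fun κ x => E.enc κ (pk κ x) (v κ x) (r κ x) := fun _ => by
  obtain ⟨p, hp, h⟩ := hE.enc
  have := PolyStr.comp₄ hp PolyStr.unary (hpk ()) (hv ()) (hr ())
  simp only [StrEnc.toStrs, h] at this
  exact this

theorem polyFn_dec {sk : ∀ κ, X κ → Str} (hsk : PolyFn sk) {c : ∀ κ, X κ → Str}
    (hc : PolyFn c) : PolyFn fun κ x => E.dec κ (sk κ x) (c κ x) := fun _ => by
  obtain ⟨p, hp, h⟩ := hE.dec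
  have := PolyStr.comp₃ hp PolyStr.unary (hsk ()) (hc ())
  simp only [StrEnc.toStrs, h] at this
  exact this

theorem polyFn_matAdd {f g : ∀ κ, X κ → E.Mat κ m n} (hf : PolyFn f) (hg : PolyFn g) :
    PolyFn fun κ x => f κ x + g κ x :=
  PolyFn.toMatrix fun i j => hE.polyFn_add (hf.ofMatrix i j) (hg.ofMatrix i j)

theorem polyFn_matSub {f g : ∀ κ, X κ → E.Mat κ m n} (hf : PolyFn f) (hg : PolyFn g) :
    PolyFn fun κ x => f κ x - g κ x :=
  PolyFn.toMatrix fun i j => hE.polyFn_sub (hf.ofMatrix i j) (hg.ofMatrix i j)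

theorem polyFn_matMul {f : ∀ κ, X κ → E.Mat κ l m} {g : ∀ κ, X κ → E.Mat κ m n} (hf : PolyFn f)
    (hg : PolyFn g) : PolyFn fun κ x => f κ x * g κ x :=
  PolyFn.toMatrix fun i j => by
    simpa only [Matrix.mul_apply] using hE.polyFn_sum Finset.univ fun k =>
      hE.polyFn_mul (hf.ofMatrix i k) (hg.ofMatrix k j)

theorem polyFn_encMat {pk : ∀ κ, X κ → Str} (hpk : PolyFn pk) {M : ∀ κ, X κ → E.Mat κ m n}
    (hM : PolyFn M) {r : ∀ κ, X κ → E.CoinMat κ m n} (hr : PolyFn r) :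
    PolyFn fun κ x => E.encMat κ (pk κ x) (M κ x) (r κ x) :=
  PolyFn.toMatrix fun i j => hE.polyFn_enc hpk (hM.ofMatrix i j) (hr.ofMatrix i j)

theorem polyFn_decMat {sk : ∀ κ, X κ → Str} (hsk : PolyFn sk) {C : ∀ κ, X κ → Matrix m n Str}
    (hC : PolyFn C) : PolyFn fun κ x => E.decMat κ (sk κ x) (C κ x) :=
  PolyFn.toMatrix fun i j => hE.polyFn_dec hsk (hC.ofMatrix i j)

/-- A looked-up entry is the sum over the whole vocabulary of the entries with matching index and
zeros otherwise. The one-hot encoding makes each match a single bit to branch on, and the vocabulary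
has fixed size. -/
theorem polyFn_lkup {v : ℕ} {Q : ∀ κ, X κ → E.Mat κ (Fin v) n} (hQ : PolyFn Q)
    {F : ∀ κ, X κ → l → m → Fin v} (hF : PolyFn F) :
    PolyFn fun κ x => lkup (Q κ x) (F κ x) :=
  PolyFn.toMatrix fun i j => by
    have := hE.polyFn_sum Finset.univ fun t : Fin v =>
      ((hF.ofPi i).ofPi j.1).ite t (hQ.ofMatrix t j.2) hE.polyFn_zero
    simpa [lkup] using this

theorem polyFn_lkupBw {v : ℕ} {G : ∀ κ, X κ → E.Mat κ l (m × n)} (hG : PolyFn G)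
    {F : ∀ κ, X κ → l → m → Fin v} (hF : PolyFn F) :
    PolyFn fun κ x => lkupBw (G κ x) (F κ x) :=
  PolyFn.toMatrix fun t c => by
    have := hE.polyFn_sum Finset.univ fun p : l × m =>
      ((hF.ofPi p.1).ofPi p.2).ite t (hG.ofMatrix p.1 (p.2, c)) hE.polyFn_zero
    simpa only [lkupBw, Finset.sum_filter] using this

theorem eppt_keygen : EPPT fun κ (_ : X κ) => E.keygen κ := by
  refine EPPT.const ?_
  have := hE.keygen.map_reindex (Sum.elim (fun _ : Unit => (0 : Fin 2)) fun _ : Unit => 1)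
  simp only [PMF.map_comp] at this
  convert this using 4 with κ x k
  funext k j
  rcases j with j | j <;> rfl

end HEScheme.Efficient

theorem PolyFn.transpose {m n : Type} [Fintype m] [Fintype n] {f : ∀ κ, X κ → Matrix m n (Y κ)}
    (hf : PolyFn f) : PolyFn fun κ x => (f κ x)ᵀ := PolyFn.toMatrix fun i j => hf.ofMatrix j i

variable {E : HEScheme} {m n : Type} [Fintype m] [Fintype n]

theorem PolyFn.mask {r : ∀ κ, X κ → E.MaskMat κ m n} (hr : PolyFn r) :
    PolyFn fun κ x => E.mask κ (r κ x) := PolyFn.toMatrix fun i j => (hr.ofMatrix i j).fst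

/-- The randomness of a transformation from given masks and coins. -/
def maskMat {κ : ℕ} (φ : E.Mat κ m n) (c : E.CoinMat κ m n) : E.MaskMat κ m n :=
  fun i j => (φ i j, c i j)

theorem PolyFn.maskMat {φ : ∀ κ, X κ → E.Mat κ m n} (hφ : PolyFn φ)
    {c : ∀ κ, X κ → E.CoinMat κ m n} (hc : PolyFn c) :
    PolyFn fun κ x => maskMat (φ κ x) (c κ x) :=
  PolyFn.toMatrix fun i j => (hφ.ofMatrix i j).pair (hc.ofMatrix i j)

theorem eppt_coin : EPPT fun κ (_ : X κ) => PMF.uniformOfFintype (E.Coin κ) :=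
  EPPT.uniform_vector E.coinLen

theorem eppt_coinMat [DecidableEq m] [DecidableEq n] :
    EPPT fun κ (_ : X κ) => PMF.uniformOfFintype (E.CoinMat κ m n) :=
  (EPPT.uniform_pi (m := m) (EPPT.uniform_pi (m := n) (eppt_coin (E := E) (X := X))))

/-- A matrix with independent entries. -/
def matPMF {α : Type} [DecidableEq m] [DecidableEq n] (p : PMF α) : PMF (Matrix m n α) :=
  piPMF fun _ : m => piPMF fun _ : n => p

theorem matPMF_close {α : Type} [DecidableEq m] [DecidableEq n] {p q : PMF α} {ε : ℝ}
    (h : Close ε p q) : Close (Fintype.card m * (Fintype.card n * ε))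
      (matPMF p : PMF (Matrix m n α)) (matPMF q) :=
  piPMF_close fun _ => piPMF_close fun _ => h

theorem matPMF_uniform {α : Type} [Fintype α] [Nonempty α] [DecidableEq m] [DecidableEq n] :
    matPMF (PMF.uniformOfFintype α) = PMF.uniformOfFintype (Matrix m n α) := by
  simp only [matPMF, piPMF_uniform]
  rfl

theorem eppt_matPMF [DecidableEq m] [DecidableEq n] {G : ∀ κ, PMF (Y κ)}
    (h : EPPT fun κ (_ : X κ) => G κ) :
    EPPT fun κ (_ : X κ) => (matPMF (G κ) : PMF (Matrix m n (Y κ))) :=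
  EPPT.pi (m := m) fun _ => EPPT.pi (m := n) fun _ => h

end Operations

/-! ## Chosen-plaintext security for several messages -/

section LeftOrRight

variable (E : HEScheme) {ι : Type} [Fintype ι] [DecidableEq ι] {S : ℕ → Type}
  {σ : Type} [Fintype σ] [∀ κ, StrEnc σ (S κ)]

/-- A state is sampled from the public key, and the final test gets the state and encryptions of
messages that depend on the state. -/
def encGame (D : ∀ κ, Str → PMF (S κ)) (fin : ∀ κ, S κ → (ι → Str) → PMF (Unit → Str))
    (msg : ∀ κ, S κ → ι → E.R κ) (κ : ℕ) : PMF (Unit → Str) :=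
  (E.keygen κ).bind fun k => (D κ k.1).bind fun s =>
    (PMF.uniformOfFintype (ι → E.Coin κ)).bind fun r =>
      fin κ s fun i => E.enc κ k.1 (msg κ s i) (r i)

variable {E} (hE : E.Efficient) (hCPA : E.INDCPA) {advice : ℕ → Str} {p : Polynomial ℕ}
  (hadv : ∀ κ, (advice κ).length ≤ p.eval κ) {D : ∀ κ, Str → PMF (S κ)}
  (hD : EPPT fun κ (x : Advised advice κ × Str) => D κ x.2)
  {fin : ∀ κ, S κ → (ι → Str) → PMF (Unit → Str)}
  (hfin : EPPT (Y := fun _ => Strs Unit) fun κ (x : S κ × (ι → Str)) => fin κ x.1 x.2)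
include hE hCPA hadv hD hfin

/-- The reduction encrypts all messages of `msg₀` itself and submits the two candidates for
coordinate `i`. Its second stage overwrites coordinate `i` by the challenge, which gives the game
for `msg₀` or `msg₁` according to the challenge bit, because the two agree elsewhere. -/
theorem encGame_change_one {msg₀ msg₁ : ∀ κ, S κ → ι → E.R κ} (h₀ : PolyFn msg₀)
    (h₁ : PolyFn msg₁) (i : ι) (hne : ∀ κ s, ∀ j ≠ i, msg₀ κ s j = msg₁ κ s j) :
    Negligible fun κ =>
      |accept (encGame E D fin msg₁ κ) - accept (encGame E D fin msg₀ κ)| := by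
  have hfin' : EPPT (Y := fun _ => Strs Unit) fun κ (x : (S κ × (ι → Str)) × Str) =>
      fin κ x.1.1 (Function.update x.1.2 i x.2) := by
    refine hfin.comap (u := fun κ (x : (S κ × (ι → Str)) × Str) =>
      (x.1.1, Function.update x.1.2 i x.2)) (PolyFn.id.fst.fst.pair (PolyFn.toPi fun j => ?_))
    by_cases hj : j = i
    · subst hj
      simpa using PolyFn.id.snd
    · simpa [hj] using PolyFn.id.fst.snd.ofPi j
  obtain ⟨G, hG, hG'⟩ := hfin'
  have hG'' : ∀ κ (s : S κ) (cs : ι → Str) (c : Str),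
      G κ (Sum.elim (StrEnc.toStrs (s, cs)) fun _ => c) = fin κ s (Function.update cs i c) := by
    intro κ s cs c
    exact (hG' κ ((s, cs), c)).symm.trans (PMF.map_id _)
  let choose : ∀ κ, Str → PMF ((E.R κ × E.R κ) × (σ ⊕ ι × Unit → Str)) := fun κ pk =>
    (D κ pk).bind fun s => (PMF.uniformOfFintype (ι → E.Coin κ)).map fun r =>
      ((msg₀ κ s i, msg₁ κ s i), StrEnc.toStrs (s, fun j => E.enc κ pk (msg₀ κ s j) (r j)))
  have hchoose : IsNonuniformPPT fun κ (x : Unit → Str) => (choose κ (x ())).map fun m =>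
      Sum.elim ![E.code κ m.1.1, E.code κ m.1.2] m.2 := by
    have h1 : EPPT fun κ (x : Advised advice κ × Str) => (D κ x.2).bind fun s =>
        (PMF.uniformOfFintype (ι → E.Coin κ)).map fun r =>
          (((msg₀ κ s i, msg₁ κ s i), (s, fun j => E.enc κ x.2 (msg₀ κ s j) (r j))) :
            (E.R κ × E.R κ) × (S κ × (ι → Str))) := by
      let H : ∀ κ, Advised advice κ × Str → S κ → PMF ((E.R κ × E.R κ) × (S κ × (ι → Str))) :=
        fun κ x s => (PMF.uniformOfFintype (ι → E.Coin κ)).map fun r =>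
          ((msg₀ κ s i, msg₁ κ s i), (s, fun j => E.enc κ x.2 (msg₀ κ s j) (r j)))
      suffices hH : EPPT fun κ (z : (Advised advice κ × Str) × S κ) => H κ z.1 z.2 from hD.bind hH
      -- The identity on the whole context: its projections certify that each variable in scope can
      -- be computed, and efficiency of a construction is assembled from them. The same device is
      -- used throughout.
      have c : PolyFn fun κ (z : ((Advised advice κ × Str) × S κ) × (ι → E.Coin κ)) => z := PolyFn.id
      have hs := c.fst.snd
      have hr := c.snd
      have hpk := c.fst.fst.snd
      have hs₀ := h₀.comp hs
      have hs₁ := h₁.comp hs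
      have hpi := PolyFn.toPi (f := fun κ (z : ((Advised advice κ × Str) × S κ) × (ι → E.Coin κ)) j =>
        E.enc κ z.1.1.2 (msg₀ κ z.1.2 j) (z.2 j)) fun j =>
          hE.polyFn_enc hpk (hs₀.ofPi j) (hr.ofPi j)
      have hu : EPPT fun κ (_ : (Advised advice κ × Str) × S κ) =>
        PMF.uniformOfFintype (ι → E.Coin κ) := EPPT.uniform_pi eppt_coin
      have hf := ((hs₀.ofPi i).pair (hs₁.ofPi i)).pair (hs.pair hpi)
      exact hu.map hf
    obtain ⟨H, hH, hH'⟩ := h1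
    refine ⟨advice, p, _, hadv, hH.map_reindex (Sum.elim (fun b : Fin 2 => Sum.inl
      (if b = 0 then Sum.inl () else Sum.inr ())) Sum.inr), fun κ x => ?_⟩
    have := hH' κ ((() : Unit), x ())
    have e : (StrEnc.toStrs (((() : Unit), x ()) : Advised advice κ × Str)) =
        Sum.elim (fun _ : Unit => advice κ) x := by
      funext j; rcases j with j | j <;> rfl
    rw [e] at this
    simp only [← this, choose, PMF.map_bind, PMF.map_comp]
    congr 1
    funext s
    congr 1
    funext r j
    rcases j with j | j
    · fin_cases j <;> rfl
    · rfl
  have key := hCPA _ choose G hchoose hG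
  have hgame : ∀ b κ, E.cpaGame choose G b κ =
      encGame E D fin (if b then msg₁ else msg₀) κ := by
    intro b κ
    unfold HEScheme.cpaGame encGame
    congr 1
    funext k
    simp only [choose, PMF.bind_bind, PMF.bind_map, Function.comp_def]
    congr 1
    funext s
    -- The challenge is encrypted with coins of its own, while the reduction has also drawn coins
    -- for coordinate `i`. Resampling one coordinate of uniform coins identifies this with a single
    -- draw.
    rw [← uniform_bind_update i fun r : ι → E.Coin κ => fin κ s fun j =>
      E.enc κ k.1 ((if b then msg₁ else msg₀) κ s j) (r j)]
    congr 1
    funext r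
    congr 1
    funext c
    rw [hG'']
    congr 1
    funext j
    by_cases hj : j = i
    · subst hj
      cases b <;> simp
    · cases b <;> simp [hj, hne κ s j hj]
  simpa only [hgame, if_true, Bool.false_eq_true, if_false] using key

/-- Hybrid argument over the set `T` of coordinates already set to zero. The number of coordinates
is independent of `κ`, so the finite sum of advantages stays negligible. -/
theorem encGame_zero {msg : ∀ κ, S κ → ι → E.R κ} (hmsg : PolyFn msg) :
    Negligible fun κ =>
      |accept (encGame E D fin msg κ) - accept (encGame E D fin (fun _ _ _ => 0) κ)| := by
  have key : ∀ T : Finset ι, Negligible fun κ => |accept (encGame E D fin msg κ) -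
      accept (encGame E D fin (fun κ s j => if j ∈ T then 0 else msg κ s j) κ)| := by
    have hp : ∀ T : Finset ι, PolyFn fun κ (s : S κ) j => if j ∈ T then 0 else msg κ s j := by
      intro T
      refine PolyFn.toPi fun j => ?_
      by_cases hj : j ∈ T
      · simpa [hj] using hE.polyFn_zero
      · simpa [hj] using hmsg.ofPi j
    intro T
    induction T using Finset.induction with
    | empty => simpa using Negligible.zero
    | insert i T hi ih =>
      have h1 := encGame_change_one hE hCPA hadv hD hfin (hp (insert i T)) (hp T) i
        (fun κ s j hj => by simp [hj])
      exact (ih.add h1).of_le (fun _ => abs_nonneg _) fun κ => abs_sub_le _ _ _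
  simpa using key Finset.univ

end LeftOrRight

/-! ## Rerandomization -/

section Rerandomization

variable {E : HEScheme} {κ : ℕ} {m n : Type} [Fintype m] [Fintype n] [DecidableEq m]
  [DecidableEq n]

/-- Masks and coins of a transformation. -/
def maskMatEquiv : E.Mat κ m n × E.CoinMat κ m n ≃ E.MaskMat κ m n where
  toFun x := maskMat x.1 x.2
  invFun r := (E.mask κ r, r.map Prod.snd)

theorem uniform_bind_maskMat {β : Type} (f : E.MaskMat κ m n → PMF β) :
    (PMF.uniformOfFintype (E.MaskMat κ m n)).bind f =
      (PMF.uniformOfFintype (E.Mat κ m n)).bind fun φ =>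
        (PMF.uniformOfFintype (E.CoinMat κ m n)).bind fun c => f (maskMat φ c) := by
  rw [uniform_bind_equiv maskMatEquiv, uniform_bind_prod]
  rfl

/-- The continuation `K` stands for the rest of the experiment and may use the mask. For each fixed
mask the entries of the message have independent coins, so rerandomization applies entry by entry;
hence the message can be exchanged even where the mask appears in an output. -/
theorem he2ss_close {ε : ℝ} {pk : Str}
    (hR : ∀ u v c, E.IsCipher κ pk u c →
      statDist ((PMF.uniformOfFintype (E.Coin κ)).map fun r => E.add κ pk c (E.enc κ pk v r))
        ((PMF.uniformOfFintype (E.Coin κ)).map fun r => E.enc κ pk (u + v) r) ≤ ε)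
    {M : E.Mat κ m n} {C : Matrix m n Str} (hC : E.IsCipherMat κ pk M C) {β : Type}
    (K : E.Mat κ m n → Matrix m n Str → PMF β) :
    Close (Fintype.card m * (Fintype.card n * (2 * ε)))
      ((PMF.uniformOfFintype (E.MaskMat κ m n)).bind fun r => K (E.mask κ r) (E.he2ss κ pk C r))
      ((PMF.uniformOfFintype (E.Mat κ m n)).bind fun φ =>
        (PMF.uniformOfFintype (E.CoinMat κ m n)).bind fun c =>
          K φ (E.encMat κ pk (M - φ) c)) := by
  rw [uniform_bind_maskMat]
  refine Close.bind_right fun φ _ => ?_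
  have h : Close (Fintype.card m * (Fintype.card n * (2 * ε)))
      ((PMF.uniformOfFintype (E.CoinMat κ m n)).map fun c => E.he2ss κ pk C (maskMat φ c))
      ((PMF.uniformOfFintype (E.CoinMat κ m n)).map fun c => E.encMat κ pk (M - φ) c) := by
    have e : ∀ f : m → n → E.Coin κ → Str,
        (PMF.uniformOfFintype (E.CoinMat κ m n)).map (fun c => (fun i j => f i j (c i j) :
          Matrix m n Str)) = piPMF fun i => piPMF fun j =>
            (PMF.uniformOfFintype (E.Coin κ)).map (f i j) := by
      intro f
      rw [← matPMF_uniform]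
      simp only [← piPMF_map]
      rfl
    have e₁ := e fun i j r => E.add κ pk (C i j) (E.enc κ pk (-φ i j) r)
    have e₂ := e fun i j r => E.enc κ pk (M i j + -φ i j) r
    have h := piPMF_close fun i : m => piPMF_close fun j : n =>
      Close.of_statDist (hR _ (-φ i j) _ (hC i j))
    rw [← e₁, ← e₂] at h
    simp only [← sub_eq_add_neg] at h
    exact h
  have := h.bind_left (K φ)
  rw [PMF.bind_map, PMF.bind_map] at this
  exact this

end Rerandomization

/-! ## Simulation -/

instance (C : Coded) (κ : ℕ) : StrEnc C.Idx (C.T κ) := ⟨C.toStrs κ⟩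

section Simulation

variable {E : HEScheme} {F : Functionality} (pr : Protocol F) (P : Party)

/-- The randomness and the messages of `P`, with the outputs of both parties. -/
abbrev Protocol.Result (κ : ℕ) : Type :=
  ((pr.Rand P).T κ × (pr.Recv P).T κ) × ((F.Out .A).T κ × (F.Out .B).T κ)

/-- The result of an execution of the protocol. -/
def realView (κ : ℕ) (k : Keys) (a : (F.Inp .A).T κ) (b : (F.Inp .B).T κ) :
    PMF (pr.Result P κ) :=
  (PMF.uniformOfFintype ((pr.Rand .A).T κ)).bind fun rA =>
  (PMF.uniformOfFintype ((pr.Rand .B).T κ)).map fun rB =>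
    ((pick (α := fun P => (pr.Rand P).T κ) (rA, rB) P, pr.recv κ k a b rA rB P),
     (pr.output κ .A k.pk (k.sk .A) a rA (pr.recv κ k a b rA rB .A),
      pr.output κ .B k.pk (k.sk .B) b rB (pr.recv κ k a b rA rB .B)))

/-- The type of samplers of the randomness and the messages of `P` from its keys, input and
output. -/
abbrev Protocol.ViewSampler : Type :=
  ∀ κ, Strs (Fin 3) × (F.Inp P).T κ × (F.Out P).T κ → PMF ((pr.Rand P).T κ × (pr.Recv P).T κ)

variable {pr P}

/-- The result of an evaluation of the functionality, with a simulated view. -/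
def idealView (V : pr.ViewSampler P) (κ : ℕ) (k : Keys) (a : (F.Inp .A).T κ)
    (b : (F.Inp .B).T κ) : PMF (pr.Result P κ) :=
  (F.eval κ a b).bind fun out =>
    (V κ (k.known P, pick (α := fun P => (F.Inp P).T κ) (a, b) P,
      pick (α := fun P => (F.Out P).T κ) out P)).map fun v => (v, out)

/-- The adversary runs on the view, and the environment decides. -/
def finalTest {σ α : Type} (adv : ℕ → (pr.ViewIdx P → Str) → PMF (α → Str))
    (dist : ℕ → (FinalIdx F σ α → Str) → PMF (Unit → Str)) (κ : ℕ) (known : Fin 3 → Str)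
    (input : (F.Inp P).T κ) (st : σ → Str) (w : pr.Result P κ) : PMF (Unit → Str) :=
  (adv κ (Sum.elim known (Sum.elim ((F.Inp P).toStrs κ input)
    (Sum.elim ((pr.Rand P).toStrs κ w.1.1) ((pr.Recv P).toStrs κ w.1.2))))).bind fun a =>
  dist κ (Sum.elim st (Sum.elim a
    (Sum.elim ((F.Out .A).toStrs κ w.2.1) ((F.Out .B).toStrs κ w.2.2))))

/-- An interaction in which the view is sampled by `W`. -/
def interaction (E : HEScheme) {σ α : Type}
    (W : ∀ κ, Keys → (F.Inp .A).T κ → (F.Inp .B).T κ → PMF (pr.Result P κ))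
    (adv : ℕ → (pr.ViewIdx P → Str) → PMF (α → Str)) (choose : Chooser F σ)
    (dist : ℕ → (FinalIdx F σ α → Str) → PMF (Unit → Str)) (κ : ℕ) : PMF (Unit → Str) :=
  (E.keys κ).bind fun k => (choose κ (k.known P)).bind fun x => (W κ k x.1.1 x.1.2).bind
    (finalTest adv dist κ (k.known P) (pick (α := fun P => (F.Inp P).T κ) x.1 P) x.2)

theorem real_eq_interaction {σ α : Type} (adv : ℕ → (pr.ViewIdx P → Str) → PMF (α → Str))
    (choose : Chooser F σ) (dist : ℕ → (FinalIdx F σ α → Str) → PMF (Unit → Str)) (κ : ℕ) :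
    real E pr P adv choose dist κ = interaction E (realView pr P) adv choose dist κ := by
  simp only [real, interaction, realView, PMF.bind_bind, PMF.bind_map]
  rfl

/-- The simulator samples a view and runs the given adversary on it. This reduces simulation to
sampling the randomness and messages of `P` from its keys, input and output, whatever the adversary
does with them. -/
theorem exists_simulator {α : Type} [Fintype α] {adv : ℕ → (pr.ViewIdx P → Str) → PMF (α → Str)}
    (hadv : IsPPT adv) {V : pr.ViewSampler P} (hV : EPPT V) :
    ∃ sim : ℕ → (Fin 3 ⊕ (F.Inp P).Idx ⊕ (F.Out P).Idx → Str) → PMF (α → Str), IsPPT sim ∧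
      ∀ (σ : Type) (choose : Chooser F σ)
        (dist : ℕ → (FinalIdx F σ α → Str) → PMF (Unit → Str)) (κ : ℕ),
        ideal E F P sim choose dist κ = interaction E (idealView V) adv choose dist κ := by
  let H : ∀ κ, Strs (Fin 3) × (F.Inp P).T κ × (F.Out P).T κ →
      (pr.Rand P).T κ × (pr.Recv P).T κ → PMF (Strs α) := fun κ x v =>
    adv κ (Sum.elim x.1 (Sum.elim ((F.Inp P).toStrs κ x.2.1)
      (Sum.elim ((pr.Rand P).toStrs κ v.1) ((pr.Recv P).toStrs κ v.2))))
  have hH : EPPT fun κ (z : (Strs (Fin 3) × (F.Inp P).T κ × (F.Out P).T κ) ×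
      ((pr.Rand P).T κ × (pr.Recv P).T κ)) => H κ z.1 z.2 := by
    have c : PolyFn fun κ (z : (Strs (Fin 3) × (F.Inp P).T κ × (F.Out P).T κ) ×
      ((pr.Rand P).T κ × (pr.Recv P).T κ)) => z := PolyFn.id
    let u : ∀ κ, (Strs (Fin 3) × (F.Inp P).T κ × (F.Out P).T κ) ×
      ((pr.Rand P).T κ × (pr.Recv P).T κ) → Strs (pr.ViewIdx P) := fun κ z =>
        Sum.elim z.1.1 (Sum.elim ((F.Inp P).toStrs κ z.1.2.1)
          (Sum.elim ((pr.Rand P).toStrs κ z.2.1) ((pr.Recv P).toStrs κ z.2.2)))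
    have hu : PolyFn u := fun j => by
      rcases j with j | j | j | j
      · exact c.fst.fst j
      · exact c.fst.snd.fst j
      · exact c.snd.fst j
      · exact c.snd.snd j
    exact (EPPT.of_isPPT hadv).comap hu
  obtain ⟨sim, hsim, hs⟩ := hV.bind hH
  refine ⟨sim, hsim, fun σ choose dist κ => ?_⟩
  have hs' : ∀ (x : Fin 3 → Str) (i : (F.Inp P).T κ) (o : (F.Out P).T κ),
      sim κ (Sum.elim x (Sum.elim ((F.Inp P).toStrs κ i) ((F.Out P).toStrs κ o))) =
        (V κ (x, i, o)).bind (H κ (x, i, o)) := fun x i o =>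
    (hs κ (x, i, o)).symm.trans (PMF.map_id _)
  simp only [ideal, interaction, idealView, hs', PMF.bind_bind, PMF.bind_map]
  congr 1
  funext k
  congr 1
  funext x
  congr 1
  funext out
  exact PMF.bind_bind _ _ _

/-- Closeness for every admissible pair of inputs is preserved under averaging and postprocessing.
It therefore suffices for all environments, and no computational bound enters this step. -/
theorem interaction_close {W W' : ∀ κ, Keys → (F.Inp .A).T κ → (F.Inp .B).T κ →
    PMF (pr.Result P κ)} {ε : ℕ → ℝ}
    (h : ∀ κ, ∀ k ∈ (E.keys κ).support, ∀ a b, F.Admissible κ k a b →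
      Close (ε κ) (W κ k a b) (W' κ k a b)) {σ α : Type} [Fintype σ]
    (adv : ℕ → (pr.ViewIdx P → Str) → PMF (α → Str)) {choose : Chooser F σ}
    (hc : AdmissibleChooser E F P choose)
    (dist : ℕ → (FinalIdx F σ α → Str) → PMF (Unit → Str)) (κ : ℕ) :
    |accept (interaction E W adv choose dist κ) - accept (interaction E W' adv choose dist κ)| ≤
      ε κ :=
  Close.accept_le <| Close.bind_right fun k hk => Close.bind_right fun x hx =>
    (h κ k hk _ _ (hc.admissible κ k hk x hx)).bind_left _

end Simulation

/-! ## Samplers of masks and encryptions -/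

section Samplers

variable {E : HEScheme} {m n : Type} [Fintype m] [Fintype n] [DecidableEq m] [DecidableEq n]
  {κ : ℕ}

/-- The randomness of a transformation, with masks from `G`. -/
def maskPMF (G : PMF (E.R κ)) : PMF (E.MaskMat κ m n) :=
  (matPMF G).bind fun φ => (PMF.uniformOfFintype (E.CoinMat κ m n)).map fun c => maskMat φ c

/-- Encryptions of random plaintexts. -/
def encPMF (pk : Str) (G : PMF (E.R κ)) : PMF (Matrix m n Str) :=
  (matPMF G).bind fun φ => (PMF.uniformOfFintype (E.CoinMat κ m n)).map fun c =>
    E.encMat κ pk φ c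

theorem maskPMF_uniform :
    maskPMF (PMF.uniformOfFintype (E.R κ)) = PMF.uniformOfFintype (E.MaskMat κ m n) := by
  rw [maskPMF, matPMF_uniform]
  exact ((PMF.bind_pure _).symm.trans (uniform_bind_maskMat PMF.pure)).symm

theorem maskPMF_close {G G' : PMF (E.R κ)} {ε : ℝ} (h : Close ε G G') :
    Close (Fintype.card m * (Fintype.card n * ε)) (maskPMF G : PMF (E.MaskMat κ m n))
      (maskPMF G') :=
  (matPMF_close h).bind_left _

theorem encPMF_close (pk : Str) {G G' : PMF (E.R κ)} {ε : ℝ} (h : Close ε G G') :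
    Close (Fintype.card m * (Fintype.card n * ε)) (encPMF pk G : PMF (Matrix m n Str))
      (encPMF pk G') :=
  (matPMF_close h).bind_left _

/-- When the mask is used nowhere else, φ ↦ M - φ is a bijection of the matrices and the message
becomes an encryption of a uniform plaintext that does not depend on `M`. -/
theorem he2ss_close_encPMF {ε : ℝ} {pk : Str}
    (hR : ∀ u v c, E.IsCipher κ pk u c →
      statDist ((PMF.uniformOfFintype (E.Coin κ)).map fun r => E.add κ pk c (E.enc κ pk v r))
        ((PMF.uniformOfFintype (E.Coin κ)).map fun r => E.enc κ pk (u + v) r) ≤ ε)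
    {M : E.Mat κ m n} {C : Matrix m n Str} (hC : E.IsCipherMat κ pk M C) :
    Close (Fintype.card m * (Fintype.card n * (2 * ε)))
      ((PMF.uniformOfFintype (E.MaskMat κ m n)).map fun r => E.he2ss κ pk C r)
      (encPMF pk (PMF.uniformOfFintype (E.R κ))) := by
  have h := he2ss_close hR hC fun _ c => PMF.pure c
  rw [encPMF, matPMF_uniform, uniform_bind_equiv (Equiv.subLeft M)]
  exact h

variable {ι : Type} [Fintype ι] {X : ℕ → Type} [∀ κ, StrEnc ι (X κ)] {G : ∀ κ, PMF (E.R κ)}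

theorem eppt_maskPMF (hG : EPPT fun κ (_ : X κ) => G κ) :
    EPPT fun κ (_ : X κ) => (maskPMF (G κ) : PMF (E.MaskMat κ m n)) := by
  let H : ∀ κ, X κ → E.Mat κ m n → PMF (E.MaskMat κ m n) := fun κ _ φ =>
    (PMF.uniformOfFintype (E.CoinMat κ m n)).map fun c => maskMat φ c
  have hH : EPPT fun κ (z : X κ × E.Mat κ m n) => H κ z.1 z.2 := by
    have c : PolyFn fun κ (z : (X κ × E.Mat κ m n) × E.CoinMat κ m n) => z := PolyFn.id
    have hf := PolyFn.maskMat c.fst.snd c.snd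
    exact EPPT.map eppt_coinMat hf
  exact (eppt_matPMF hG).bind hH

theorem eppt_encPMF (hE : E.Efficient) (hG : EPPT fun κ (_ : X κ) => G κ)
    {pk : ∀ κ, X κ → Str} (hpk : PolyFn pk) :
    EPPT fun κ (x : X κ) => (encPMF (pk κ x) (G κ) : PMF (Matrix m n Str)) := by
  let H : ∀ κ, X κ → E.Mat κ m n → PMF (Matrix m n Str) := fun κ x φ =>
    (PMF.uniformOfFintype (E.CoinMat κ m n)).map fun c => E.encMat κ (pk κ x) φ c
  have hH : EPPT fun κ (z : X κ × E.Mat κ m n) => H κ z.1 z.2 := by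
    have c : PolyFn fun κ (z : (X κ × E.Mat κ m n) × E.CoinMat κ m n) => z := PolyFn.id
    have hf := hE.polyFn_encMat (hpk.comp c.fst.fst) c.fst.snd c.snd
    exact EPPT.map eppt_coinMat hf
  exact (eppt_matPMF hG).bind hH

/-- Uniform plaintexts can be sampled up to negligible distance. -/
theorem HEScheme.Efficient.exists_sampler (hE : E.Efficient) :
    ∃ (G : ∀ κ, PMF (E.R κ)) (ε : ℕ → ℝ), Negligible ε ∧
      (∀ κ, Close (ε κ) (PMF.uniformOfFintype (E.R κ)) (G κ)) ∧
      IsPPT fun κ (_ : Empty → Str) => (G κ).map fun v (_ : Unit) => E.code κ v := by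
  obtain ⟨G, ε, hG, hε, h⟩ := hE.sample
  exact ⟨G, fun κ => 2 * ε κ, hε.const_mul 2, fun κ => (Close.of_statDist (h κ)).symm, hG⟩

end Samplers

/-! ## Security of the forward protocol -/

section LayerFields

variable {E : HEScheme} {sh : Shape} {P : Party} {ι : Type} [Fintype ι] {X : ℕ → Type}
  [∀ κ, StrEnc ι (X κ)] {f : ∀ κ, X κ → LayerInput E sh P κ}

theorem PolyFn.layer_X (hf : PolyFn f) : PolyFn fun κ x => (f κ x).X := fun j => hf (.inl j)

theorem PolyFn.layer_S (hf : PolyFn f) : PolyFn fun κ x => (f κ x).S := fun j => hf (.inr (.inl j))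

theorem PolyFn.layer_U (hf : PolyFn f) : PolyFn fun κ x => (f κ x).U :=
  fun j => hf (.inr (.inr (.inl j)))

theorem PolyFn.layer_Vother (hf : PolyFn f) : PolyFn fun κ x => (f κ x).Vother :=
  fun j => hf (.inr (.inr (.inr (.inr (.inl j)))))

end LayerFields

section FwSecurity

variable {E : HEScheme} {sh : Shape} {κ : ℕ}

/-- Encryptions of random plaintexts in place of the three messages for party `P`. -/
def fwMsgPMF (sh : Shape) (Q : Party) (pk : Str) (G : PMF (E.R κ)) :
    PMF (Matrix sh.Batch (sh.Ins Q) Str × Matrix sh.Batch sh.Outs Str ×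
      Matrix sh.Batch sh.Outs Str) :=
  (encPMF pk G).bind fun m₁ => (encPMF pk G).bind fun m₂ => (encPMF pk G).map fun m₃ =>
    (m₁, m₂, m₃)

/-- The randomness of `P`, with masks from `G`. -/
def fwRandPMF (sh : Shape) (Q : Party) (G : PMF (E.R κ)) : PMF (FwRand E sh Q κ) :=
  (maskPMF G).bind fun r₁ => (maskPMF G).bind fun r₂ => (maskPMF G).map fun r₃ => (r₁, r₂, r₃)

/-- The number of mask entries of party `Q`. -/
def fwCount (sh : Shape) (Q : Party) : ℝ :=
  Fintype.card sh.Batch * Fintype.card (sh.Ins Q) +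
    2 * (Fintype.card sh.Batch * Fintype.card sh.Outs)

theorem fwRandPMF_uniform (Q : Party) :
    fwRandPMF sh Q (PMF.uniformOfFintype (E.R κ)) = PMF.uniformOfFintype (FwRand E sh Q κ) := by
  simp only [fwRandPMF, maskPMF_uniform]
  refine Eq.symm ((PMF.bind_pure _).symm.trans ?_)
  rw [uniform_bind_prod]
  congr 1
  funext r₁
  rw [uniform_bind_prod]
  rfl

theorem fwRandPMF_close (Q : Party) {G G' : PMF (E.R κ)} {ε : ℝ} (h : Close ε G G') :
    Close (fwCount sh Q * ε) (fwRandPMF sh Q G) (fwRandPMF sh Q G') := by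
  refine ((maskPMF_close h).bind fun r₁ _ => (maskPMF_close h).bind fun r₂ _ =>
    (maskPMF_close h).map _).mono (le_of_eq ?_)
  rw [fwCount]; ring

theorem fwMsgPMF_close (Q : Party) (pk : Str) {G G' : PMF (E.R κ)} {ε : ℝ} (h : Close ε G G') :
    Close (fwCount sh Q * ε) (fwMsgPMF sh Q pk G) (fwMsgPMF sh Q pk G') := by
  refine ((encPMF_close pk h).bind fun r₁ _ => (encPMF_close pk h).bind fun r₂ _ =>
    (encPMF_close pk h).map _).mono (le_of_eq ?_)
  rw [fwCount]; ring

/-- The three messages that party `Q` sends are close to encryptions of random plaintexts. -/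
theorem fwMsgs_close {ε : ℝ} {pk : Str}
    (hR : ∀ u v c, E.IsCipher κ pk u c →
      statDist ((PMF.uniformOfFintype (E.Coin κ)).map fun r => E.add κ pk c (E.enc κ pk v r))
        ((PMF.uniformOfFintype (E.Coin κ)).map fun r => E.enc κ pk (u + v) r) ≤ ε)
    {Q : Party} (x : LayerInput E sh Q κ) {T : E.Mat κ (sh.Voc Q) (sh.Dim Q)}
    {V : E.Mat κ (sh.Ins Q) sh.Outs} {U : E.Mat κ (sh.Ins Q.other) sh.Outs}
    (hT : E.IsCipherMat κ pk T x.cT) (hV : E.IsCipherMat κ pk V x.cV)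
    (hU : E.IsCipherMat κ pk U x.cUother) (sk : Str)
    (m : Matrix sh.Batch (sh.Ins Q.other) Str) :
    Close (fwCount sh Q * (2 * ε))
      ((PMF.uniformOfFintype (FwRand E sh Q κ)).map fun r =>
        (fwMsg₁ pk x r, fwMsg₂ pk x r, fwMsg₃ pk sk x r m))
      (fwMsgPMF sh Q pk (PMF.uniformOfFintype (E.R κ))) := by
  have e : ((PMF.uniformOfFintype (FwRand E sh Q κ)).map fun r =>
      (fwMsg₁ pk x r, fwMsg₂ pk x r, fwMsg₃ pk sk x r m)) =
      (PMF.uniformOfFintype (E.MaskMat κ sh.Batch (sh.Ins Q))).bind fun r₁ =>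
      ((PMF.uniformOfFintype (E.MaskMat κ sh.Batch sh.Outs)).map fun r₂ =>
        E.he2ss κ pk (E.mulLeft κ pk (lkup x.S x.X + E.mask κ r₁) x.cV) r₂).bind fun m₂ =>
      ((PMF.uniformOfFintype (E.MaskMat κ sh.Batch sh.Outs)).map fun r₃ =>
        E.he2ss κ pk (E.mulLeft κ pk (E.decMat κ sk m) x.cUother) r₃).map fun m₃ =>
      (E.he2ss κ pk (lkup x.cT x.X) r₁, m₂, m₃) := by
    rw [← PMF.bind_pure_comp, uniform_bind_prod]
    congr 1
    funext r₁
    rw [uniform_bind_prod, PMF.bind_map]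
    congr 1
    funext r₂
    simp only [Function.comp_apply, PMF.map_comp]
    rfl
  rw [e]
  -- The second message is formed from ψ, which contains the mask in `r₁`. With `r₁` fixed, the
  -- second and third messages are replaced by ciphertexts that no longer depend on it; after this
  -- `r₁` occurs in the first message only, which can then be replaced as well.
  have h₁ : ∀ r₁ : E.MaskMat κ sh.Batch (sh.Ins Q), Close _
      (((PMF.uniformOfFintype (E.MaskMat κ sh.Batch sh.Outs)).map fun r₂ =>
        E.he2ss κ pk (E.mulLeft κ pk (lkup x.S x.X + E.mask κ r₁) x.cV) r₂).bind fun m₂ =>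
      ((PMF.uniformOfFintype (E.MaskMat κ sh.Batch sh.Outs)).map fun r₃ =>
        E.he2ss κ pk (E.mulLeft κ pk (E.decMat κ sk m) x.cUother) r₃).map fun m₃ =>
      (E.he2ss κ pk (lkup x.cT x.X) r₁, m₂, m₃))
      ((encPMF pk (PMF.uniformOfFintype (E.R κ))).bind fun m₂ =>
        (encPMF pk (PMF.uniformOfFintype (E.R κ))).map fun m₃ =>
          (E.he2ss κ pk (lkup x.cT x.X) r₁, m₂, m₃)) := fun r₁ =>
    (he2ss_close_encPMF hR (hV.mulLeft (lkup x.S x.X + E.mask κ r₁))).bind fun m₂ _ =>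
      (he2ss_close_encPMF hR (hU.mulLeft (E.decMat κ sk m))).map _
  have h₂ := (he2ss_close_encPMF hR (hT.lkup x.X)).bind_left fun m₁ =>
    (encPMF pk (PMF.uniformOfFintype (E.R κ))).bind
      fun m₂ : Matrix sh.Batch sh.Outs Str =>
      (encPMF pk (PMF.uniformOfFintype (E.R κ))).map fun m₃ : Matrix sh.Batch sh.Outs Str =>
        (m₁, m₂, m₃)
  rw [PMF.bind_map] at h₂
  exact ((Close.bind_right fun r₁ _ => h₁ r₁).trans h₂).mono (le_of_eq (by rw [fwCount]; ring))

/-- Expand (ψ + (E - ψ))(U + V) for each model. The products ψU and (E - ψ)V are computed locally by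
its owner and by the other party respectively; ψV and (E - ψ)U come from the owner's second and the
other party's third HE2SS message. Each mask is added by one party and subtracted in what the other
decrypts. -/
theorem fwZ_add_fwZ (hC : E.Correct) {k : Keys} (hk : k ∈ (E.keys κ).support)
    {a : LayerInput E sh .A κ} {b : LayerInput E sh .B κ} (h : LayerInput.Consistent k a b)
    (rA : FwRand E sh .A κ) (rB : FwRand E sh .B κ) :
    fwZ (k.sk .A) a rA (fwMsg₁ (k.pk .A) b rB) (fwMsg₂ (k.pk .A) b rB)
        (fwMsg₃ (k.pk .A) (k.sk .B) b rB (fwMsg₁ (k.pk .B) a rA)) +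
      fwZ (k.sk .B) b rB (fwMsg₁ (k.pk .B) a rA) (fwMsg₂ (k.pk .B) a rA)
        (fwMsg₃ (k.pk .B) (k.sk .A) a rA (fwMsg₁ (k.pk .A) b rB)) =
    embedA a b * weightA a b + embedB a b * weightB a b := by
  have hA₁ : E.decMat κ (k.sk .B) (fwMsg₁ (k.pk .B) a rA) = lkup b.Tother a.X - E.mask κ rA.1 :=
    hC.decMat hk .B ((h.cTA.lkup a.X).he2ss rA.1)
  have hB₁ : E.decMat κ (k.sk .A) (fwMsg₁ (k.pk .A) b rB) = lkup a.Tother b.X - E.mask κ rB.1 :=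
    hC.decMat hk .A ((h.cTB.lkup b.X).he2ss rB.1)
  have hA₂ : E.decMat κ (k.sk .B) (fwMsg₂ (k.pk .B) a rA) =
      fwPsi a rA * b.Vother - E.mask κ rA.2.1 :=
    hC.decMat hk .B ((h.cVA.mulLeft (fwPsi a rA)).he2ss rA.2.1)
  have hB₂ : E.decMat κ (k.sk .A) (fwMsg₂ (k.pk .A) b rB) =
      fwPsi b rB * a.Vother - E.mask κ rB.2.1 :=
    hC.decMat hk .A ((h.cVB.mulLeft (fwPsi b rB)).he2ss rB.2.1)
  have hA₃ : E.decMat κ (k.sk .B) (fwMsg₃ (k.pk .B) (k.sk .A) a rA (fwMsg₁ (k.pk .A) b rB)) =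
      (lkup a.Tother b.X - E.mask κ rB.1) * b.U - E.mask κ rA.2.2 := by
    rw [← hB₁]
    exact hC.decMat hk .B ((h.cUB.mulLeft _).he2ss rA.2.2)
  have hB₃ : E.decMat κ (k.sk .A) (fwMsg₃ (k.pk .A) (k.sk .B) b rB (fwMsg₁ (k.pk .B) a rA)) =
      (lkup b.Tother a.X - E.mask κ rA.1) * a.U - E.mask κ rB.2.2 := by
    rw [← hA₁]
    exact hC.decMat hk .A ((h.cUA.mulLeft _).he2ss rB.2.2)
  have zA : ∀ m₁ m₂ m₃, fwZ (k.sk .A) a rA m₁ m₂ m₃ =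
      (fwPsi a rA * a.U + E.mask κ rA.2.1 + E.decMat κ (k.sk .A) m₂) +
        ((E.decMat κ (k.sk .A) m₁ : E.Mat κ sh.Batch (sh.Ins .B)) *
          (a.Vother : E.Mat κ (sh.Ins .B) sh.Outs) + E.mask κ rA.2.2 +
            E.decMat κ (k.sk .A) m₃) := fun _ _ _ => rfl
  have zB : ∀ m₁ m₂ m₃, fwZ (k.sk .B) b rB m₁ m₂ m₃ =
      (fwPsi b rB * b.U + E.mask κ rB.2.1 + E.decMat κ (k.sk .B) m₂) +
        ((E.decMat κ (k.sk .B) m₁ : E.Mat κ sh.Batch (sh.Ins .A)) *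
          (b.Vother : E.Mat κ (sh.Ins .A) sh.Outs) + E.mask κ rB.2.2 +
            E.decMat κ (k.sk .B) m₃) := fun _ _ _ => rfl
  simp only [zA, zB, hA₁, hB₁, hA₂, hB₂, hA₃, hB₃]
  simp only [fwPsi, embedA, embedB, weightA, weightB, tableA, tableB, lkup_add, Matrix.add_mul,
    Matrix.mul_add, Matrix.sub_mul]
  abel

variable (E sh)

/-- The simulated view of `A` in the forward protocol. -/
def fwViewA (G : ∀ κ, PMF (E.R κ)) : (embedMatMulFw E sh).ViewSampler .A := fun κ x =>
  (fwRandPMF sh .A (G κ)).bind fun r => (fwMsgPMF sh .B (x.1 0) (G κ)).map fun m =>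
    ((r, m) : FwRand E sh .A κ × FwRecvA sh κ)

/-- The simulated view of `B` in the forward protocol; the share of `A` is the output minus the
share of `B`. -/
def fwViewB (G : ∀ κ, PMF (E.R κ)) : (embedMatMulFw E sh).ViewSampler .B :=
  fun κ (x : Strs (Fin 3) × LayerInput E sh .B κ × E.Mat κ sh.Batch sh.Outs) =>
  (fwRandPMF sh .B (G κ)).bind fun r => (fwMsgPMF sh .A (x.1 1) (G κ)).map fun m =>
    ((r, (m.1, m.2.1, m.2.2, x.2.2 - fwZ (x.1 2) x.2.1 r m.1 m.2.1 m.2.2)) :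
      FwRand E sh .B κ × FwRecvB E sh κ)

variable {E sh}

section EPPT

variable {ι : Type} [Fintype ι] {X : ℕ → Type} [∀ κ, StrEnc ι (X κ)] {G : ∀ κ, PMF (E.R κ)}

theorem eppt_fwRandPMF (Q : Party) (hG : EPPT fun κ (_ : X κ) => G κ) :
    EPPT fun κ (_ : X κ) => fwRandPMF sh Q (G κ) :=
  (eppt_maskPMF hG).prod ((eppt_maskPMF hG).prod (eppt_maskPMF hG)) |> fun h => by
    simpa only [fwRandPMF, PMF.map_bind, PMF.map_comp, Function.comp_def] using h

theorem eppt_fwMsgPMF (hE : E.Efficient) (Q : Party) (hG : EPPT fun κ (_ : X κ) => G κ)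
    {pk : ∀ κ, X κ → Str} (hpk : PolyFn pk) :
    EPPT fun κ (x : X κ) => fwMsgPMF sh Q (pk κ x) (G κ) :=
  (eppt_encPMF hE hG hpk).prod ((eppt_encPMF hE hG hpk).prod (eppt_encPMF hE hG hpk)) |> fun h => by
    simpa only [fwMsgPMF, PMF.map_bind, PMF.map_comp, Function.comp_def] using h

end EPPT

end FwSecurity

/-! ### Simulators for the forward protocol and their errors -/

section FwSecurity

variable {E : HEScheme} {sh : Shape}

theorem PolyFn.fwZ {P : Party} {ι : Type} [Fintype ι] {X : ℕ → Type} [∀ κ, StrEnc ι (X κ)]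
    (hE : E.Efficient) {sk : ∀ κ, X κ → Str} (hsk : PolyFn sk)
    {x : ∀ κ, X κ → LayerInput E sh P κ} (hx : PolyFn x) {r : ∀ κ, X κ → FwRand E sh P κ}
    (hr : PolyFn r) {m₁ : ∀ κ, X κ → Matrix sh.Batch (sh.Ins P.other) Str} (h₁ : PolyFn m₁)
    {m₂ m₃ : ∀ κ, X κ → Matrix sh.Batch sh.Outs Str} (h₂ : PolyFn m₂) (h₃ : PolyFn m₃) :
    PolyFn fun κ s => fwZ (sk κ s) (x κ s) (r κ s) (m₁ κ s) (m₂ κ s) (m₃ κ s) := by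
  have hψ := hE.polyFn_matAdd (hE.polyFn_lkup hx.layer_S hx.layer_X) (PolyFn.mask hr.fst)
  have hl := hE.polyFn_matAdd (hE.polyFn_matAdd (hE.polyFn_matMul hψ hx.layer_U)
    (PolyFn.mask hr.snd.fst)) (hE.polyFn_decMat hsk h₂)
  have hr' := hE.polyFn_matAdd (hE.polyFn_matAdd
    (hE.polyFn_matMul (hE.polyFn_decMat hsk h₁) hx.layer_Vother)
    (PolyFn.mask hr.snd.snd)) (hE.polyFn_decMat hsk h₃)
  exact hE.polyFn_matAdd hl hr'

theorem eppt_fwViewA (hE : E.Efficient) {G : ∀ κ, PMF (E.R κ)}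
    (hG : IsPPT fun κ (_ : Empty → Str) => (G κ).map fun v (_ : Unit) => E.code κ v) :
    EPPT (fwViewA E sh G) := by
  have hG' : EPPT fun κ (_ : Strs (Fin 3) × LayerInput E sh .A κ × Unit) => G κ := EPPT.const hG
  have c : PolyFn fun κ (z : Strs (Fin 3) × LayerInput E sh .A κ × Unit) => z := PolyFn.id
  exact (eppt_fwRandPMF (sh := sh) .A hG').prod (eppt_fwMsgPMF hE .B hG' (c.fst.ofStrs 0))

theorem eppt_fwViewB (hE : E.Efficient) {G : ∀ κ, PMF (E.R κ)}
    (hG : IsPPT fun κ (_ : Empty → Str) => (G κ).map fun v (_ : Unit) => E.code κ v) :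
    EPPT (fwViewB E sh G) := by
  have hG' : EPPT fun κ (_ : Strs (Fin 3) × LayerInput E sh .B κ × E.Mat κ sh.Batch sh.Outs) =>
    G κ := EPPT.const hG
  have c : PolyFn fun κ (z : Strs (Fin 3) × LayerInput E sh .B κ ×
    E.Mat κ sh.Batch sh.Outs) => z := PolyFn.id
  have hp := (eppt_fwRandPMF (sh := sh) .B hG').prod (eppt_fwMsgPMF (sh := sh) hE .A hG' (c.fst.ofStrs 1))
  have d : PolyFn fun κ (z : (Strs (Fin 3) × LayerInput E sh .B κ × E.Mat κ sh.Batch sh.Outs) ×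
    (FwRand E sh .B κ × Matrix sh.Batch (sh.Ins .A) Str × Matrix sh.Batch sh.Outs Str ×
      Matrix sh.Batch sh.Outs Str)) => z := PolyFn.id
  have hz := PolyFn.fwZ hE (d.fst.fst.ofStrs 2) d.fst.snd.fst d.snd.fst d.snd.snd.fst
    d.snd.snd.snd.fst d.snd.snd.snd.snd
  have hf := d.snd.fst.pair (d.snd.snd.fst.pair (d.snd.snd.snd.fst.pair
    (d.snd.snd.snd.snd.pair (hE.polyFn_matSub d.fst.snd.snd hz))))
  have h := hp.map (f := fun κ (x : Strs (Fin 3) × LayerInput E sh .B κ ×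
    E.Mat κ sh.Batch sh.Outs) (w : FwRand E sh .B κ × Matrix sh.Batch (sh.Ins .A) Str ×
      Matrix sh.Batch sh.Outs Str × Matrix sh.Batch sh.Outs Str) =>
        ((w.1, (w.2.1, w.2.2.1, w.2.2.2, x.2.2 - fwZ (x.1 2) x.2.1 w.1 w.2.1 w.2.2.1 w.2.2.2)) :
          FwRand E sh .B κ × FwRecvB E sh κ)) hf
  simp only [PMF.map_bind, PMF.map_comp, Function.comp_def] at h
  exact h

variable {κ : ℕ} {k : Keys} {a : LayerInput E sh .A κ} {b : LayerInput E sh .B κ} {ε δ : ℝ}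
  {G : ∀ κ, PMF (E.R κ)}

/-- Since the output is the constant Z, the masks of `B` occur only in the messages to `A`. The
first summand of the error pays for rerandomization, the other two for sampling the masks of `A` and
the plaintexts of the simulated messages approximately. -/
theorem fwViewA_close (hC : E.Correct) (hk : k ∈ (E.keys κ).support)
    (h : LayerInput.Consistent k a b)
    (hR : ∀ u v c, E.IsCipher κ (k.pk .A) u c →
      statDist ((PMF.uniformOfFintype (E.Coin κ)).map fun r =>
          E.add κ (k.pk .A) c (E.enc κ (k.pk .A) v r))
        ((PMF.uniformOfFintype (E.Coin κ)).map fun r => E.enc κ (k.pk .A) (u + v) r) ≤ ε)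
    (hG : Close δ (PMF.uniformOfFintype (E.R κ)) (G κ)) :
    Close (fwCount sh .B * (2 * ε) + (fwCount sh .A * δ + fwCount sh .B * δ))
      (realView (embedMatMulFw E sh) .A κ k a b) (idealView (fwViewA E sh G) κ k a b) := by
  have e : realView (embedMatMulFw E sh) .A κ k a b =
      (PMF.uniformOfFintype (FwRand E sh .A κ)).bind fun rA =>
      ((PMF.uniformOfFintype (FwRand E sh .B κ)).map fun rB => (fwMsg₁ (k.pk .A) b rB,
        fwMsg₂ (k.pk .A) b rB, fwMsg₃ (k.pk .A) (k.sk .B) b rB (fwMsg₁ (k.pk .B) a rA))).map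
        fun m => ((rA, m), ((), embedA a b * weightA a b + embedB a b * weightB a b)) := by
    unfold realView
    refine congrArg _ (funext fun rA => ?_)
    rw [PMF.map_comp]
    refine congrArg (fun f => PMF.map f _) (funext fun rB => ?_)
    exact congrArg (fun z => (((rA, _) : FwRand E sh .A κ × FwRecvA sh κ), ((), z)))
      (fwZ_add_fwZ hC hk h rA rB)
  have e' : idealView (fwViewA E sh G) κ k a b =
      (fwRandPMF sh .A (G κ)).bind fun rA => (fwMsgPMF sh .B (k.pk .A) (G κ)).map fun m =>
        ((rA, m), ((), embedA a b * weightA a b + embedB a b * weightB a b)) := by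
    refine (PMF.pure_bind _ _).trans ?_
    refine (PMF.map_bind _ _ _).trans ?_
    refine congrArg _ (funext fun rA => ?_)
    exact PMF.map_comp _ _ _
  rw [e, e', ← fwRandPMF_uniform]
  refine Close.trans (Close.bind_right fun rA _ =>
    (fwMsgs_close hR b h.cTB h.cVB h.cUA (k.sk .B) (fwMsg₁ (k.pk .B) a rA)).map _) ?_
  exact (fwRandPMF_close .A hG).bind fun rA _ => (fwMsgPMF_close .B (k.pk .A) hG).map _

theorem fwViewB_close (hC : E.Correct) (hk : k ∈ (E.keys κ).support)
    (h : LayerInput.Consistent k a b)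
    (hR : ∀ u v c, E.IsCipher κ (k.pk .B) u c →
      statDist ((PMF.uniformOfFintype (E.Coin κ)).map fun r =>
          E.add κ (k.pk .B) c (E.enc κ (k.pk .B) v r))
        ((PMF.uniformOfFintype (E.Coin κ)).map fun r => E.enc κ (k.pk .B) (u + v) r) ≤ ε)
    (hG : Close δ (PMF.uniformOfFintype (E.R κ)) (G κ)) :
    Close (fwCount sh .A * (2 * ε) + (fwCount sh .B * δ + fwCount sh .A * δ))
      (realView (embedMatMulFw E sh) .B κ k a b) (idealView (fwViewB E sh G) κ k a b) := by
  let Z := embedA a b * weightA a b + embedB a b * weightB a b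
  let fin : FwRand E sh .B κ → (Matrix sh.Batch (sh.Ins .A) Str × Matrix sh.Batch sh.Outs Str ×
      Matrix sh.Batch sh.Outs Str) → (FwRand E sh .B κ × FwRecvB E sh κ) ×
        (Unit × E.Mat κ sh.Batch sh.Outs) := fun rB m =>
    ((rB, (m.1, m.2.1, m.2.2, Z - fwZ (k.sk .B) b rB m.1 m.2.1 m.2.2)), ((), Z))
  have e : realView (embedMatMulFw E sh) .B κ k a b =
      (PMF.uniformOfFintype (FwRand E sh .B κ)).bind fun rB =>
      ((PMF.uniformOfFintype (FwRand E sh .A κ)).map fun rA => (fwMsg₁ (k.pk .B) a rA,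
        fwMsg₂ (k.pk .B) a rA, fwMsg₃ (k.pk .B) (k.sk .A) a rA (fwMsg₁ (k.pk .A) b rB))).map
        (fin rB) := by
    unfold realView
    refine (PMF.bind_comm _ _ _).trans ?_
    refine congrArg _ (funext fun rB => ?_)
    rw [PMF.map_comp]
    refine congrArg (fun f => PMF.map f _) (funext fun rA => ?_)
    have hz := fwZ_add_fwZ hC hk h rA rB
    -- Correctness determines Z'_A as Z - Z'_B. The remaining message of `A` is thus a function of
    -- the output and of the part of the view of `B` that has already been accounted for.
    refine Prod.ext ?_ (Prod.ext rfl hz)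
    exact congrArg (fun z => ((rB, (_, _, _, z)) : FwRand E sh .B κ × FwRecvB E sh κ))
      (eq_sub_of_add_eq hz)
  have e' : idealView (fwViewB E sh G) κ k a b =
      (fwRandPMF sh .B (G κ)).bind fun rB => (fwMsgPMF sh .A (k.pk .B) (G κ)).map (fin rB) := by
    refine (PMF.pure_bind _ _).trans ?_
    refine (PMF.map_bind _ _ _).trans ?_
    refine congrArg _ (funext fun rB => ?_)
    exact PMF.map_comp _ _ _
  rw [e, e', ← fwRandPMF_uniform]
  refine Close.trans (Close.bind_right fun rB _ =>
    (fwMsgs_close hR a h.cTA h.cVA h.cUB (k.sk .A) (fwMsg₁ (k.pk .A) b rB)).map _) ?_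
  exact (fwRandPMF_close .B hG).bind fun rB _ => (fwMsgPMF_close .A (k.pk .B) hG).map _

theorem securelyRealizes_fw (hE : E.Efficient) (hC : E.Correct) (hR : E.Rerandomizing) :
    SecurelyRealizes E (embedMatMulFw E sh) := by
  obtain ⟨G, δ, hδ, hGδ, hG⟩ := hE.exists_sampler
  obtain ⟨ε, hε, hR⟩ := hR
  intro P α _ adv hadv
  cases P with
  | A =>
    obtain ⟨sim, hsim, hs⟩ := exists_simulator (E := E) hadv (eppt_fwViewA hE hG)
    refine ⟨sim, hsim, fun σ _ choose dist hc _ => ?_⟩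
    refine Negligible.of_le (((hε.const_mul 2).const_mul (fwCount sh .B)).add
      ((hδ.const_mul (fwCount sh .A)).add (hδ.const_mul (fwCount sh .B))))
      (fun _ => abs_nonneg _) fun κ => ?_
    rw [hs, real_eq_interaction]
    exact interaction_close (ε := fun κ => fwCount sh .B * (2 * ε κ) +
      (fwCount sh .A * δ κ + fwCount sh .B * δ κ)) (fun κ k hk a b hab =>
        fwViewA_close hC hk hab (hR κ _ (HEScheme.mem_support_keygen_of_keys hk .A)) (hGδ κ))
        adv hc dist κ
  | B =>
    obtain ⟨sim, hsim, hs⟩ := exists_simulator (E := E) hadv (eppt_fwViewB hE hG)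
    refine ⟨sim, hsim, fun σ _ choose dist hc _ => ?_⟩
    refine Negligible.of_le (((hε.const_mul 2).const_mul (fwCount sh .A)).add
      ((hδ.const_mul (fwCount sh .B)).add (hδ.const_mul (fwCount sh .A))))
      (fun _ => abs_nonneg _) fun κ => ?_
    rw [hs, real_eq_interaction]
    exact interaction_close (ε := fun κ => fwCount sh .A * (2 * ε κ) +
      (fwCount sh .B * δ κ + fwCount sh .A * δ κ)) (fun κ k hk a b hab =>
        fwViewB_close hC hk hab (hR κ _ (HEScheme.mem_support_keygen_of_keys hk .B)) (hGδ κ))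
        adv hc dist κ

end FwSecurity

/-! ## Replacing ciphertexts under the key of the honest party -/

/-- The position of the public key of the other party among the known keys. -/
def otherIdx : Party → Fin 3
  | .A => 1
  | .B => 0

/-- The keys known to `P`, from the public key of the other party and the key pair of `P`. -/
def knownOf : Party → Str → Str × Str → Fin 3 → Str
  | .A, pk, k => ![k.1, pk, k.2]
  | .B, pk, k => ![pk, k.1, k.2]

theorem knownOf_otherIdx (P : Party) (pk : Str) (k : Str × Str) :
    knownOf P pk k (otherIdx P) = pk := by
  cases P <;> rfl

/-- A quantity that depends only on the known keys does not involve the honest secret key. The key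
pairs are independent, so the honest one may be drawn first, as in the chosen-plaintext game where
it belongs to the challenger. -/
theorem keys_bind_known {E : HEScheme} {κ : ℕ} {β : Type} (P : Party)
    (f : (Fin 3 → Str) → PMF β) :
    ((E.keys κ).bind fun k => f (k.known P)) =
      (E.keygen κ).bind fun o => (E.keygen κ).bind fun k => f (knownOf P o.1 k) := by
  rw [HEScheme.keys, PMF.bind_bind]
  cases P with
  | A =>
    rw [PMF.bind_comm]
    congr 1
    funext a
    rw [PMF.bind_map]
    rfl
  | B =>
    congr 1
    funext a
    rw [PMF.bind_map]
    rfl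

section Hybrid

variable {E : HEScheme} {F : Functionality} {pr : Protocol F} {P : Party} {ι : Type} [Fintype ι]
  [DecidableEq ι] {N : ℕ → Type}

/-- A view that contains encryptions of the plaintexts `msg` under the key of the other party. -/
def hybridView (E : HEScheme) (ν : ∀ κ, PMF (N κ))
    (res : ∀ κ, (Fin 3 → Str) → (F.Inp .A).T κ → (F.Inp .B).T κ → N κ → (ι → Str) →
      pr.Result P κ)
    (msg : ∀ κ, (F.Inp .A).T κ → (F.Inp .B).T κ → N κ → ι → E.R κ)
    (κ : ℕ) (k : Keys) (a : (F.Inp .A).T κ) (b : (F.Inp .B).T κ) : PMF (pr.Result P κ) :=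
  (ν κ).bind fun n => (PMF.uniformOfFintype (ι → E.Coin κ)).map fun r =>
    res κ (k.known P) a b n fun i => E.enc κ (k.known P (otherIdx P)) (msg κ a b n i) (r i)

theorem hybridView_close {ν ν' : ∀ κ, PMF (N κ)} {κ : ℕ} {ε : ℝ} (h : Close ε (ν κ) (ν' κ))
    (res : ∀ κ, (Fin 3 → Str) → (F.Inp .A).T κ → (F.Inp .B).T κ → N κ → (ι → Str) →
      pr.Result P κ)
    (msg : ∀ κ, (F.Inp .A).T κ → (F.Inp .B).T κ → N κ → ι → E.R κ) (k : Keys)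
    (a : (F.Inp .A).T κ) (b : (F.Inp .B).T κ) :
    Close ε (hybridView E ν res msg κ k a b) (hybridView E ν' res msg κ k a b) :=
  h.bind_left _

/-- The environment becomes a uniform sampler whose extra argument carries no data but is encoded by
the advice string. Non-uniformity is thus handled by the closure rules for `EPPT`; the reindexing
merely rebrackets the inputs and the state. -/
theorem eppt_chooser {σ : Type} [Fintype σ] {choose : Chooser F σ}
    (hc : AdmissibleChooser E F P choose) :
    ∃ (advice : ℕ → Str) (p : Polynomial ℕ), (∀ κ, (advice κ).length ≤ p.eval κ) ∧
      EPPT (Y := fun κ => ((F.Inp .A).T κ × (F.Inp .B).T κ) × Strs σ)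
        fun κ (x : Advised advice κ × Strs (Fin 3)) => choose κ x.2 := by
  obtain ⟨advice, p, G, hadv, hG, h⟩ := hc.ppt
  refine ⟨advice, p, hadv, _, hG.map_reindex (Equiv.sumAssoc _ _ _), fun κ x => ?_⟩
  have e : (StrEnc.toStrs x : Unit ⊕ Fin 3 → Str) = Sum.elim (fun _ => advice κ) x.2 := by
    funext j; rcases j with j | j <;> rfl
  rw [e]
  refine Eq.trans ?_ (congrArg (PMF.map _) (h κ x.2))
  refine Eq.trans ?_ (PMF.map_comp _ _ _).symm
  refine congrArg (fun f => PMF.map f _) (funext fun y => funext fun j => ?_)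
  rcases j with (j | j) | j <;> rfl

variable {ο : Type} [Fintype ο] [∀ κ, StrEnc ο (N κ)]

theorem eppt_finalTest {ι' : Type} [Fintype ι'] {X : ℕ → Type} [∀ κ, StrEnc ι' (X κ)]
    {σ α : Type} [Fintype σ] [Fintype α]
    {adv : ℕ → (pr.ViewIdx P → Str) → PMF (α → Str)} (hadv : IsPPT adv)
    {dist : ℕ → (FinalIdx F σ α → Str) → PMF (Unit → Str)} (hdist : IsPPT dist)
    {known : ∀ κ, X κ → Strs (Fin 3)} (hk : PolyFn known)
    {input : ∀ κ, X κ → (F.Inp P).T κ} (hi : PolyFn input) {st : ∀ κ, X κ → Strs σ}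
    (hst : PolyFn st) {w : ∀ κ, X κ → pr.Result P κ} (hw : PolyFn w) :
    EPPT (Y := fun _ => Strs Unit) fun κ x =>
      finalTest adv dist κ (known κ x) (input κ x) (st κ x) (w κ x) := by
  let u : ∀ κ, X κ → Strs (pr.ViewIdx P) := fun κ x =>
    Sum.elim (known κ x) (Sum.elim ((F.Inp P).toStrs κ (input κ x))
      (Sum.elim ((pr.Rand P).toStrs κ (w κ x).1.1) ((pr.Recv P).toStrs κ (w κ x).1.2)))
  have hu : PolyFn u := fun j => by
    rcases j with j | j | j | j
    · exact hk j
    · exact hi j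
    · exact hw.fst.fst j
    · exact hw.fst.snd j
  let H : ∀ κ, X κ → Strs α → PMF (Strs Unit) := fun κ x a => dist κ (Sum.elim (st κ x)
    (Sum.elim a (Sum.elim ((F.Out .A).toStrs κ (w κ x).2.1) ((F.Out .B).toStrs κ (w κ x).2.2))))
  have hH : EPPT fun κ (z : X κ × Strs α) => H κ z.1 z.2 := by
    have c : PolyFn fun κ (z : X κ × Strs α) => z := PolyFn.id
    have hst' := hst.comp c.fst
    have hw' := hw.comp c.fst
    let v : ∀ κ, X κ × Strs α → Strs (FinalIdx F σ α) := fun κ z => Sum.elim (st κ z.1)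
      (Sum.elim z.2 (Sum.elim ((F.Out .A).toStrs κ (w κ z.1).2.1)
        ((F.Out .B).toStrs κ (w κ z.1).2.2)))
    have hv : PolyFn v := fun j => by
      rcases j with j | j | j | j
      · exact hst' j
      · exact c.snd j
      · exact hw'.snd.fst j
      · exact hw'.snd.snd j
    exact (EPPT.of_isPPT hdist).comap hv
  exact ((EPPT.of_isPPT hadv).comap hu).bind hH

/-- Reduction to `encGame_zero`: the interaction is itself an encryption game whose challenge key is
that of the honest party. The corrupted key pair, the inputs and the masks form the state, and
running the adversary and the environment is the final test. -/
theorem interaction_hybrid_zero (hE : E.Efficient) (hCPA : E.INDCPA) {ν : ∀ κ, PMF (N κ)}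
    (hν : IsPPT fun κ (_ : Empty → Str) => (ν κ).map StrEnc.toStrs)
    {res : ∀ κ, (Fin 3 → Str) → (F.Inp .A).T κ → (F.Inp .B).T κ → N κ → (ι → Str) →
      pr.Result P κ}
    (hres : PolyFn fun κ (z : Strs (Fin 3) × ((F.Inp .A).T κ × (F.Inp .B).T κ) × N κ ×
      (ι → Str)) => res κ z.1 z.2.1.1 z.2.1.2 z.2.2.1 z.2.2.2)
    {msg : ∀ κ, (F.Inp .A).T κ → (F.Inp .B).T κ → N κ → ι → E.R κ}
    (hmsg : PolyFn fun κ (z : ((F.Inp .A).T κ × (F.Inp .B).T κ) × N κ) =>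
      msg κ z.1.1 z.1.2 z.2)
    {α : Type} [Fintype α] {adv : ℕ → (pr.ViewIdx P → Str) → PMF (α → Str)} (hadv : IsPPT adv)
    {σ : Type} [Fintype σ] {choose : Chooser F σ} (hc : AdmissibleChooser E F P choose)
    {dist : ℕ → (FinalIdx F σ α → Str) → PMF (Unit → Str)} (hdist : IsPPT dist) :
    Negligible fun κ => |accept (interaction E (hybridView E ν res msg) adv choose dist κ) -
      accept (interaction E (hybridView E ν res fun _ _ _ _ _ => 0) adv choose dist κ)| := by
  obtain ⟨advice, p, hp, hch⟩ := eppt_chooser hc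
  -- The state of the game: known keys, both inputs with the state of the environment, and the
  -- remaining randomness of the view. The advice is needed only to sample it, so the final test is
  -- uniform, as the IND-CPA game demands of its guesser.
  let S : ℕ → Type := fun κ =>
    (Strs (Fin 3) × ((F.Inp .A).T κ × (F.Inp .B).T κ) × Strs σ) × N κ
  let D : ∀ κ, Str → PMF (S κ) := fun κ pk => (E.keygen κ).bind fun k =>
    (choose κ (knownOf P pk k)).bind fun x => (ν κ).map fun n => ((knownOf P pk k, x), n)
  have hD : EPPT fun κ (x : Advised advice κ × Str) => D κ x.2 := by
    let H₂ : ∀ κ, (Advised advice κ × Str) × Str × Str →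
        ((F.Inp .A).T κ × (F.Inp .B).T κ) × Strs σ → PMF (S κ) := fun κ z x =>
      (ν κ).map fun n => ((knownOf P z.1.2 z.2, x), n)
    let H₁ : ∀ κ, Advised advice κ × Str → Str × Str → PMF (S κ) := fun κ x k =>
      (choose κ (knownOf P x.2 k)).bind fun y => H₂ κ (x, k) y
    let kn : ∀ κ, (Advised advice κ × Str) × Str × Str → Strs (Fin 3) :=
      fun κ z => knownOf P z.1.2 z.2
    have hkn : PolyFn kn := by
      have c : PolyFn fun κ (z : (Advised advice κ × Str) × Str × Str) => z := PolyFn.id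
      refine PolyFn.toStrs fun i => ?_
      cases P <;> fin_cases i
      · exact c.snd.fst
      · exact c.fst.snd
      · exact c.snd.snd
      · exact c.fst.snd
      · exact c.snd.fst
      · exact c.snd.snd
    have h₂ : EPPT fun κ (z : ((Advised advice κ × Str) × Str × Str) ×
        (((F.Inp .A).T κ × (F.Inp .B).T κ) × Strs σ)) => H₂ κ z.1 z.2 := by
      have c : PolyFn fun κ (z : (((Advised advice κ × Str) × Str × Str) ×
        (((F.Inp .A).T κ × (F.Inp .B).T κ) × Strs σ)) × N κ) => z := PolyFn.id
      have hf := ((hkn.comp c.fst.fst).pair c.fst.snd).pair c.snd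
      have hν' : EPPT fun κ (_ : ((Advised advice κ × Str) × Str × Str) ×
        (((F.Inp .A).T κ × (F.Inp .B).T κ) × Strs σ)) => ν κ := EPPT.const hν
      exact hν'.map hf
    have h₁ : EPPT fun κ (z : (Advised advice κ × Str) × Str × Str) => H₁ κ z.1 z.2 := by
      have c : PolyFn fun κ (z : (Advised advice κ × Str) × Str × Str) => z := PolyFn.id
      have hc' := hch.comap (c.fst.fst.pair hkn)
      exact hc'.bind h₂
    exact EPPT.bind hE.eppt_keygen h₁
  let fin : ∀ κ, S κ → (ι → Str) → PMF (Unit → Str) := fun κ s ch =>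
    finalTest adv dist κ s.1.1 (pick (α := fun P => (F.Inp P).T κ) s.1.2.1 P) s.1.2.2
      (res κ s.1.1 s.1.2.1.1 s.1.2.1.2 s.2 ch)
  have c : PolyFn fun κ (z : S κ × (ι → Str)) => z := PolyFn.id
  have hfin : EPPT (Y := fun _ => Strs Unit) fun κ (x : S κ × (ι → Str)) => fin κ x.1 x.2 := by
    refine eppt_finalTest hadv hdist c.fst.fst.fst ?_ c.fst.fst.snd.snd
      (hres.comp (c.fst.fst.fst.pair (c.fst.fst.snd.fst.pair (c.fst.snd.pair c.snd))))
    cases P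
    · exact c.fst.fst.snd.fst.fst
    · exact c.fst.fst.snd.fst.snd
  have d : PolyFn fun κ (z : S κ) => z := PolyFn.id
  have hmsg' := hmsg.comp (d.fst.snd.fst.pair d.snd)
  have key := encGame_zero hE hCPA hp hD hfin hmsg'
  have hgame : ∀ (msg : ∀ κ, (F.Inp .A).T κ → (F.Inp .B).T κ → N κ → ι → E.R κ) κ,
      interaction E (hybridView E ν res msg) adv choose dist κ =
        encGame E D fin (fun κ s => msg κ s.1.2.1.1 s.1.2.1.2 s.2) κ := by
    intro msg κ
    unfold interaction encGame hybridView
    rw [keys_bind_known P fun kn => (choose κ kn).bind fun x => ((ν κ).bind fun n =>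
      (PMF.uniformOfFintype (ι → E.Coin κ)).map fun r => res κ kn x.1.1 x.1.2 n fun i =>
        E.enc κ (kn (otherIdx P)) (msg κ x.1.1 x.1.2 n i) (r i)).bind
        (finalTest adv dist κ kn (pick (α := fun P => (F.Inp P).T κ) x.1 P) x.2)]
    congr 1
    funext o
    refine Eq.trans ?_ (PMF.bind_bind _ _ _).symm
    congr 1
    funext k
    refine Eq.trans ?_ (PMF.bind_bind _ _ _).symm
    congr 1
    funext x
    refine Eq.trans ?_ (PMF.bind_map _ _ _).symm
    rw [PMF.bind_bind]
    congr 1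
    funext n
    rw [PMF.bind_map, knownOf_otherIdx]
    rfl
  simpa only [hgame] using key

end Hybrid

/-! ## Security of the backward protocol -/

section BwFields

variable {E : HEScheme} {sh : Shape} {ι : Type} [Fintype ι] {X : ℕ → Type}
  [∀ κ, StrEnc ι (X κ)]

theorem PolyFn.layer_Tother {P : Party} {f : ∀ κ, X κ → LayerInput E sh P κ} (hf : PolyFn f) :
    PolyFn fun κ x => (f κ x).Tother := fun j => hf (.inr (.inr (.inr (.inl j))))

theorem PolyFn.bwA_layer {f : ∀ κ, X κ → BwInputA E sh κ} (hf : PolyFn f) :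
    PolyFn fun κ x => (f κ x).layer := fun j => hf (.inl j)

theorem PolyFn.bwB_layer {f : ∀ κ, X κ → BwInputB E sh κ} (hf : PolyFn f) :
    PolyFn fun κ x => (f κ x).layer := fun j => hf (.inl j)

theorem PolyFn.bwB_psi {f : ∀ κ, X κ → BwInputB E sh κ} (hf : PolyFn f) :
    PolyFn fun κ x => (f κ x).psi := fun j => hf (.inr (.inl j))

theorem PolyFn.bwB_share {f : ∀ κ, X κ → BwInputB E sh κ} (hf : PolyFn f) :
    PolyFn fun κ x => (f κ x).share := fun j => hf (.inr (.inr (.inl j)))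

theorem PolyFn.bwB_gradZ {f : ∀ κ, X κ → BwInputB E sh κ} (hf : PolyFn f) :
    PolyFn fun κ x => (f κ x).gradZ := fun j => hf (.inr (.inr (.inr j)))

section Gradients

variable (hE : E.Efficient) {a : ∀ κ, X κ → LayerInput E sh .A κ} (ha : PolyFn a)
  {b : ∀ κ, X κ → LayerInput E sh .B κ} (hb : PolyFn b)
  {Z : ∀ κ, X κ → E.Mat κ sh.Batch sh.Outs} (hZ : PolyFn Z)
include hE ha hb hZ

theorem PolyFn.gradWA : PolyFn fun κ x => gradWA (a κ x) (b κ x) (Z κ x) :=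
  hE.polyFn_matMul (hE.polyFn_lkup (hE.polyFn_matAdd ha.layer_S hb.layer_Tother)
    ha.layer_X).transpose hZ

theorem PolyFn.gradWB : PolyFn fun κ x => gradWB (a κ x) (b κ x) (Z κ x) :=
  hE.polyFn_matMul (hE.polyFn_lkup (hE.polyFn_matAdd hb.layer_S ha.layer_Tother)
    hb.layer_X).transpose hZ

theorem PolyFn.gradQA : PolyFn fun κ x => gradQA (a κ x) (b κ x) (Z κ x) :=
  hE.polyFn_lkupBw (hE.polyFn_matMul hZ
    (hE.polyFn_matAdd ha.layer_U hb.layer_Vother).transpose) ha.layer_X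

theorem PolyFn.gradQB : PolyFn fun κ x => gradQB (a κ x) (b κ x) (Z κ x) :=
  hE.polyFn_lkupBw (hE.polyFn_matMul hZ
    (hE.polyFn_matAdd hb.layer_U ha.layer_Vother).transpose) hb.layer_X

end Gradients

end BwFields

/-! ### Sampling without input and from products -/

section General

variable {ι ο ο' : Type} [Fintype ι] [Fintype ο] [Fintype ο'] {X Y Z : ℕ → Type}
  [∀ κ, StrEnc ι (X κ)] [∀ κ, StrEnc ο (Y κ)] [∀ κ, StrEnc ο' (Z κ)]

theorem EPPT.isPPT_of_unit {F : ∀ κ, PMF (Y κ)} (hF : EPPT fun κ (_ : Unit) => F κ) :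
    IsPPT fun κ (_ : Empty → Str) => (F κ).map StrEnc.toStrs := by
  obtain ⟨G, hG, h⟩ := hF
  convert hG using 3 with κ x
  rw [h κ ()]
  congr 1
  exact Subsingleton.elim _ _

theorem EPPT.uniform_prod [∀ κ, Fintype (Y κ)] [∀ κ, Nonempty (Y κ)] [∀ κ, Fintype (Z κ)]
    [∀ κ, Nonempty (Z κ)] (hY : EPPT fun κ (_ : X κ) => PMF.uniformOfFintype (Y κ))
    (hZ : EPPT fun κ (_ : X κ) => PMF.uniformOfFintype (Z κ)) :
    EPPT fun κ (_ : X κ) => PMF.uniformOfFintype (Y κ × Z κ) := by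
  have e : ∀ κ, PMF.uniformOfFintype (Y κ × Z κ) = (PMF.uniformOfFintype (Y κ)).bind fun y =>
      (PMF.uniformOfFintype (Z κ)).map fun z => (y, z) := fun κ =>
    (PMF.bind_pure _).symm.trans (uniform_bind_prod PMF.pure)
  simpa only [e] using hY.prod hZ

end General

/-! ### Random pieces of the backward protocol, and the simulated view of `A` -/

section BwSecurity

variable (E : HEScheme) (sh : Shape) (κ : ℕ)

/-- The random pieces `φ, ξ, ρ_A, ρ_B`. -/
abbrev BwMasks : Type :=
  E.Mat κ (sh.Ins .A) sh.Outs × E.Mat κ (sh.Ins .B) sh.Outs ×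
    E.Mat κ (sh.Voc .A) (sh.Dim .A) × E.Mat κ (sh.Voc .B) (sh.Dim .B)

variable {E κ}

/-- Random pieces with independent entries. -/
def bwMasksPMF (G : PMF (E.R κ)) : PMF (BwMasks E sh κ) :=
  (matPMF G).bind fun φ => (matPMF G).bind fun ξ => (matPMF G).bind fun ρ => (matPMF G).map fun τ =>
    (φ, ξ, ρ, τ)

/-- The number of entries of the random pieces. -/
def bwCount : ℝ :=
  Fintype.card (sh.Ins .A) * Fintype.card sh.Outs +
    (Fintype.card (sh.Ins .B) * Fintype.card sh.Outs +
      (Fintype.card (sh.Voc .A) * Fintype.card (sh.Dim .A) +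
        Fintype.card (sh.Voc .B) * Fintype.card (sh.Dim .B)))

variable {sh}

theorem bwMasksPMF_uniform :
    bwMasksPMF sh (PMF.uniformOfFintype (E.R κ)) = PMF.uniformOfFintype (BwMasks E sh κ) := by
  simp only [bwMasksPMF, matPMF_uniform]
  refine Eq.symm ((PMF.bind_pure _).symm.trans ?_)
  rw [uniform_bind_prod]
  refine congrArg _ (funext fun φ => ?_)
  rw [uniform_bind_prod]
  refine congrArg _ (funext fun ξ => ?_)
  rw [uniform_bind_prod]
  rfl

theorem bwMasksPMF_close {G G' : PMF (E.R κ)} {ε : ℝ} (h : Close ε G G') :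
    Close (bwCount sh * ε) (bwMasksPMF sh G) (bwMasksPMF sh G') := by
  refine ((matPMF_close h).bind fun φ _ => (matPMF_close h).bind fun ξ _ =>
    (matPMF_close h).bind fun ρ _ => (matPMF_close h).map _).mono (le_of_eq ?_)
  rw [bwCount]; ring

theorem eppt_bwMasksPMF {ι : Type} [Fintype ι] {X : ℕ → Type} [∀ κ, StrEnc ι (X κ)]
    {G : ∀ κ, PMF (E.R κ)} (hG : EPPT fun κ (_ : X κ) => G κ) :
    EPPT fun κ (_ : X κ) => bwMasksPMF sh (G κ) :=
  (eppt_matPMF hG).prod ((eppt_matPMF hG).prod ((eppt_matPMF hG).prod (eppt_matPMF hG))) |>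
    fun h => by
      simpa only [bwMasksPMF, PMF.map_bind, PMF.map_comp, Function.comp_def] using h

/-- The outputs of the backward functionality for given random pieces. -/
def bwOut (a : BwInputA E sh κ) (b : BwInputB E sh κ) (s : BwMasks E sh κ) :
    BwOutputA E sh κ × BwOutputB E sh κ :=
  ({ phi := s.1
     xi := s.2.1
     rho := s.2.2.1
     gradQB := gradQB a.layer b.layer b.gradZ - s.2.2.2 },
   { gradWA := gradWA a.layer b.layer b.gradZ - s.1
     gradWB := gradWB a.layer b.layer b.gradZ - s.2.1
     gradQA := gradQA a.layer b.layer b.gradZ - s.2.2.1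
     rho := s.2.2.2 })

theorem PolyFn.bwOut (hE : E.Efficient) {ι : Type} [Fintype ι] {X : ℕ → Type}
    [∀ κ, StrEnc ι (X κ)] {a : ∀ κ, X κ → BwInputA E sh κ} (ha : PolyFn a)
    {b : ∀ κ, X κ → BwInputB E sh κ} (hb : PolyFn b) {s : ∀ κ, X κ → BwMasks E sh κ}
    (hs : PolyFn s) : PolyFn fun κ x => bwOut (a κ x) (b κ x) (s κ x) := by
  have hWA := hE.polyFn_matSub (PolyFn.gradWA hE ha.bwA_layer hb.bwB_layer hb.bwB_gradZ) hs.fst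
  have hWB := hE.polyFn_matSub (PolyFn.gradWB hE ha.bwA_layer hb.bwB_layer hb.bwB_gradZ) hs.snd.fst
  have hQA := hE.polyFn_matSub (PolyFn.gradQA hE ha.bwA_layer hb.bwB_layer hb.bwB_gradZ)
    hs.snd.snd.fst
  have hQB := hE.polyFn_matSub (PolyFn.gradQB hE ha.bwA_layer hb.bwB_layer hb.bwB_gradZ)
    hs.snd.snd.snd
  exact (hs.fst.pair (hs.snd.fst.pair (hs.snd.snd.fst.pair hQB))).pair
    (hWA.pair (hWB.pair (hQA.pair hs.snd.snd.snd)))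

variable (E sh κ)

/-- Coins in the view of `A`, apart from those of the encryptions under the key of `B`: for the
masks, for its own encryptions, and for the message with `∇Q_B - ρ_B`. -/
abbrev BwCoinsA : Type :=
  E.CoinMat κ (sh.Ins .A) sh.Outs × E.CoinMat κ (sh.Ins .B) sh.Outs ×
    E.CoinMat κ (sh.Voc .A) (sh.Dim .A) × E.CoinMat κ (sh.Ins .A) sh.Outs ×
      E.CoinMat κ (sh.Ins .B) sh.Outs × E.CoinMat κ (sh.Voc .B) (sh.Dim .B) ×
        E.CoinMat κ (sh.Voc .B) (sh.Dim .B)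

/-- Index set of the ciphertexts under the key of `B` that `A` receives. -/
abbrev BwIdxA : Type :=
  sh.Batch × sh.Outs ⊕ sh.Batch × sh.Ins .A ⊕ sh.Ins .A × sh.Outs ⊕ sh.Ins .B × sh.Outs ⊕
    sh.Voc .A × sh.Dim .A

variable {E sh κ}

/-- The randomness of `A` with given masks. -/
def bwRandOfA (φ : E.Mat κ (sh.Ins .A) sh.Outs) (ξ : E.Mat κ (sh.Ins .B) sh.Outs)
    (ρ : E.Mat κ (sh.Voc .A) (sh.Dim .A)) (c : BwCoinsA E sh κ) : BwRandA E sh κ where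
  phi := maskMat φ c.1
  xi := maskMat ξ c.2.1
  rho := maskMat ρ c.2.2.1
  coinPhi := c.2.2.2.1
  coinXi := c.2.2.2.2.1
  coinQB := c.2.2.2.2.2.1

/-- The messages for `A`, from the ciphertexts under the key of `B` and the message with
`∇Q_B - ρ_B`. -/
def bwRecvOfA (C : BwIdxA sh → Str) (m : Matrix (sh.Voc .B) (sh.Dim .B) Str) : BwRecvA sh where
  cZ i j := C (.inl (i, j))
  cZV i j := C (.inr (.inl (i, j)))
  cWA i j := C (.inr (.inr (.inl (i, j))))
  cWB i j := C (.inr (.inr (.inr (.inl (i, j)))))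
  mQB := m
  cQA i j := C (.inr (.inr (.inr (.inr (i, j)))))

/-- The plaintexts of the ciphertexts under the key of `B` that `A` receives. -/
def bwPlainA (a : BwInputA E sh κ) (b : BwInputB E sh κ) (s : BwMasks E sh κ) :
    BwIdxA sh → E.R κ :=
  Sum.elim (fun p => b.gradZ p.1 p.2) <|
  Sum.elim (fun p => (b.gradZ * b.layer.Votherᵀ : E.Mat κ sh.Batch (sh.Ins .A)) p.1 p.2) <|
  Sum.elim (fun p => (gradWA a.layer b.layer b.gradZ - s.1) p.1 p.2) <|
  Sum.elim (fun p => (gradWB a.layer b.layer b.gradZ - s.2.1) p.1 p.2)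
    fun p => (gradQA a.layer b.layer b.gradZ - s.2.2.1) p.1 p.2

/-- The result of an execution as seen by `A`. -/
def bwResA (κ : ℕ) (known : Fin 3 → Str) (a : BwInputA E sh κ) (b : BwInputB E sh κ)
    (n : BwMasks E sh κ × BwCoinsA E sh κ) (C : BwIdxA sh → Str) :
    (embedMatMulBw E sh).Result .A κ :=
  ((bwRandOfA n.1.1 n.1.2.1 n.1.2.2.1 n.2, bwRecvOfA C (E.encMat κ (known 0)
    (gradQB a.layer b.layer b.gradZ - n.1.2.2.2) n.2.2.2.2.2.2.2)), bwOut a b n.1)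

variable (E sh)

/-- The simulated view of `A` in the backward protocol. -/
def bwViewA : (embedMatMulBw E sh).ViewSampler .A :=
  fun κ (x : Strs (Fin 3) × BwInputA E sh κ × BwOutputA E sh κ) =>
  (PMF.uniformOfFintype (BwCoinsA E sh κ)).bind fun c =>
  (PMF.uniformOfFintype (BwIdxA sh → E.Coin κ)).map fun r =>
    ((bwRandOfA x.2.2.phi x.2.2.xi x.2.2.rho c,
      bwRecvOfA (fun i => E.enc κ (x.1 1) 0 (r i)) (E.encMat κ (x.1 0) x.2.2.gradQB
        c.2.2.2.2.2.2)) : BwRandA E sh κ × BwRecvA sh)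

variable {E sh}

/-- Random pieces together with uniform coins. -/
def withCoins {M : Type} (C : Type) [Fintype C] [Nonempty C] (μ : PMF M) : PMF (M × C) :=
  μ.bind fun s => (PMF.uniformOfFintype C).map fun c => (s, c)

/-- An exact identity: the functionality draws uniform pieces, and the simulator finds φ, ξ, ρ_A and
∇Q_B - ρ_B in the output of `A`. Only coins are left to sample, so the simulated view is consistent
with the outputs of both parties. -/
theorem idealView_bwViewA (k : Keys) (a : BwInputA E sh κ) (b : BwInputB E sh κ) :
    idealView (bwViewA E sh) κ k a b = hybridView E
      (fun κ => withCoins (BwCoinsA E sh κ) (PMF.uniformOfFintype (BwMasks E sh κ)))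
      bwResA (fun _ _ _ _ _ => 0) κ k a b := by
  unfold idealView hybridView withCoins
  refine (PMF.bind_map _ _ _).trans ?_
  refine Eq.trans ?_ (PMF.bind_bind _ _ _).symm
  refine congrArg _ (funext fun s => ?_)
  refine (PMF.map_bind _ _ _).trans ?_
  refine Eq.trans ?_ (PMF.bind_map _ _ _).symm
  refine congrArg _ (funext fun c => ?_)
  exact PMF.map_comp _ _ _

section EPPT

variable {ι : Type} [Fintype ι] {X : ℕ → Type} [∀ κ, StrEnc ι (X κ)]

theorem PolyFn.bwRandOfA {φ : ∀ κ, X κ → E.Mat κ (sh.Ins .A) sh.Outs} (hφ : PolyFn φ)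
    {ξ : ∀ κ, X κ → E.Mat κ (sh.Ins .B) sh.Outs} (hξ : PolyFn ξ)
    {ρ : ∀ κ, X κ → E.Mat κ (sh.Voc .A) (sh.Dim .A)} (hρ : PolyFn ρ)
    {c : ∀ κ, X κ → BwCoinsA E sh κ} (hc : PolyFn c) :
    PolyFn fun κ x => bwRandOfA (φ κ x) (ξ κ x) (ρ κ x) (c κ x) :=
  (hφ.maskMat hc.fst).pair ((hξ.maskMat hc.snd.fst).pair ((hρ.maskMat hc.snd.snd.fst).pair
    (hc.snd.snd.snd.fst.pair (hc.snd.snd.snd.snd.fst.pair hc.snd.snd.snd.snd.snd.fst))))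

theorem PolyFn.bwRecvOfA {C : ∀ κ, X κ → BwIdxA sh → Str} (hC : ∀ i, PolyFn fun κ x => C κ x i)
    {m : ∀ κ, X κ → Matrix (sh.Voc .B) (sh.Dim .B) Str} (hm : PolyFn m) :
    PolyFn fun κ x => bwRecvOfA (C κ x) (m κ x) := by
  intro j
  rcases j with j | j | j | j | j | j
  · exact hC _ ()
  · exact hC _ ()
  · exact hC _ ()
  · exact hC _ ()
  · exact hm j
  · exact hC _ ()

theorem eppt_bwCoinsA : EPPT fun κ (_ : X κ) => PMF.uniformOfFintype (BwCoinsA E sh κ) :=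
  .uniform_prod eppt_coinMat (.uniform_prod eppt_coinMat (.uniform_prod eppt_coinMat
    (.uniform_prod eppt_coinMat (.uniform_prod eppt_coinMat
      (.uniform_prod eppt_coinMat eppt_coinMat)))))

theorem eppt_bwSimA (hE : E.Efficient) {known : ∀ κ, X κ → Strs (Fin 3)} (hk : PolyFn known)
    {o : ∀ κ, X κ → BwOutputA E sh κ} (ho : PolyFn o) :
    EPPT fun κ x => (PMF.uniformOfFintype (BwCoinsA E sh κ)).bind fun c =>
      (PMF.uniformOfFintype (BwIdxA sh → E.Coin κ)).map fun r =>
        (bwRandOfA (o κ x).phi (o κ x).xi (o κ x).rho c,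
          bwRecvOfA (fun i => E.enc κ (known κ x 1) 0 (r i)) (E.encMat κ (known κ x 0)
            (o κ x).gradQB c.2.2.2.2.2.2)) := by
  have hH : EPPT fun κ (z : X κ × BwCoinsA E sh κ) =>
      (PMF.uniformOfFintype (BwIdxA sh → E.Coin κ)).map fun r =>
        (bwRandOfA (o κ z.1).phi (o κ z.1).xi (o κ z.1).rho z.2,
          bwRecvOfA (fun i => E.enc κ (known κ z.1 1) 0 (r i)) (E.encMat κ (known κ z.1 0)
            (o κ z.1).gradQB z.2.2.2.2.2.2.2)) := by
    have hu : EPPT fun κ (_ : X κ × BwCoinsA E sh κ) =>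
      PMF.uniformOfFintype (BwIdxA sh → E.Coin κ) := EPPT.uniform_pi eppt_coin
    have c : PolyFn fun κ (z : (X κ × BwCoinsA E sh κ) × (BwIdxA sh → E.Coin κ)) => z := PolyFn.id
    have hk' := hk.comp c.fst.fst
    have ho' := ho.comp c.fst.fst
    have hr := PolyFn.bwRandOfA (φ := fun κ (z : (X κ × BwCoinsA E sh κ) ×
      (BwIdxA sh → E.Coin κ)) => (o κ z.1.1).phi) (fun j => ho' (.inl j))
      (ξ := fun κ z => (o κ z.1.1).xi) (fun j => ho' (.inr (.inl j)))
      (ρ := fun κ z => (o κ z.1.1).rho) (fun j => ho' (.inr (.inr (.inl j)))) c.fst.snd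
    have hq : PolyFn fun κ (z : (X κ × BwCoinsA E sh κ) × (BwIdxA sh → E.Coin κ)) =>
      (o κ z.1.1).gradQB := fun j => ho' (.inr (.inr (.inr j)))
    have hm := PolyFn.bwRecvOfA (C := fun κ (z : (X κ × BwCoinsA E sh κ) ×
      (BwIdxA sh → E.Coin κ)) i => E.enc κ (known κ z.1.1 1) 0 (z.2 i)) (fun i =>
        hE.polyFn_enc (hk'.ofStrs 1) hE.polyFn_zero (c.snd.ofPi i))
      (hE.polyFn_encMat (hk'.ofStrs 0) hq c.fst.snd.snd.snd.snd.snd.snd.snd)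
    exact hu.map (hr.pair hm)
  exact eppt_bwCoinsA.bind hH

theorem PolyFn.bwResA (hE : E.Efficient) {known : ∀ κ, X κ → Strs (Fin 3)} (hk : PolyFn known)
    {a : ∀ κ, X κ → BwInputA E sh κ} (ha : PolyFn a)
    {b : ∀ κ, X κ → BwInputB E sh κ} (hb : PolyFn b)
    {n : ∀ κ, X κ → BwMasks E sh κ × BwCoinsA E sh κ} (hn : PolyFn n)
    {C : ∀ κ, X κ → BwIdxA sh → Str} (hC : PolyFn C) :
    PolyFn fun κ x => bwResA κ (known κ x) (a κ x) (b κ x) (n κ x) (C κ x) := by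
  have hr := PolyFn.bwRandOfA hn.fst.fst hn.fst.snd.fst hn.fst.snd.snd.fst hn.snd
  have hq := hE.polyFn_matSub (PolyFn.gradQB hE ha.bwA_layer hb.bwB_layer hb.bwB_gradZ)
    hn.fst.snd.snd.snd
  have hm := PolyFn.bwRecvOfA (fun i => hC.ofPi i)
    (hE.polyFn_encMat (hk.ofStrs 0) hq hn.snd.snd.snd.snd.snd.snd.snd)
  exact (hr.pair hm).pair (PolyFn.bwOut hE ha hb hn.fst)

theorem PolyFn.bwPlainA (hE : E.Efficient) {a : ∀ κ, X κ → BwInputA E sh κ} (ha : PolyFn a)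
    {b : ∀ κ, X κ → BwInputB E sh κ} (hb : PolyFn b)
    {s : ∀ κ, X κ → BwMasks E sh κ} (hs : PolyFn s) :
    PolyFn fun κ x => bwPlainA (a κ x) (b κ x) (s κ x) := by
  have hZ := hb.bwB_gradZ
  have hZV := hE.polyFn_matMul hZ hb.bwB_layer.layer_Vother.transpose
  have hWA := hE.polyFn_matSub (PolyFn.gradWA hE ha.bwA_layer hb.bwB_layer hZ) hs.fst
  have hWB := hE.polyFn_matSub (PolyFn.gradWB hE ha.bwA_layer hb.bwB_layer hZ) hs.snd.fst
  have hQA := hE.polyFn_matSub (PolyFn.gradQA hE ha.bwA_layer hb.bwB_layer hZ) hs.snd.snd.fst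
  refine PolyFn.toPi fun i => ?_
  rcases i with i | i | i | i | i
  · exact hZ.ofMatrix i.1 i.2
  · exact hZV.ofMatrix i.1 i.2
  · exact hWA.ofMatrix i.1 i.2
  · exact hWB.ofMatrix i.1 i.2
  · exact hQA.ofMatrix i.1 i.2

end EPPT

theorem eppt_bwViewA (hE : E.Efficient) : EPPT (bwViewA E sh) := by
  have c : PolyFn fun κ (z : Strs (Fin 3) × BwInputA E sh κ × BwOutputA E sh κ) => z := PolyFn.id
  exact eppt_bwSimA hE c.fst c.snd.snd

end BwSecurity

/-! ### From hybrid views to simulators -/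

section HybridSecurity

variable {E : HEScheme} {F : Functionality} {pr : Protocol F} {P : Party} {ι : Type} [Fintype ι]
  [DecidableEq ι] {N : ℕ → Type} {ο : Type} [Fintype ο] [∀ κ, StrEnc ο (N κ)]

/-- A view that is statistically close to one with encryptions under the key of the other party
can be simulated if it can be sampled with encryptions of zero. -/
theorem exists_simulator_of_hybrid (hE : E.Efficient) (hCPA : E.INDCPA) {ν ν' : ∀ κ, PMF (N κ)}
    (hν' : IsPPT fun κ (_ : Empty → Str) => (ν' κ).map StrEnc.toStrs) {δ : ℕ → ℝ}
    (hδ : Negligible δ) (hνν' : ∀ κ, Close (δ κ) (ν κ) (ν' κ))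
    {res : ∀ κ, (Fin 3 → Str) → (F.Inp .A).T κ → (F.Inp .B).T κ → N κ → (ι → Str) →
      pr.Result P κ}
    (hres : PolyFn fun κ (z : Strs (Fin 3) × ((F.Inp .A).T κ × (F.Inp .B).T κ) × N κ ×
      (ι → Str)) => res κ z.1 z.2.1.1 z.2.1.2 z.2.2.1 z.2.2.2)
    {msg : ∀ κ, (F.Inp .A).T κ → (F.Inp .B).T κ → N κ → ι → E.R κ}
    (hmsg : PolyFn fun κ (z : ((F.Inp .A).T κ × (F.Inp .B).T κ) × N κ) =>
      msg κ z.1.1 z.1.2 z.2)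
    {ε : ℕ → ℝ} (hε : Negligible ε)
    (hreal : ∀ κ, ∀ k ∈ (E.keys κ).support, ∀ a b, F.Admissible κ k a b →
      Close (ε κ) (realView pr P κ k a b) (hybridView E ν res msg κ k a b))
    {V : pr.ViewSampler P} (hV : EPPT V)
    (hideal : ∀ κ k a b, idealView V κ k a b =
      hybridView E ν res (fun _ _ _ _ _ => 0) κ k a b)
    {α : Type} [Fintype α] {adv : ℕ → (pr.ViewIdx P → Str) → PMF (α → Str)} (hadv : IsPPT adv) :
    ∃ sim : ℕ → (Fin 3 ⊕ (F.Inp P).Idx ⊕ (F.Out P).Idx → Str) → PMF (α → Str), IsPPT sim ∧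
      ∀ (σ : Type) [Fintype σ] (choose : Chooser F σ)
        (dist : ℕ → (FinalIdx F σ α → Str) → PMF (Unit → Str)),
        AdmissibleChooser E F P choose → IsPPT dist →
        Negligible fun κ =>
          |accept (real E pr P adv choose dist κ) - accept (ideal E F P sim choose dist κ)| := by
  obtain ⟨sim, hsim, hs⟩ := exists_simulator (E := E) hadv hV
  refine ⟨sim, hsim, fun σ _ choose dist hc hdist => ?_⟩
  have hcpa := interaction_hybrid_zero hE hCPA hν' hres hmsg hadv hc hdist
  -- The term `δ` enters twice: the reduction can sample only `ν'`, while the real and the ideal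
  -- experiment use `ν`, so the masks are exchanged before the chosen-plaintext step and exchanged
  -- back after it.
  refine Negligible.of_le ((hε.add hδ).add (hcpa.add hδ)) (fun _ => abs_nonneg _) fun κ => ?_
  have h₁ := interaction_close hreal adv hc dist κ
  have h₂ := interaction_close (fun κ k _ a b _ => hybridView_close (E := E) (hνν' κ) res msg k a b)
    adv hc dist κ
  have h₃ := interaction_close (E := E) (W := hybridView E ν' res fun _ _ _ _ _ => 0)
    (W' := idealView V) (ε := δ) (fun κ k _ a b _ => by
      rw [hideal]
      exact hybridView_close (E := E) (hνν' κ).symm res _ k a b) adv hc dist κ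
  rw [hs, real_eq_interaction]
  exact (abs_sub_le _ _ _).trans (add_le_add ((abs_sub_le _ _ _).trans (add_le_add h₁ h₂))
    ((abs_sub_le _ _ _).trans (add_le_add le_rfl h₃)))

end HybridSecurity

/-! ### The backward protocol with `A` corrupted -/

section BwSecurity

variable {E : HEScheme} {sh : Shape} {κ : ℕ}

theorem withCoins_uniform_bind {M C β : Type} [Fintype M] [Nonempty M] [Fintype C] [Nonempty C]
    (f : M × C → PMF β) :
    (withCoins C (PMF.uniformOfFintype M)).bind f = (PMF.uniformOfFintype (M × C)).bind f := by
  rw [withCoins, PMF.bind_bind, uniform_bind_prod]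
  refine congrArg _ (funext fun s => ?_)
  rw [PMF.bind_map]
  rfl

theorem withCoins_close {M : Type} (C : Type) [Fintype C] [Nonempty C] {μ μ' : PMF M} {ε : ℝ}
    (h : Close ε μ μ') : Close ε (withCoins C μ) (withCoins C μ') :=
  h.bind_left _

variable (E sh κ)

/-- The coins of `B` apart from those for its mask. -/
abbrev BwRestB : Type :=
  E.CoinMat κ sh.Batch sh.Outs × E.CoinMat κ sh.Batch (sh.Ins .A) ×
    E.CoinMat κ (sh.Ins .A) sh.Outs × E.CoinMat κ (sh.Ins .B) sh.Outs ×
    E.CoinMat κ (sh.Voc .A) (sh.Dim .A) × E.CoinMat κ sh.Batch (sh.Ins .B)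

/-- The randomness of an execution as seen by `A`, sorted by party. -/
def bwEquivA : ((BwMasks E sh κ × BwCoinsA E sh κ) × (BwIdxA sh → E.Coin κ)) ×
      E.CoinMat κ sh.Batch (sh.Ins .B) ≃
    BwRandA E sh κ × BwRestB E sh κ × E.Mat κ (sh.Voc .B) (sh.Dim .B) ×
      E.CoinMat κ (sh.Voc .B) (sh.Dim .B) where
  toFun x := (bwRandOfA x.1.1.1.1 x.1.1.1.2.1 x.1.1.1.2.2.1 x.1.1.2,
    (fun i j => x.1.2 (.inl (i, j)), fun i j => x.1.2 (.inr (.inl (i, j))),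
      fun i j => x.1.2 (.inr (.inr (.inl (i, j)))),
      fun i j => x.1.2 (.inr (.inr (.inr (.inl (i, j))))),
      fun i j => x.1.2 (.inr (.inr (.inr (.inr (i, j))))), x.2),
    x.1.1.1.2.2.2, x.1.1.2.2.2.2.2.2.2)
  invFun y := ((((E.mask κ y.1.phi, E.mask κ y.1.xi, E.mask κ y.1.rho, y.2.2.1),
      (y.1.phi.map Prod.snd, y.1.xi.map Prod.snd, y.1.rho.map Prod.snd, y.1.coinPhi, y.1.coinXi,
        y.1.coinQB, y.2.2.2)),
    Sum.elim (fun p => y.2.1.1 p.1 p.2) <| Sum.elim (fun p => y.2.1.2.1 p.1 p.2) <|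
      Sum.elim (fun p => y.2.1.2.2.1 p.1 p.2) <| Sum.elim (fun p => y.2.1.2.2.2.1 p.1 p.2)
        fun p => y.2.1.2.2.2.2.1 p.1 p.2), y.2.1.2.2.2.2.2)
  left_inv x := by
    refine Prod.ext (Prod.ext rfl (funext fun i => ?_)) rfl
    rcases i with i | i | i | i | i <;> rfl
  right_inv _ := rfl

variable {E sh κ} {k : Keys} {a : BwInputA E sh κ} {b : BwInputB E sh κ} {ε : ℝ}

/-- The result of an execution as seen by `A`, from its randomness, the coins of `B`, the mask
`ρ_B` and the message with `∇Q_B - ρ_B`. -/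
def bwJointA (k : Keys) (a : BwInputA E sh κ) (b : BwInputB E sh κ) (rA : BwRandA E sh κ)
    (z : BwRestB E sh κ) (τ : E.Mat κ (sh.Voc .B) (sh.Dim .B))
    (m : Matrix (sh.Voc .B) (sh.Dim .B) Str) :
    (BwRandA E sh κ × BwRecvA sh) × (BwOutputA E sh κ × BwOutputB E sh κ) :=
  ((rA,
    { cZ := E.encMat κ (k.pk .B) b.gradZ z.1
      cZV := E.encMat κ (k.pk .B) (b.gradZ * b.layer.Votherᵀ) z.2.1
      cWA := E.encMat κ (k.pk .B) (gradWA a.layer b.layer b.gradZ - E.mask κ rA.phi) z.2.2.1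
      cWB := E.encMat κ (k.pk .B) (gradWB a.layer b.layer b.gradZ - E.mask κ rA.xi) z.2.2.2.1
      mQB := m
      cQA := E.encMat κ (k.pk .B) (gradQA a.layer b.layer b.gradZ - E.mask κ rA.rho)
        z.2.2.2.2.1 }),
    bwOut a b (E.mask κ rA.phi, E.mask κ rA.xi, E.mask κ rA.rho, τ))

theorem realView_bw_A (hC : E.Correct) (hk : k ∈ (E.keys κ).support) (h : BwConsistent k a b) :
    realView (embedMatMulBw E sh) .A κ k a b =
      (PMF.uniformOfFintype (BwRandA E sh κ)).bind fun rA =>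
      (PMF.uniformOfFintype (BwRestB E sh κ)).bind fun z =>
      (PMF.uniformOfFintype (E.MaskMat κ (sh.Voc .B) (sh.Dim .B))).bind fun r =>
        PMF.pure (bwJointA k a b rA z (E.mask κ r) (E.he2ss κ (k.pk .A)
          (E.clkupBw κ (k.pk .A) (E.addMat κ (k.pk .A)
            (E.mulLeft κ (k.pk .A) b.gradZ b.layer.cVᵀ)
            (E.encMat κ (k.pk .A) (b.gradZ * b.layer.Uᵀ) z.2.2.2.2.2)) b.layer.X) r)) := by
  unfold realView
  refine congrArg _ (funext fun rA => ?_)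
  refine Eq.trans (uniform_bind_equiv (BwRandB.equiv E sh).symm _) ?_
  -- The transformation with mask ρ_B is drawn last, so that the ciphertext it is applied to,
  -- including the coins of the scalar addition, is already fixed when rerandomization is invoked.
  refine (uniform_bind_prod _).trans ((PMF.bind_comm _ _ _).trans ?_)
  refine congrArg _ (funext fun z => congrArg _ (funext fun r => congrArg PMF.pure ?_))
  refine Prod.ext (Prod.ext rfl ?_) (Prod.ext ?_ ?_)
  · exact bwRecv_fst hC hk h rA _
  · exact bwOutA_eq hC hk h rA _
  · exact bwOutB_eq hC hk h rA _

set_option synthInstance.maxSize 512 in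
theorem hybridView_bwResA (k : Keys) (a : BwInputA E sh κ) (b : BwInputB E sh κ) :
    hybridView (pr := embedMatMulBw E sh) (P := .A) E (fun κ => withCoins (BwCoinsA E sh κ) (PMF.uniformOfFintype (BwMasks E sh κ)))
      bwResA (fun _ a b n => bwPlainA a b n.1) κ k a b =
      (PMF.uniformOfFintype (BwRandA E sh κ)).bind fun rA =>
      (PMF.uniformOfFintype (BwRestB E sh κ)).bind fun z =>
      (PMF.uniformOfFintype (E.Mat κ (sh.Voc .B) (sh.Dim .B))).bind fun τ =>
      (PMF.uniformOfFintype (E.CoinMat κ (sh.Voc .B) (sh.Dim .B))).bind fun c =>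
        PMF.pure (bwJointA k a b rA z τ
          (E.encMat κ (k.pk .A) (gradQB a.layer b.layer b.gradZ - τ) c)) := by
  have e : ∀ K : BwRandA E sh κ × BwRestB E sh κ × E.Mat κ (sh.Voc .B) (sh.Dim .B) ×
      E.CoinMat κ (sh.Voc .B) (sh.Dim .B) → PMF ((BwRandA E sh κ × BwRecvA sh) ×
        (BwOutputA E sh κ × BwOutputB E sh κ)),
      ((PMF.uniformOfFintype (BwRandA E sh κ)).bind fun rA =>
      (PMF.uniformOfFintype (BwRestB E sh κ)).bind fun z =>
      (PMF.uniformOfFintype (E.Mat κ (sh.Voc .B) (sh.Dim .B))).bind fun τ =>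
      (PMF.uniformOfFintype (E.CoinMat κ (sh.Voc .B) (sh.Dim .B))).bind fun c =>
        K (rA, z, τ, c)) =
      (PMF.uniformOfFintype (BwMasks E sh κ × BwCoinsA E sh κ)).bind fun n =>
      (PMF.uniformOfFintype (BwIdxA sh → E.Coin κ)).bind fun r =>
      (PMF.uniformOfFintype (E.CoinMat κ sh.Batch (sh.Ins .B))).bind fun c =>
        K (bwEquivA E sh κ ((n, r), c)) := by
    intro K
    have h := uniform_bind_equiv (bwEquivA E sh κ) K
    simp only [uniform_bind_prod] at h ⊢
    exact h
  refine Eq.trans ?_ (e fun y => PMF.pure (bwJointA k a b y.1 y.2.1 y.2.2.1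
    (E.encMat κ (k.pk .A) (gradQB a.layer b.layer b.gradZ - y.2.2.1) y.2.2.2))).symm
  unfold hybridView
  refine (withCoins_uniform_bind _).trans ?_
  refine congrArg _ (funext fun n => congrArg _ (funext fun r => ?_))
  -- In the hybrid the message with ∇Q_B - ρ_B is a fresh encryption. The coins of the scalar
  -- addition of ∇Z U_Bᵀ, carried along to match the randomness of `B`, no longer occur and average
  -- out.
  exact (PMF.bind_const _ _).symm

/-- Only one of the messages to `A` is under its own key. Its mask ρ_B is an output of `B`, so the
continuation in `he2ss_close` must depend on the mask; everything else already agrees with the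
hybrid. -/
theorem realView_bw_A_close (hC : E.Correct) (hk : k ∈ (E.keys κ).support)
    (h : BwConsistent k a b)
    (hR : ∀ u v c, E.IsCipher κ (k.pk .A) u c →
      statDist ((PMF.uniformOfFintype (E.Coin κ)).map fun r =>
          E.add κ (k.pk .A) c (E.enc κ (k.pk .A) v r))
        ((PMF.uniformOfFintype (E.Coin κ)).map fun r => E.enc κ (k.pk .A) (u + v) r) ≤ ε) :
    Close (Fintype.card (sh.Voc .B) * (Fintype.card (sh.Dim .B) * (2 * ε)))
      (realView (embedMatMulBw E sh) .A κ k a b)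
      (hybridView (pr := embedMatMulBw E sh) (P := .A) E (fun κ => withCoins (BwCoinsA E sh κ)
        (PMF.uniformOfFintype (BwMasks E sh κ))) bwResA (fun _ a b n => bwPlainA a b n.1)
        κ k a b) := by
  rw [realView_bw_A hC hk h, hybridView_bwResA]
  refine Close.bind_right fun rA _ => Close.bind_right fun z _ => ?_
  exact he2ss_close hR (isCipher_gradQB h z.2.2.2.2.2) fun τ m =>
    PMF.pure (bwJointA k a b rA z τ m)

set_option synthInstance.maxSize 512 in
set_option synthInstance.maxHeartbeats 200000 in
theorem exists_simulator_bw_A (hE : E.Efficient) (hC : E.Correct) (hR : E.Rerandomizing)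
    (hCPA : E.INDCPA) {α : Type} [Fintype α]
    {adv : ℕ → ((embedMatMulBw E sh).ViewIdx .A → Str) → PMF (α → Str)} (hadv : IsPPT adv) :
    ∃ sim : ℕ → (Fin 3 ⊕ ((FEmbedMatMulBw E sh).Inp .A).Idx ⊕
        ((FEmbedMatMulBw E sh).Out .A).Idx → Str) → PMF (α → Str), IsPPT sim ∧
      ∀ (σ : Type) [Fintype σ] (choose : Chooser (FEmbedMatMulBw E sh) σ)
        (dist : ℕ → (FinalIdx (FEmbedMatMulBw E sh) σ α → Str) → PMF (Unit → Str)),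
        AdmissibleChooser E (FEmbedMatMulBw E sh) .A choose → IsPPT dist →
        Negligible fun κ => |accept (real E (embedMatMulBw E sh) .A adv choose dist κ) -
          accept (ideal E (FEmbedMatMulBw E sh) .A sim choose dist κ)| := by
  obtain ⟨G, δ, hδ, hGδ, hG⟩ := hE.exists_sampler
  obtain ⟨ε, hε, hR⟩ := hR
  have hG' : EPPT fun κ (_ : Unit) => G κ := EPPT.const hG
  have hν : IsPPT fun κ (_ : Empty → Str) =>
      (withCoins (BwCoinsA E sh κ) (bwMasksPMF sh (G κ))).map StrEnc.toStrs :=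
    ((eppt_bwMasksPMF (sh := sh) hG').prod eppt_bwCoinsA).isPPT_of_unit
  have c : PolyFn fun κ (z : Strs (Fin 3) × (BwInputA E sh κ × BwInputB E sh κ) ×
    (BwMasks E sh κ × BwCoinsA E sh κ) × (BwIdxA sh → Str)) => z := PolyFn.id
  have hres := PolyFn.bwResA hE c.fst c.snd.fst.fst c.snd.fst.snd c.snd.snd.fst c.snd.snd.snd
  have d : PolyFn fun κ (z : (BwInputA E sh κ × BwInputB E sh κ) ×
    (BwMasks E sh κ × BwCoinsA E sh κ)) => z := PolyFn.id
  have hmsg := PolyFn.bwPlainA hE d.fst.fst d.fst.snd d.snd.fst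
  exact exists_simulator_of_hybrid (pr := embedMatMulBw E sh) hE hCPA
    (ν := fun κ => withCoins (BwCoinsA E sh κ) (PMF.uniformOfFintype (BwMasks E sh κ))) hν
    (hδ.const_mul (bwCount sh)) (fun κ => withCoins_close _ (by
      rw [← bwMasksPMF_uniform]
      exact bwMasksPMF_close (hGδ κ)))
    (res := bwResA) hres (msg := fun _ a b n => bwPlainA a b n.1) hmsg
    (((hε.const_mul 2).const_mul _).const_mul _) (fun κ k hk a b hab =>
      realView_bw_A_close hC hk hab (hR κ _ (HEScheme.mem_support_keygen_of_keys hk .A)))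
    (eppt_bwViewA hE) (fun κ k a b => idealView_bwViewA k a b) hadv

end BwSecurity

/-! ### The backward protocol with `B` corrupted -/

section BwSecurityB

variable (E : HEScheme) (sh : Shape) (κ : ℕ)

/-- Coins in the view of `B`, apart from those of the encryptions under the key of `A`: for its
mask, for its own encryptions, and for the messages with the shares of `∇W_A`, `∇W_B`, `∇Q_A`. -/
abbrev BwCoinsB : Type :=
  E.CoinMat κ (sh.Voc .B) (sh.Dim .B) × BwRestB E sh κ × E.CoinMat κ (sh.Ins .A) sh.Outs ×
    E.CoinMat κ (sh.Ins .B) sh.Outs × E.CoinMat κ (sh.Voc .A) (sh.Dim .A)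

/-- Index set of the ciphertexts under the key of `A` that `B` receives. -/
abbrev BwIdxB : Type :=
  sh.Ins .A × sh.Outs ⊕ sh.Ins .B × sh.Outs ⊕ sh.Voc .B × sh.Dim .B

variable {E sh κ}

/-- The randomness of `B` with a given mask. -/
def bwRandOfB (τ : E.Mat κ (sh.Voc .B) (sh.Dim .B)) (c : BwCoinsB E sh κ) : BwRandB E sh κ where
  rho := maskMat τ c.1
  coinZ := c.2.1.1
  coinZV := c.2.1.2.1
  coinWA := c.2.1.2.2.1
  coinWB := c.2.1.2.2.2.1
  coinQA := c.2.1.2.2.2.2.1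
  coinZU := c.2.1.2.2.2.2.2

/-- The messages for `B`, from the ciphertexts under the key of `A`, the input of `B`, its shares
of the gradients, and the coins of the messages with these shares. -/
def bwRecvOfB (pk : Str) (b : BwInputB E sh κ) (o : BwOutputB E sh κ) (c : BwCoinsB E sh κ)
    (C : BwIdxB sh → Str) : BwRecvB sh where
  mWA := E.encMat κ pk (o.gradWA - b.shareᵀ * b.gradZ) c.2.2.1
  mWB := E.encMat κ pk (o.gradWB - b.psiᵀ * b.gradZ) c.2.2.2.1
  cPhi i j := C (.inl (i, j))
  cXi i j := C (.inr (.inl (i, j)))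
  mQA := E.encMat κ pk o.gradQA c.2.2.2.2
  cQB i j := C (.inr (.inr (i, j)))

/-- The plaintexts of the ciphertexts under the key of `A` that `B` receives. -/
def bwPlainB (a : BwInputA E sh κ) (b : BwInputB E sh κ) (s : BwMasks E sh κ) :
    BwIdxB sh → E.R κ :=
  Sum.elim (fun p => s.1 p.1 p.2) <| Sum.elim (fun p => s.2.1 p.1 p.2)
    fun p => (gradQB a.layer b.layer b.gradZ - s.2.2.2) p.1 p.2

/-- The result of an execution as seen by `B`. -/
def bwResB (κ : ℕ) (known : Fin 3 → Str) (a : BwInputA E sh κ) (b : BwInputB E sh κ)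
    (n : BwMasks E sh κ × BwCoinsB E sh κ) (C : BwIdxB sh → Str) :
    (embedMatMulBw E sh).Result .B κ :=
  ((bwRandOfB n.1.2.2.2 n.2, bwRecvOfB (known 1) b (bwOut a b n.1).2 n.2 C), bwOut a b n.1)

variable (E sh)

/-- The simulated view of `B` in the backward protocol. -/
def bwViewB : (embedMatMulBw E sh).ViewSampler .B :=
  fun κ (x : Strs (Fin 3) × BwInputB E sh κ × BwOutputB E sh κ) =>
  (PMF.uniformOfFintype (BwCoinsB E sh κ)).bind fun c =>
  (PMF.uniformOfFintype (BwIdxB sh → E.Coin κ)).map fun r =>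
    ((bwRandOfB x.2.2.rho c, bwRecvOfB (x.1 1) x.2.1 x.2.2 c fun i => E.enc κ (x.1 0) 0 (r i)) :
      BwRandB E sh κ × BwRecvB sh)

variable {E sh}

/-- As for `A`, an exact identity. The plaintexts of the messages under the key of `B` are recovered
from its output shares by subtracting the products it adds locally, and the mask ρ_B is itself an
output. -/
theorem idealView_bwViewB (k : Keys) (a : BwInputA E sh κ) (b : BwInputB E sh κ) :
    idealView (bwViewB E sh) κ k a b = hybridView E
      (fun κ => withCoins (BwCoinsB E sh κ) (PMF.uniformOfFintype (BwMasks E sh κ)))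
      bwResB (fun _ _ _ _ _ => 0) κ k a b := by
  unfold idealView hybridView withCoins
  refine (PMF.bind_map _ _ _).trans ?_
  refine Eq.trans ?_ (PMF.bind_bind _ _ _).symm
  refine congrArg _ (funext fun s => ?_)
  refine (PMF.map_bind _ _ _).trans ?_
  refine Eq.trans ?_ (PMF.bind_map _ _ _).symm
  refine congrArg _ (funext fun c => ?_)
  exact PMF.map_comp _ _ _

section EPPT

variable {ι : Type} [Fintype ι] {X : ℕ → Type} [∀ κ, StrEnc ι (X κ)]

theorem PolyFn.bwRandOfB {τ : ∀ κ, X κ → E.Mat κ (sh.Voc .B) (sh.Dim .B)} (hτ : PolyFn τ)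
    {c : ∀ κ, X κ → BwCoinsB E sh κ} (hc : PolyFn c) :
    PolyFn fun κ x => bwRandOfB (τ κ x) (c κ x) :=
  (hτ.maskMat hc.fst).pair hc.snd.fst

theorem PolyFn.bwRecvOfB (hE : E.Efficient) {pk : ∀ κ, X κ → Str} (hpk : PolyFn pk)
    {b : ∀ κ, X κ → BwInputB E sh κ} (hb : PolyFn b)
    {o : ∀ κ, X κ → BwOutputB E sh κ} (ho : PolyFn o)
    {c : ∀ κ, X κ → BwCoinsB E sh κ} (hc : PolyFn c)
    {C : ∀ κ, X κ → BwIdxB sh → Str} (hC : ∀ i, PolyFn fun κ x => C κ x i) :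
    PolyFn fun κ x => bwRecvOfB (pk κ x) (b κ x) (o κ x) (c κ x) (C κ x) := by
  have hWA : PolyFn fun κ x => (o κ x).gradWA := fun j => ho (.inl j)
  have hWB : PolyFn fun κ x => (o κ x).gradWB := fun j => ho (.inr (.inl j))
  have hQA : PolyFn fun κ x => (o κ x).gradQA := fun j => ho (.inr (.inr (.inl j)))
  have h₁ := hE.polyFn_encMat hpk (hE.polyFn_matSub hWA
    (hE.polyFn_matMul hb.bwB_share.transpose hb.bwB_gradZ)) hc.snd.snd.fst
  have h₂ := hE.polyFn_encMat hpk (hE.polyFn_matSub hWB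
    (hE.polyFn_matMul hb.bwB_psi.transpose hb.bwB_gradZ)) hc.snd.snd.snd.fst
  have h₃ := hE.polyFn_encMat hpk hQA hc.snd.snd.snd.snd
  intro j
  rcases j with j | j | j | j | j | j
  · exact h₁ j
  · exact h₂ j
  · exact hC _ ()
  · exact hC _ ()
  · exact h₃ j
  · exact hC _ ()

set_option synthInstance.maxSize 512 in
theorem eppt_bwCoinsB : EPPT fun κ (_ : X κ) => PMF.uniformOfFintype (BwCoinsB E sh κ) :=
  .uniform_prod eppt_coinMat (.uniform_prod
    (.uniform_prod eppt_coinMat (.uniform_prod eppt_coinMat (.uniform_prod eppt_coinMat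
      (.uniform_prod eppt_coinMat (.uniform_prod eppt_coinMat eppt_coinMat)))))
    (.uniform_prod eppt_coinMat (.uniform_prod eppt_coinMat eppt_coinMat)))

theorem eppt_bwSimB (hE : E.Efficient) {known : ∀ κ, X κ → Strs (Fin 3)} (hk : PolyFn known)
    {b : ∀ κ, X κ → BwInputB E sh κ} (hb : PolyFn b)
    {o : ∀ κ, X κ → BwOutputB E sh κ} (ho : PolyFn o) :
    EPPT fun κ x => (PMF.uniformOfFintype (BwCoinsB E sh κ)).bind fun c =>
      (PMF.uniformOfFintype (BwIdxB sh → E.Coin κ)).map fun r =>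
        (bwRandOfB (o κ x).rho c, bwRecvOfB (known κ x 1) (b κ x) (o κ x) c
          fun i => E.enc κ (known κ x 0) 0 (r i)) := by
  have hH : EPPT fun κ (z : X κ × BwCoinsB E sh κ) =>
      (PMF.uniformOfFintype (BwIdxB sh → E.Coin κ)).map fun r =>
        (bwRandOfB (o κ z.1).rho z.2, bwRecvOfB (known κ z.1 1) (b κ z.1) (o κ z.1) z.2
          fun i => E.enc κ (known κ z.1 0) 0 (r i)) := by
    have hu : EPPT fun κ (_ : X κ × BwCoinsB E sh κ) =>
      PMF.uniformOfFintype (BwIdxB sh → E.Coin κ) := EPPT.uniform_pi eppt_coin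
    have c : PolyFn fun κ (z : (X κ × BwCoinsB E sh κ) × (BwIdxB sh → E.Coin κ)) => z := PolyFn.id
    have hk' := hk.comp c.fst.fst
    have ho' := ho.comp c.fst.fst
    have hr := PolyFn.bwRandOfB (τ := fun κ (z : (X κ × BwCoinsB E sh κ) ×
      (BwIdxB sh → E.Coin κ)) => (o κ z.1.1).rho) (fun j => ho' (.inr (.inr (.inr j)))) c.fst.snd
    have hm := PolyFn.bwRecvOfB hE (hk'.ofStrs 1) (hb.comp c.fst.fst) ho' c.fst.snd
      (C := fun κ (z : (X κ × BwCoinsB E sh κ) × (BwIdxB sh → E.Coin κ)) i =>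
        E.enc κ (known κ z.1.1 0) 0 (z.2 i)) (fun i =>
          hE.polyFn_enc (hk'.ofStrs 0) hE.polyFn_zero (c.snd.ofPi i))
    exact hu.map (hr.pair hm)
  exact eppt_bwCoinsB.bind hH

theorem PolyFn.bwResB (hE : E.Efficient) {known : ∀ κ, X κ → Strs (Fin 3)} (hk : PolyFn known)
    {a : ∀ κ, X κ → BwInputA E sh κ} (ha : PolyFn a)
    {b : ∀ κ, X κ → BwInputB E sh κ} (hb : PolyFn b)
    {n : ∀ κ, X κ → BwMasks E sh κ × BwCoinsB E sh κ} (hn : PolyFn n)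
    {C : ∀ κ, X κ → BwIdxB sh → Str} (hC : PolyFn C) :
    PolyFn fun κ x => bwResB κ (known κ x) (a κ x) (b κ x) (n κ x) (C κ x) := by
  have ho := PolyFn.bwOut hE ha hb hn.fst
  have hr := PolyFn.bwRandOfB hn.fst.snd.snd.snd hn.snd
  have hm := PolyFn.bwRecvOfB hE (hk.ofStrs 1) hb ho.snd hn.snd (fun i => hC.ofPi i)
  exact (hr.pair hm).pair ho

theorem PolyFn.bwPlainB (hE : E.Efficient) {a : ∀ κ, X κ → BwInputA E sh κ} (ha : PolyFn a)
    {b : ∀ κ, X κ → BwInputB E sh κ} (hb : PolyFn b)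
    {s : ∀ κ, X κ → BwMasks E sh κ} (hs : PolyFn s) :
    PolyFn fun κ x => bwPlainB (a κ x) (b κ x) (s κ x) := by
  have hQB := hE.polyFn_matSub (PolyFn.gradQB hE ha.bwA_layer hb.bwB_layer hb.bwB_gradZ)
    hs.snd.snd.snd
  refine PolyFn.toPi fun i => ?_
  rcases i with i | i | i
  · exact hs.fst.ofMatrix i.1 i.2
  · exact hs.snd.fst.ofMatrix i.1 i.2
  · exact hQB.ofMatrix i.1 i.2

end EPPT

theorem eppt_bwViewB (hE : E.Efficient) : EPPT (bwViewB E sh) := by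
  have c : PolyFn fun κ (z : Strs (Fin 3) × BwInputB E sh κ × BwOutputB E sh κ) => z := PolyFn.id
  exact eppt_bwSimB hE c.fst c.snd.fst c.snd.snd

variable (E sh κ)

/-- The coins of `A` apart from those for its masks. -/
abbrev BwRestA : Type :=
  E.CoinMat κ (sh.Ins .A) sh.Outs × E.CoinMat κ (sh.Ins .B) sh.Outs ×
    E.CoinMat κ (sh.Voc .B) (sh.Dim .B)

/-- The randomness of an execution as seen by `B`, sorted by party and mask. -/
def bwEquivB : (BwMasks E sh κ × BwCoinsB E sh κ) × (BwIdxB sh → E.Coin κ) ≃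
    BwRandB E sh κ × E.Mat κ (sh.Ins .A) sh.Outs × E.CoinMat κ (sh.Ins .A) sh.Outs ×
      E.Mat κ (sh.Ins .B) sh.Outs × E.CoinMat κ (sh.Ins .B) sh.Outs ×
        E.Mat κ (sh.Voc .A) (sh.Dim .A) × E.CoinMat κ (sh.Voc .A) (sh.Dim .A) ×
          BwRestA E sh κ where
  toFun x := (bwRandOfB x.1.1.2.2.2 x.1.2, x.1.1.1, x.1.2.2.2.1, x.1.1.2.1, x.1.2.2.2.2.1,
    x.1.1.2.2.1, x.1.2.2.2.2.2, (fun i j => x.2 (.inl (i, j)),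
      fun i j => x.2 (.inr (.inl (i, j))), fun i j => x.2 (.inr (.inr (i, j)))))
  invFun y := (((y.2.1, y.2.2.2.1, y.2.2.2.2.2.1, E.mask κ y.1.rho),
      (y.1.rho.map Prod.snd, (y.1.coinZ, y.1.coinZV, y.1.coinWA, y.1.coinWB, y.1.coinQA,
        y.1.coinZU), y.2.2.1, y.2.2.2.2.1, y.2.2.2.2.2.2.1)),
    Sum.elim (fun p => y.2.2.2.2.2.2.2.1 p.1 p.2) <|
      Sum.elim (fun p => y.2.2.2.2.2.2.2.2.1 p.1 p.2) fun p => y.2.2.2.2.2.2.2.2.2 p.1 p.2)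
  left_inv x := by
    refine Prod.ext rfl (funext fun i => ?_)
    rcases i with i | i | i <;> rfl
  right_inv _ := rfl

variable {E sh κ} {k : Keys} {a : BwInputA E sh κ} {b : BwInputB E sh κ} {ε : ℝ}

/-- The result of an execution as seen by `B`, from its randomness, the masks of `A` with the
messages that contain them, and the other coins of `A`. -/
def bwJointB (k : Keys) (a : BwInputA E sh κ) (b : BwInputB E sh κ) (rB : BwRandB E sh κ)
    (φ : E.Mat κ (sh.Ins .A) sh.Outs) (mφ : Matrix (sh.Ins .A) sh.Outs Str)
    (ξ : E.Mat κ (sh.Ins .B) sh.Outs) (mξ : Matrix (sh.Ins .B) sh.Outs Str)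
    (ρ : E.Mat κ (sh.Voc .A) (sh.Dim .A)) (mρ : Matrix (sh.Voc .A) (sh.Dim .A) Str)
    (z : BwRestA E sh κ) :
    (BwRandB E sh κ × BwRecvB sh) × (BwOutputA E sh κ × BwOutputB E sh κ) :=
  ((rB,
    { mWA := mφ
      mWB := mξ
      cPhi := E.encMat κ (k.pk .A) φ z.1
      cXi := E.encMat κ (k.pk .A) ξ z.2.1
      mQA := mρ
      cQB := E.encMat κ (k.pk .A) (gradQB a.layer b.layer b.gradZ - E.mask κ rB.rho) z.2.2 }),
    bwOut a b (φ, ξ, ρ, E.mask κ rB.rho))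

theorem realView_bw_B (hC : E.Correct) (hk : k ∈ (E.keys κ).support) (h : BwConsistent k a b) :
    realView (embedMatMulBw E sh) .B κ k a b =
      (PMF.uniformOfFintype (BwRandB E sh κ)).bind fun rB =>
      (PMF.uniformOfFintype (E.MaskMat κ (sh.Ins .A) sh.Outs)).bind fun r₁ =>
      (PMF.uniformOfFintype (E.MaskMat κ (sh.Ins .B) sh.Outs)).bind fun r₂ =>
      (PMF.uniformOfFintype (E.MaskMat κ (sh.Voc .A) (sh.Dim .A))).bind fun r₃ =>
      (PMF.uniformOfFintype (BwRestA E sh κ)).bind fun z =>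
        PMF.pure (bwJointB k a b rB
          (E.mask κ r₁) (E.he2ss κ (k.pk .B) (E.mulLeft κ (k.pk .B) a.psiᵀ
            (E.encMat κ (k.pk .B) b.gradZ rB.coinZ)) r₁)
          (E.mask κ r₂) (E.he2ss κ (k.pk .B) (E.mulLeft κ (k.pk .B) a.shareᵀ
            (E.encMat κ (k.pk .B) b.gradZ rB.coinZ)) r₂)
          (E.mask κ r₃) (E.he2ss κ (k.pk .B) (E.clkupBw κ (k.pk .B) (E.addMat κ (k.pk .B)
            (E.mulRight κ (k.pk .B) (E.encMat κ (k.pk .B) b.gradZ rB.coinZ) a.layer.Uᵀ)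
            (E.encMat κ (k.pk .B) (b.gradZ * b.layer.Votherᵀ) rB.coinZV)) a.layer.X) r₃) z) := by
  unfold realView
  refine (PMF.bind_comm _ _ _).trans ?_
  refine congrArg _ (funext fun rB => ?_)
  refine Eq.trans (uniform_bind_equiv (BwRandA.equiv E sh).symm _) ?_
  refine (uniform_bind_prod _).trans (congrArg _ (funext fun r₁ => ?_))
  refine (uniform_bind_prod _).trans (congrArg _ (funext fun r₂ => ?_))
  refine (uniform_bind_prod _).trans (congrArg _ (funext fun r₃ => ?_))
  refine congrArg _ (funext fun z => congrArg PMF.pure ?_)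
  refine Prod.ext (Prod.ext rfl ?_) (Prod.ext ?_ ?_)
  · exact bwRecv_snd hC hk h _ rB
  · exact bwOutA_eq hC hk h _ rB
  · exact bwOutB_eq hC hk h _ rB

set_option synthInstance.maxSize 512 in
theorem hybridView_bwResB (k : Keys) (a : BwInputA E sh κ) (b : BwInputB E sh κ) :
    hybridView (pr := embedMatMulBw E sh) (P := .B) E
      (fun κ => withCoins (BwCoinsB E sh κ) (PMF.uniformOfFintype (BwMasks E sh κ)))
      bwResB (fun _ a b n => bwPlainB a b n.1) κ k a b =
      (PMF.uniformOfFintype (BwRandB E sh κ)).bind fun rB =>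
      (PMF.uniformOfFintype (E.Mat κ (sh.Ins .A) sh.Outs)).bind fun φ =>
      (PMF.uniformOfFintype (E.CoinMat κ (sh.Ins .A) sh.Outs)).bind fun c₁ =>
      (PMF.uniformOfFintype (E.Mat κ (sh.Ins .B) sh.Outs)).bind fun ξ =>
      (PMF.uniformOfFintype (E.CoinMat κ (sh.Ins .B) sh.Outs)).bind fun c₂ =>
      (PMF.uniformOfFintype (E.Mat κ (sh.Voc .A) (sh.Dim .A))).bind fun ρ =>
      (PMF.uniformOfFintype (E.CoinMat κ (sh.Voc .A) (sh.Dim .A))).bind fun c₃ =>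
      (PMF.uniformOfFintype (BwRestA E sh κ)).bind fun z =>
        PMF.pure (bwJointB k a b rB
          φ (E.encMat κ (k.pk .B)
            (gradWA a.layer b.layer b.gradZ - φ - b.shareᵀ * b.gradZ) c₁)
          ξ (E.encMat κ (k.pk .B) (gradWB a.layer b.layer b.gradZ - ξ - b.psiᵀ * b.gradZ) c₂)
          ρ (E.encMat κ (k.pk .B) (gradQA a.layer b.layer b.gradZ - ρ) c₃) z) := by
  have e := uniform_bind_equiv (bwEquivB E sh κ) fun y => PMF.pure (bwJointB k a b y.1
    y.2.1 (E.encMat κ (k.pk .B)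
      (gradWA a.layer b.layer b.gradZ - y.2.1 - b.shareᵀ * b.gradZ) y.2.2.1)
    y.2.2.2.1 (E.encMat κ (k.pk .B)
      (gradWB a.layer b.layer b.gradZ - y.2.2.2.1 - b.psiᵀ * b.gradZ) y.2.2.2.2.1)
    y.2.2.2.2.2.1 (E.encMat κ (k.pk .B)
      (gradQA a.layer b.layer b.gradZ - y.2.2.2.2.2.1) y.2.2.2.2.2.2.1) y.2.2.2.2.2.2.2)
  refine Eq.trans ?_ (e.symm.trans ?_)
  · unfold hybridView
    refine (withCoins_uniform_bind _).trans (Eq.trans ?_ (uniform_bind_prod _).symm)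
    rfl
  · refine (uniform_bind_prod _).trans (congrArg _ (funext fun rB => ?_))
    refine (uniform_bind_prod _).trans (congrArg _ (funext fun φ => ?_))
    refine (uniform_bind_prod _).trans (congrArg _ (funext fun c₁ => ?_))
    refine (uniform_bind_prod _).trans (congrArg _ (funext fun ξ => ?_))
    refine (uniform_bind_prod _).trans (congrArg _ (funext fun c₂ => ?_))
    refine (uniform_bind_prod _).trans (congrArg _ (funext fun ρ => ?_))
    exact uniform_bind_prod _

variable (sh) in
/-- The number of entries of the masks of `A`. -/
def bwCountA : ℝ :=
  Fintype.card (sh.Ins .A) * Fintype.card sh.Outs +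
    (Fintype.card (sh.Ins .B) * Fintype.card sh.Outs +
      Fintype.card (sh.Voc .A) * Fintype.card (sh.Dim .A))

/-- The three transformations of `A` are made fresh one after another, each time with the later ones
in the continuation. The coins of `B` are fixed beforehand, because the ciphertexts being masked are
built from its encryptions of ∇Z and ∇Z V_Aᵀ. -/
theorem realView_bw_B_close (hC : E.Correct) (hk : k ∈ (E.keys κ).support)
    (h : BwConsistent k a b)
    (hR : ∀ u v c, E.IsCipher κ (k.pk .B) u c →
      statDist ((PMF.uniformOfFintype (E.Coin κ)).map fun r =>
          E.add κ (k.pk .B) c (E.enc κ (k.pk .B) v r))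
        ((PMF.uniformOfFintype (E.Coin κ)).map fun r => E.enc κ (k.pk .B) (u + v) r) ≤ ε) :
    Close (bwCountA sh * (2 * ε)) (realView (embedMatMulBw E sh) .B κ k a b)
      (hybridView (pr := embedMatMulBw E sh) (P := .B) E
        (fun κ => withCoins (BwCoinsB E sh κ) (PMF.uniformOfFintype (BwMasks E sh κ)))
        bwResB (fun _ a b n => bwPlainB a b n.1) κ k a b) := by
  rw [realView_bw_B hC hk h, hybridView_bwResB]
  -- The simulator subtracts its local product from the share ∇W - φ or ∇W - ξ, whereas the
  -- transformation masks the ciphertext of ∇W minus that product; the two orders of subtraction are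
  -- reconciled here.
  simp only [sub_right_comm _ _ (b.shareᵀ * b.gradZ), sub_right_comm _ _ (b.psiᵀ * b.gradZ)]
  refine Close.mono ?_ (le_of_eq (by rw [bwCountA]; ring) : Fintype.card (sh.Ins .A) *
    (Fintype.card sh.Outs * (2 * ε)) + (Fintype.card (sh.Ins .B) * (Fintype.card sh.Outs * (2 * ε))
      + Fintype.card (sh.Voc .A) * (Fintype.card (sh.Dim .A) * (2 * ε))) ≤ _)
  refine Close.bind_right fun rB _ => ?_
  refine Close.trans (he2ss_close hR (isCipher_gradWA h rB.coinZ) fun φ mφ =>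
    (PMF.uniformOfFintype (E.MaskMat κ (sh.Ins .B) sh.Outs)).bind fun r₂ =>
    (PMF.uniformOfFintype (E.MaskMat κ (sh.Voc .A) (sh.Dim .A))).bind fun r₃ =>
    (PMF.uniformOfFintype (BwRestA E sh κ)).bind fun z => PMF.pure (bwJointB k a b rB φ mφ
      (E.mask κ r₂) (E.he2ss κ (k.pk .B) (E.mulLeft κ (k.pk .B) a.shareᵀ
        (E.encMat κ (k.pk .B) b.gradZ rB.coinZ)) r₂)
      (E.mask κ r₃) (E.he2ss κ (k.pk .B) (E.clkupBw κ (k.pk .B) (E.addMat κ (k.pk .B)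
        (E.mulRight κ (k.pk .B) (E.encMat κ (k.pk .B) b.gradZ rB.coinZ) a.layer.Uᵀ)
        (E.encMat κ (k.pk .B) (b.gradZ * b.layer.Votherᵀ) rB.coinZV)) a.layer.X) r₃) z)) ?_
  refine Close.bind_right fun φ _ => Close.bind_right fun c₁ _ => ?_
  refine Close.trans (he2ss_close hR (isCipher_gradWB h rB.coinZ) fun ξ mξ =>
    (PMF.uniformOfFintype (E.MaskMat κ (sh.Voc .A) (sh.Dim .A))).bind fun r₃ =>
    (PMF.uniformOfFintype (BwRestA E sh κ)).bind fun z => PMF.pure (bwJointB k a b rB φ _ ξ mξ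
      (E.mask κ r₃) (E.he2ss κ (k.pk .B) (E.clkupBw κ (k.pk .B) (E.addMat κ (k.pk .B)
        (E.mulRight κ (k.pk .B) (E.encMat κ (k.pk .B) b.gradZ rB.coinZ) a.layer.Uᵀ)
        (E.encMat κ (k.pk .B) (b.gradZ * b.layer.Votherᵀ) rB.coinZV)) a.layer.X) r₃) z)) ?_
  refine Close.bind_right fun ξ _ => Close.bind_right fun c₂ _ => ?_
  exact he2ss_close hR (isCipher_gradQA a b rB.coinZ rB.coinZV) fun ρ mρ =>
    (PMF.uniformOfFintype (BwRestA E sh κ)).bind fun z =>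
      PMF.pure (bwJointB k a b rB φ _ ξ _ ρ mρ z)

set_option synthInstance.maxSize 512 in
set_option synthInstance.maxHeartbeats 200000 in
theorem exists_simulator_bw_B (hE : E.Efficient) (hC : E.Correct) (hR : E.Rerandomizing)
    (hCPA : E.INDCPA) {α : Type} [Fintype α]
    {adv : ℕ → ((embedMatMulBw E sh).ViewIdx .B → Str) → PMF (α → Str)} (hadv : IsPPT adv) :
    ∃ sim : ℕ → (Fin 3 ⊕ ((FEmbedMatMulBw E sh).Inp .B).Idx ⊕
        ((FEmbedMatMulBw E sh).Out .B).Idx → Str) → PMF (α → Str), IsPPT sim ∧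
      ∀ (σ : Type) [Fintype σ] (choose : Chooser (FEmbedMatMulBw E sh) σ)
        (dist : ℕ → (FinalIdx (FEmbedMatMulBw E sh) σ α → Str) → PMF (Unit → Str)),
        AdmissibleChooser E (FEmbedMatMulBw E sh) .B choose → IsPPT dist →
        Negligible fun κ => |accept (real E (embedMatMulBw E sh) .B adv choose dist κ) -
          accept (ideal E (FEmbedMatMulBw E sh) .B sim choose dist κ)| := by
  obtain ⟨G, δ, hδ, hGδ, hG⟩ := hE.exists_sampler
  obtain ⟨ε, hε, hR⟩ := hR
  have hG' : EPPT fun κ (_ : Unit) => G κ := EPPT.const hG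
  have hν : IsPPT fun κ (_ : Empty → Str) =>
      (withCoins (BwCoinsB E sh κ) (bwMasksPMF sh (G κ))).map StrEnc.toStrs :=
    ((eppt_bwMasksPMF (sh := sh) hG').prod eppt_bwCoinsB).isPPT_of_unit
  have c : PolyFn fun κ (z : Strs (Fin 3) × (BwInputA E sh κ × BwInputB E sh κ) ×
    (BwMasks E sh κ × BwCoinsB E sh κ) × (BwIdxB sh → Str)) => z := PolyFn.id
  have hres := PolyFn.bwResB hE c.fst c.snd.fst.fst c.snd.fst.snd c.snd.snd.fst c.snd.snd.snd
  have d : PolyFn fun κ (z : (BwInputA E sh κ × BwInputB E sh κ) ×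
    (BwMasks E sh κ × BwCoinsB E sh κ)) => z := PolyFn.id
  have hmsg := PolyFn.bwPlainB hE d.fst.fst d.fst.snd d.snd.fst
  exact exists_simulator_of_hybrid (pr := embedMatMulBw E sh) hE hCPA
    (ν := fun κ => withCoins (BwCoinsB E sh κ) (PMF.uniformOfFintype (BwMasks E sh κ))) hν
    (hδ.const_mul (bwCount sh)) (fun κ => withCoins_close _ (by
      rw [← bwMasksPMF_uniform]
      exact bwMasksPMF_close (hGδ κ)))
    (res := bwResB) hres (msg := fun _ a b n => bwPlainB a b n.1) hmsg
    ((hε.const_mul 2).const_mul _) (fun κ k hk a b hab =>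
      realView_bw_B_close hC hk hab (hR κ _ (HEScheme.mem_support_keygen_of_keys hk .B)))
    (eppt_bwViewB hE) (fun κ k a b => idealView_bwViewB k a b) hadv

theorem securelyRealizes_bw (hE : E.Efficient) (hC : E.Correct) (hR : E.Rerandomizing)
    (hCPA : E.INDCPA) : SecurelyRealizes E (embedMatMulBw E sh) := by
  intro P α _ adv hadv
  cases P with
  | A => exact exists_simulator_bw_A hE hC hR hCPA hadv
  | B => exact exists_simulator_bw_B hE hC hR hCPA hadv

end BwSecurityB

end BlindFL

end

theorem mainTheorem2 (E : BlindFL.HEScheme) (hEff : E.Efficient) (hCorrect : E.Correct)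
    (hRerand : E.Rerandomizing) (hCPA : E.INDCPA) (sh : BlindFL.Shape) :
    BlindFL.SecurelyRealizes E (BlindFL.embedMatMulFw E sh) ∧
    BlindFL.SecurelyRealizes E (BlindFL.embedMatMulBw E sh) ∧
    BlindFL.UpdatesModels E sh := by
  exact ⟨BlindFL.securelyRealizes_fw hEff hCorrect hRerand,
    BlindFL.securelyRealizes_bw hEff hCorrect hRerand hCPA, BlindFL.updatesModels hCorrect⟩
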